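/- **Q-CIRCUIT.** Fix a finite set $\mathcal G$ of elementary gates (unitary operators, each on a bounded number of qubits). For a real number $\gamma$, the promise problem $\textsf{Q-CIRCUIT}_\gamma$ over $\mathcal G$ is the following. An instance is a quantum circuit $U=U_N\cdots U_1$ on $n\ge 1$ qubits with gates from $\mathcal G$, together with a string $x\in\{0,1\}^n$. It is a YES instance if $\|(|1\rangle\langle 1|\otimes I_{n-1})\,U|x\rangle\|^2\ge 1-\gamma$ and a NO instance if $\|(|1\rangle\langle 1|\otimes I_{n-1})\,U|x\rangle\|^2\le\gamma$. **Quantum prover interactive proofs.** A $\textsf{QPIP}_\kappa$ verifier consists of a probabilistic polynomial-time classical machine and a register of $\kappa$ qubits. The classical machine controls which unitary operators (from a finite list of arbitrary unitaries on the $\kappa$ qubits) and which standard-basis measurements are performed on the register, and it uses the measurement outcomes. The verifier exchanges qubits of the register with the prover through a quantum channel, exchanges bits with the prover through a classical channel, takes polynomially many steps, and never holds more than $\kappa$ qubits. An honest prover is a polynomial-time quantum (BQP) machine: for each interaction it applies to the message and to polynomially many private qubits a quantum circuit, over a fixed universal gate set, that is generated in polynomial time. A promise problem has a $\textsf{QPIP}_\kappa$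 with completeness $c$ and soundness $s$ (against unbounded provers) if there are a verifier and an honest prover such that on every YES instance the verifier accepts with probability at least $c$ when interacting with the honest prover, and on every NO instance he accepts with probability at most $s$ when interacting with any prover whatsoever, that is, with arbitrary unitary operations on the messages and on a private quantum register of any finite dimension. **Theorem.** For every $a\in\mathbb N$ there is a constant $C$ such that the following holds for every finite gate set $\mathcal G$ whose gates act on at most $a$ qubits each. Let $0<\epsilon<1$ and $\gamma<1-\epsilon$. Then for some $\kappa\le C\,(1+\log(1/\epsilon))$ the promise problem $\textsf{Q-CIRCUIT}_\gamma$ over $\mathcal G$ has a $\textsf{QPIP}_\kappa$ with completeness $1-\gamma$ and soundness $\epsilon+\gamma$, where soundness holds against computationally unbounded provers. -/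

import Mathlib

open Computability

namespace QPIP

noncomputable section

/-! ### Quantum circuits -/

/-- The group of unitary operators on a register whose standard basis is labelled by `B`. -/
abbrev Unitary (B : Type) [Fintype B] [DecidableEq B] : Type :=
  Matrix.unitaryGroup B ℂ

/-- A finite set of elementary gates; the gate `g` is a unitary operator on `arity g` qubits. -/
structure GateSet where
  Op : Type
  [fintypeOp : Fintype Op]
  arity : Op → ℕ
  mat : (g : Op) → Unitary (Fin (arity g) → Bool)

attribute [instance] GateSet.fintypeOp

/-- A gate of a circuit: an elementary gate with the ordered list of qubits it is applied to. -/
structure Gate (G : GateSet) where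
  op : G.Op
  wires : List ℕ

/-- The gate is correctly applied in an `n`-qubit circuit: to the right number of
pairwise distinct qubits among `0, …, n - 1`. -/
def Gate.Valid {G : GateSet} (g : Gate G) (n : ℕ) : Prop :=
  g.wires.length = G.arity g.op ∧ g.wires.Nodup ∧ ∀ w ∈ g.wires, w < n

/-- The operator on `n` qubits that applies `U` to the qubits `e 0, …, e (a - 1)` and the identity
to the others. -/
def embed {n a : ℕ} (e : Fin a → Fin n) (U : Matrix (Fin a → Bool) (Fin a → Bool) ℂ) :
    Matrix (Fin n → Bool) (Fin n → Bool) ℂ :=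
  fun y x => if ∀ j, (∀ i, e i ≠ j) → y j = x j then U (y ∘ e) (x ∘ e) else 0

theorem embed_mul {n a : ℕ} {e : Fin a → Fin n} (he : Function.Injective e)
    (U V : Matrix (Fin a → Bool) (Fin a → Bool) ℂ) :
    embed e U * embed e V = embed e (U * V) := by
  classical
  ext y x
  simp only [Matrix.mul_apply, embed]
  by_cases hyx : ∀ j, (∀ i, e i ≠ j) → y j = x j
  · rw [if_pos hyx]
    symm
    refine Finset.sum_of_injOn
      (fun w : Fin a → Bool => fun j => if h : ∃ i, e i = j then w h.choose else y j) ?_ ?_ ?_ ?_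
    · intro w _ w' _ h
      funext i
      have hi : ∃ i', e i' = e i := ⟨i, rfl⟩
      have h1 := congrFun h (e i)
      simp only [dif_pos hi] at h1
      rwa [he hi.choose_spec] at h1
    · simp
    · intro z _ hz
      by_cases h : ∀ j, (∀ i, e i ≠ j) → y j = z j
      · exfalso
        apply hz
        refine ⟨z ∘ e, by simp, ?_⟩
        funext j
        by_cases hj : ∃ i, e i = j
        · simp only [dif_pos hj, Function.comp_apply, hj.choose_spec]
        · simp only [dif_neg hj]
          exact h j (fun i hi => hj ⟨i, hi⟩)
      · rw [if_neg h, zero_mul]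
    · intro w _
      have h1 : ∀ j, (∀ i, e i ≠ j) →
          (if h : ∃ i, e i = j then w h.choose else y j) = y j := by
        intro j hj
        rw [dif_neg]
        rintro ⟨i, hi⟩
        exact hj i hi
      have h2 : (fun j => if h : ∃ i, e i = j then w h.choose else y j) ∘ e = w := by
        funext i
        have hi : ∃ i', e i' = e i := ⟨i, rfl⟩
        simp only [Function.comp_apply, dif_pos hi, he hi.choose_spec]
      rw [if_pos (fun j hj => (h1 j hj).symm), if_pos (fun j hj => (h1 j hj).trans (hyx j hj)), h2]
  · rw [if_neg hyx]
    refine Finset.sum_eq_zero fun z _ => ?_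
    by_cases h : ∀ j, (∀ i, e i ≠ j) → y j = z j
    · by_cases h' : ∀ j, (∀ i, e i ≠ j) → z j = x j
      · exact absurd (fun j hj => (h j hj).trans (h' j hj)) hyx
      · rw [if_neg h', mul_zero]
    · rw [if_neg h, zero_mul]

theorem embed_one {n a : ℕ} (e : Fin a → Fin n) : embed e 1 = 1 := by
  classical
  ext y x
  simp only [embed, Matrix.one_apply]
  by_cases hyx : y = x
  · subst hyx
    simp
  · rw [if_neg hyx]
    split_ifs with h h'
    · exfalso
      apply hyx
      funext j
      by_cases hj : ∃ i, e i = j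
      · obtain ⟨i, rfl⟩ := hj
        exact congrFun h' i
      · exact h j (fun i hi => hj ⟨i, hi⟩)
    · rfl
    · rfl

theorem star_embed {n a : ℕ} (e : Fin a → Fin n) (U : Matrix (Fin a → Bool) (Fin a → Bool) ℂ) :
    star (embed e U) = embed e (star U) := by
  ext y x
  simp only [Matrix.star_apply, embed]
  by_cases h : ∀ j, (∀ i, e i ≠ j) → y j = x j
  · rw [if_pos h, if_pos (fun j hj => (h j hj).symm)]
  · rw [if_neg h, if_neg (fun h' => h fun j hj => (h' j hj).symm), star_zero]

theorem embed_mem {n a : ℕ} {e : Fin a → Fin n} (he : Function.Injective e)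
    (U : Unitary (Fin a → Bool)) : embed e U.1 ∈ Matrix.unitaryGroup (Fin n → Bool) ℂ := by
  rw [Matrix.mem_unitaryGroup_iff, star_embed, embed_mul he,
    Matrix.mem_unitaryGroup_iff.1 U.2, embed_one]

open Classical in
/-- The operator of a gate in an `n`-qubit circuit (the identity if the gate is not valid). -/
def Gate.unitary {G : GateSet} (n : ℕ) (g : Gate G) : Unitary (Fin n → Bool) :=
  if h : g.Valid n then
    ⟨embed (fun i : Fin (G.arity g.op) =>
        (⟨g.wires[i.val]'(by rw [h.1]; exact i.isLt), h.2.2 _ (List.getElem_mem _)⟩ : Fin n))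
      (G.mat g.op).1, embed_mem (fun i j hij => by
        have h1 := congrArg Fin.val hij
        exact Fin.ext ((h.2.1.getElem_inj_iff).1 h1)) (G.mat g.op)⟩
  else 1

/-- The operator `U_N ⋯ U_1` of the circuit with the list of gates `[U_1, …, U_N]`. -/
def circuitUnitary {G : GateSet} (n : ℕ) : List (Gate G) → Unitary (Fin n → Bool)
  | [] => 1
  | g :: c => circuitUnitary n c * g.unitary n

/-- Symbols used to write down circuits. -/
inductive Token (G : GateSet) where
  | op (g : G.Op)
  | tick
  | sep

/-- A gate is written as its name, followed by its qubits in unary, each ended by `sep`. -/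
def Gate.encode {G : GateSet} (g : Gate G) : List (Token G) :=
  Token.op g.op :: g.wires.flatMap fun w => List.replicate w Token.tick ++ [Token.sep]

/-- One step of the parser, which reads a word from right to left and keeps the wires that
wait for their gate and the gates read so far. -/
def parseStep {G : GateSet} : Token G → List ℕ × List (Gate G) → List ℕ × List (Gate G)
  | .op g, (ws, c) => ([], ⟨g, ws⟩ :: c)
  | .tick, (ws, c) => (ws.modifyHead (· + 1), c)
  | .sep, (ws, c) => (0 :: ws, c)

theorem parse_wires {G : GateSet} (ws ws' : List ℕ) (c : List (Gate G)) :
    (ws.flatMap fun w => List.replicate w Token.tick ++ [Token.sep]).foldr parseStep (ws', c) =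
      (ws ++ ws', c) := by
  have key : ∀ w v l, (List.replicate w (Token.tick (G := G))).foldr parseStep (v :: l, c) =
      ((v + w) :: l, c) := by
    intro w
    induction w with
    | zero => intro v l; rfl
    | succ w ih =>
      intro v l
      rw [List.replicate_succ, List.foldr_cons, ih]
      simp [parseStep, add_assoc]
  induction ws with
  | nil => rfl
  | cons w ws ih =>
    rw [List.flatMap_cons, List.foldr_append, ih, List.foldr_append]
    simp [parseStep, key]

/-- The encoding of lists of gates as words. -/
def circuitEncoding (G : GateSet) : Encoding (List (Gate G)) (Token G) where
  encode c := c.flatMap Gate.encode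
  decode w := some (w.foldr parseStep ([], [])).2
  decode_encode c := by
    have : (c.flatMap Gate.encode).foldr parseStep ([], []) = (([] : List ℕ), c) := by
      induction c with
      | nil => rfl
      | cons g c ih =>
        rw [List.flatMap_cons, List.foldr_append, ih, Gate.encode, List.foldr_cons, parse_wires]
        simp [parseStep]
    rw [this]

/-! ### The promise problem Q-CIRCUIT -/

/-- An instance: a circuit on `n ≥ 1` qubits over the gate set `G`, and an input string. -/
structure Instance (G : GateSet) where
  n : ℕ
  pos : 0 < n
  gates : List (Gate G)
  valid : ∀ g ∈ gates, g.Valid n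
  input : Fin n → Bool

/-- The squared norm of `(|1⟩⟨1| ⊗ I) U |x⟩`. -/
def Instance.prob {G : GateSet} (I : Instance G) : ℝ :=
  ∑ y : Fin I.n → Bool,
    if y ⟨0, I.pos⟩ = true then
      ‖(circuitUnitary I.n I.gates).1.mulVec (Pi.single I.input 1) y‖ ^ 2
    else 0

/-- The alphabet of the words that describe instances. -/
abbrev Symbol (G : GateSet) : Type := Bool ⊕ Token G

/-- An instance is written as its input string followed by its gates. -/
def Instance.encode {G : GateSet} (I : Instance G) : List (Symbol G) :=
  (encodingProd (encodingList Bool) (circuitEncoding G)).encode (List.ofFn I.input, I.gates)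

/-- The YES instances of `Q-CIRCUIT_γ`. -/
def qCircuitYes (G : GateSet) (γ : ℝ) : Set (List (Symbol G)) :=
  {w | ∃ I : Instance G, w = I.encode ∧ 1 - γ ≤ I.prob}

/-- The NO instances of `Q-CIRCUIT_γ`. -/
def qCircuitNo (G : GateSet) (γ : ℝ) : Set (List (Symbol G)) :=
  {w | ∃ I : Instance G, w = I.encode ∧ I.prob ≤ γ}

/-! ### Verifiers -/

/-- The instructions that the classical part of the verifier can give, for a quantum register
of `κ` qubits. -/
inductive Instr (κ : ℕ) where
  /-- toss a fair coin -/
  | flip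
  /-- apply a unitary operator to the register -/
  | unitary (U : Unitary (Fin κ → Bool))
  /-- measure qubit `i` in the standard basis -/
  | measure (i : Fin κ)
  /-- hand qubit `i` over to the prover through the quantum channel and get a qubit back -/
  | exchange (i : Fin κ)
  /-- send the bit `b` to the prover through the classical channel and get a bit back -/
  | bit (b : Bool)
  | accept
  | reject

/-- A hybrid verifier with `κ` qubits for inputs over the alphabet `α`. In every round the classical
part computes, in polynomial time, the next instruction (one of finitely many) from the input and
the list of bits that it has obtained in the earlier rounds, the oldest first: a random bit, the
outcome of a measurement, a bit from the prover, or the dummy bit `false` in the other cases. The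
number of rounds is bounded by a polynomial in the length of the input. -/
structure Verifier (α : Type) (κ : ℕ) where
  Label : Type
  [fintypeLabel : Fintype Label]
  instr : Label → Instr κ
  next : List α × List Bool → Label
  polyTime : Nonempty (Turing.TM2ComputableInPolyTime
    (encodingProd (encodingList α) (encodingList Bool)).encode (fun l => [l]) next)
  rounds : Polynomial ℕ

/-! ### Provers -/

/-- The two channels. -/
inductive Channel where
  | quantum
  | classical

/-- The behaviour of a computationally unbounded quantum prover on a fixed input: a private register
of any finite dimension, its initial state, and for each interaction a unitary operator on
the message qubit and the private register. The operator may depend on the list of the channels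
used so far, the current one last. -/
structure Strategy where
  M : Type
  [fintypeM : Fintype M]
  [decEqM : DecidableEq M]
  init : M → ℂ
  norm_init : ∑ m, ‖init m‖ ^ 2 = 1
  act : List Channel → Unitary (Bool × M)

attribute [instance] Strategy.fintypeM Strategy.decEqM

/-- The Hadamard gate, the `π/8` gate and the controlled-NOT gate. -/
inductive StdOp where
  | H
  | T
  | CNOT
  deriving DecidableEq

instance : Fintype StdOp :=
  ⟨{.H, .T, .CNOT}, fun g => by cases g <;> simp⟩

def hadamard : Matrix (Fin 1 → Bool) (Fin 1 → Bool) ℂ :=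
  fun y x => (if y 0 && x 0 then -1 else 1) / (Real.sqrt 2 : ℂ)

def tGate : Matrix (Fin 1 → Bool) (Fin 1 → Bool) ℂ :=
  Matrix.diagonal fun x => if x 0 then Complex.exp (Real.pi / 4 * Complex.I) else 1

def cnot : Matrix (Fin 2 → Bool) (Fin 2 → Bool) ℂ :=
  fun y x => if y 0 = x 0 ∧ y 1 = xor (x 0) (x 1) then 1 else 0

theorem hadamard_mem : hadamard ∈ Matrix.unitaryGroup (Fin 1 → Bool) ℂ := by
  have h2 : (Real.sqrt 2 : ℂ) * (Real.sqrt 2 : ℂ) = 2 := by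
    rw [← Complex.ofReal_mul, Real.mul_self_sqrt (by norm_num)]
    norm_num
  have h0 : (Real.sqrt 2 : ℂ) ≠ 0 := by
    intro h
    rw [h] at h2
    norm_num at h2
  rw [Matrix.mem_unitaryGroup_iff]
  ext y x
  rw [Matrix.mul_apply, ← (Equiv.funUnique (Fin 1) Bool).symm.sum_comp]
  have hyx : y = x ↔ y 0 = x 0 := by
    constructor
    · rintro rfl
      rfl
    · intro h
      funext i
      rw [Subsingleton.elim i 0, h]
  rw [Matrix.one_apply]
  simp only [hyx, Fintype.sum_bool, Matrix.star_apply, hadamard]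
  cases hy : y 0 <;> cases hx : x 0 <;> simp [field] <;> simp [pow_two, h2] <;> norm_num

theorem tGate_mem : tGate ∈ Matrix.unitaryGroup (Fin 1 → Bool) ℂ := by
  rw [Matrix.mem_unitaryGroup_iff, tGate, Matrix.star_eq_conjTranspose,
    Matrix.diagonal_conjTranspose, Matrix.diagonal_mul_diagonal, ← Matrix.diagonal_one]
  congr 1
  funext x
  by_cases h : x 0 = true
  · simp only [h, if_true, Pi.star_apply, Complex.star_def]
    rw [← Complex.exp_conj, ← Complex.exp_add]
    simp [Complex.conj_ofNat]
  · simp [h]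

theorem cnot_mem : cnot ∈ Matrix.unitaryGroup (Fin 2 → Bool) ℂ := by
  rw [Matrix.mem_unitaryGroup_iff]
  ext y x
  rw [Matrix.mul_apply, Finset.sum_eq_single ![y 0, xor (y 0) (y 1)]]
  · have hyx : y = x ↔ y 0 = x 0 ∧ y 1 = x 1 := by
      simp [funext_iff, Fin.forall_fin_two]
    rw [Matrix.one_apply]
    simp only [hyx, Matrix.star_apply, cnot]
    cases y 0 <;> cases y 1 <;> cases x 0 <;> cases x 1 <;> simp
  · intro z _ hz
    have : ¬ (y 0 = z 0 ∧ y 1 = xor (z 0) (z 1)) := by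
      rintro ⟨h0, h1⟩
      apply hz
      funext i
      fin_cases i
      · simp [h0]
      · simp [h0, h1]
    simp [cnot, this]
  · simp

/-- The universal gate set of the honest prover. -/
def stdGates : GateSet where
  Op := StdOp
  arity
    | .H => 1
    | .T => 1
    | .CNOT => 2
  mat
    | .H => ⟨hadamard, hadamard_mem⟩
    | .T => ⟨tGate, tGate_mem⟩
    | .CNOT => ⟨cnot, cnot_mem⟩

/-- A prover who is a BQP machine: a polynomial number of private qubits, initially in the state
`|0⋯0⟩`, and for each interaction a quantum circuit that is computed in polynomial time from the
input and the list of the channels used so far. In the circuits, qubit `0` is the message qubit and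
the qubits from `1` on are the private ones. -/
structure BQPProver (α : Type) where
  width : Polynomial ℕ
  circuit : List α × List Channel → List (Gate stdGates)
  polyTime : Nonempty (Turing.TM2ComputableInPolyTime
    (encodingProd (encodingList α) (encodingList Channel)).encode
    (circuitEncoding stdGates).encode circuit)

/-- A unitary operator on `w + 1` qubits as an operator on qubit `0` and the remaining ones. -/
def splitFirst {w : ℕ} (U : Unitary (Fin (w + 1) → Bool)) : Unitary (Bool × (Fin w → Bool)) :=
  ⟨U.1.submatrix (Fin.consEquiv fun _ => Bool) (Fin.consEquiv fun _ => Bool), by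
    rw [Matrix.mem_unitaryGroup_iff, Matrix.star_eq_conjTranspose, Matrix.conjTranspose_submatrix,
      Matrix.submatrix_mul_equiv, ← Matrix.star_eq_conjTranspose,
      Matrix.mem_unitaryGroup_iff.1 U.2, Matrix.submatrix_one_equiv]⟩

/-- The strategy that a BQP prover follows on input `x`. -/
def BQPProver.strategy {α : Type} (P : BQPProver α) (x : List α) : Strategy where
  M := Fin (P.width.eval x.length) → Bool
  init := Pi.single (fun _ => false) 1
  norm_init := by
    rw [Finset.sum_eq_single (fun _ => false)]
    · simp
    · intro m _ hm
      simp [Pi.single_eq_of_ne hm]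
    · simp
  act l := splitFirst (circuitUnitary _ (P.circuit (x, l)))

/-! ### Interaction -/

/-- The probability that the verifier accepts within the next rounds (their number is the first
explicit argument), if he has obtained the bits `h`, the channels `l` have been used, and the
joint state of his register and the prover's private register is the vector `ψ`. Vectors are not
normalised: after a measurement the state is the projected vector, whose squared norm
is the probability of the outcome. Running out of rounds counts as rejection. -/
def run {α : Type} {κ : ℕ} (V : Verifier α κ) (S : Strategy) (x : List α) :
    ℕ → List Bool → List Channel → ((Fin κ → Bool) × S.M → ℂ) → ℝ
  | 0, h, _, ψ =>
    match V.instr (V.next (x, h)) with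
    | .accept => ∑ p, ‖ψ p‖ ^ 2
    | _ => 0
  | k + 1, h, l, ψ =>
    match V.instr (V.next (x, h)) with
    | .accept => ∑ p, ‖ψ p‖ ^ 2
    | .reject => 0
    | .flip => (run V S x k (h ++ [false]) l ψ + run V S x k (h ++ [true]) l ψ) / 2
    | .unitary U =>
      run V S x k (h ++ [false]) l fun p => ∑ q, U.1 p.1 q * ψ (q, p.2)
    | .measure i =>
      ∑ b : Bool, run V S x k (h ++ [b]) l fun p => if p.1 i = b then ψ p else 0
    | .exchange i =>
      run V S x k (h ++ [false]) (l ++ [.quantum]) fun p =>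
        ∑ r : Bool × S.M, (S.act (l ++ [.quantum])).1 (p.1 i, p.2) r *
          ψ (Function.update p.1 i r.1, r.2)
    | .bit b =>
      ∑ b' : Bool, run V S x k (h ++ [b']) (l ++ [.classical]) fun p =>
        ∑ m : S.M, (S.act (l ++ [.classical])).1 (b', p.2) (b, m) * ψ (p.1, m)

/-- The probability that `V` accepts the input `x` in interaction with the strategy `S`. The qubits
of the verifier are initially in the state `|0⋯0⟩`. -/
def acceptProb {α : Type} {κ : ℕ} (V : Verifier α κ) (S : Strategy) (x : List α) : ℝ :=
  run V S x (V.rounds.eval x.length) [] [] fun p =>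
    if p.1 = fun _ => false then S.init p.2 else 0

/-- The promise problem `(yes, no)` has a quantum prover interactive proof with a verifier of `κ`
qubits, completeness `c` (with a BQP prover) and soundness `s` (against unbounded provers). -/
def HasQPIP {α : Type} (κ : ℕ) (yes no : Set (List α)) (c s : ℝ) : Prop :=
  ∃ (V : Verifier α κ) (P : BQPProver α),
    (∀ x ∈ yes, c ≤ acceptProb V (P.strategy x) x) ∧
    ∀ x ∈ no, ∀ S : Strategy, acceptProb V S x ≤ s

end

end QPIP

/-! The verifier uses the prover only as a memory and executes the circuit himself. Each logical
qubit lives in a block of `3 * d` qubits, encoded by an authentication code with a secret key of `9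
* d` bits; the register holds one block and `a + 1` work qubits. For each wire of a gate all blocks
pass by once in cyclic order. Every block is decoded, its ancillas are measured (he rejects unless
all are `0`), the wanted qubit is exchanged with a work qubit, and the block is encoded with a fresh
key and sent back. Then the gate is applied to the work qubits, and the same passes put the qubits
back. The prover sees a pattern of exchanges that is fixed by the input, and an honest prover is
just a queue.

The code works over a field with `q = 2 ^ d` elements. A one-time pad of Pauli operators reduces
every attack to its Pauli components (`sum_pads`), and a nontrivial Pauli operator escapes detection
for at most `q ^ 2` of the `q ^ 3` inner keys (`card_undetected`). This gives `second_moment`, with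
error `δ = 1 / q`.

For soundness the keys are purified. Under a uniform key the amplitudes of the code form a scaled
orthonormal system, so averages over all keys are squared norms of a virtual state, in which the
prover was sent halves of maximally entangled blocks that carry no information about the data
(`realize`, `expect_norm_sq_realize`). Decoding with a random key is a random linear map whose mean
is the projection to the entangled state (`contract`). What happens later is accepted with a
probability that is an average of squared seminorms of the state, so its mean is its value at the
mean plus a variance (`HasVariance`), and the variance is at most `δ` times the norm lost in the
projection (`expect_decode_bounds`).

The projected state stays a product of the data, which undergo exactly the circuit, and the memory
of the prover. The errors telescope over the cycles: if `p` is the acceptance probability of the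
circuit and `F` the norm that survives all projections, the verifier accepts with a probability
between `p * F` and `p * F + δ * (1 - F)` (`script_bounds`, `acceptProb_bounds`). A queue has `F =
1` (`fidelity_prover`), which gives completeness; always `0 ≤ F ≤ 1`, which gives soundness. With
`d` about `log₂ (1 / ε)` one has `δ ≤ ε`.

The classical side consists of two polynomial-time claims. The verifier is a stack machine that
reads one bit per round (`Controller`), so his next instruction is found by replaying the history;
the circuits of the queue are written by an explicit stack machine with unary counters. -/

open Computability
namespace QPIP
noncomputable section

/-! ### Stack machines -/

/-- A machine with a read-only input stack, a write-only output stack and finitely many work stacks.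
In one step it may pop from every stack and then push words (the head of a word ends on top). -/
structure StackMachine (A O : Type) where
  Q : Type
  [finQ : Fintype Q]
  K : Type
  [finK : Fintype K]
  [decK : DecidableEq K]
  W : Type
  [finW : Fintype W]
  start : Q
  δ : Q → Option A → (K → Option W) → Option Q × Bool × List O × (K → Bool × List W)

attribute [instance] StackMachine.finQ StackMachine.finK StackMachine.decK StackMachine.finW

namespace StackMachine

variable {A O : Type}

/-- The effect on a stack of popping (if the flag is set) and pushing a word. -/
def act {X : Type} (p : Bool × List X) (s : List X) : List X :=
  p.2 ++ (if p.1 then s.tail else s)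

/-- A configuration; the state is `none` once the machine has halted. -/
@[ext] structure Conf (M : StackMachine A O) where
  q : Option M.Q
  inp : List A
  out : List O
  stk : M.K → List M.W

/-- One step (halted configurations do not change). -/
def step (M : StackMachine A O) (c : M.Conf) : M.Conf :=
  match c.q with
  | none => c
  | some q =>
    let r := M.δ q c.inp.head? (fun k => (c.stk k).head?)
    ⟨r.1, act (r.2.1, []) c.inp, act (false, r.2.2.1) c.out, fun k => act (r.2.2.2 k) (c.stk k)⟩

/-- The indices of the stacks of the associated `TM2` machine. -/
inductive Stk (K : Type) where
  | inp
  | out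
  | wk (k : K)
  deriving DecidableEq, Fintype

/-- The alphabets of the stacks of the associated `TM2` machine. -/
abbrev alph (M : StackMachine A O) : Stk M.K → Type
  | .inp => A
  | .out => O
  | .wk _ => M.W

/-- The symbols on top of the stacks. -/
abbrev Tops (M : StackMachine A O) : Type := Option A × (M.K → Option M.W)

abbrev Lab (M : StackMachine A O) : Type := M.Q ⊕ (M.Q × M.Tops)

abbrev TStmt (M : StackMachine A O) : Type := Turing.TM2.Stmt M.alph M.Lab M.Tops

def noTops (M : StackMachine A O) : M.Tops := (none, fun _ => none)

def peekAll (M : StackMachine A O) (p : M.TStmt) : List M.K → M.TStmt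
  | [] => p
  | k :: ks => .peek (.wk k) (fun v x => (v.1, Function.update v.2 k x)) (M.peekAll p ks)

def pushList (M : StackMachine A O) (k : Stk M.K) (p : M.TStmt) : List (M.alph k) → M.TStmt
  | [] => p
  | x :: l => M.pushList k (.push k (fun _ => x) p) l

def popIf (M : StackMachine A O) (k : Stk M.K) (b : Bool) (p : M.TStmt) : M.TStmt :=
  if b then .pop k (fun v _ => v) p else p

def actAll (M : StackMachine A O) (f : M.K → Bool × List M.W) (p : M.TStmt) : List M.K → M.TStmt
  | [] => p
  | k :: ks => M.popIf (.wk k) (f k).1 (M.pushList (.wk k) (M.actAll f p ks) (f k).2)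

def finish (M : StackMachine A O) : Option M.Q → M.TStmt
  | none => .load (fun _ => M.noTops) .halt
  | some q => .load (fun _ => M.noTops) (.goto fun _ => .inl q)

/-- A step is split in two: the first label collects the tops of all stacks and jumps to a label
that contains them, so that the second statement has the transition hard-wired. Resetting the
internal state in `finish` makes the `TM2` configuration a function of the abstract one. -/
def prog (M : StackMachine A O) : M.Lab → M.TStmt
  | .inl q => .peek .inp (fun v x => (x, v.2))
      (M.peekAll (.goto fun v => .inr (q, v)) Finset.univ.toList)
  | .inr (q, v) =>
    let r := M.δ q v.1 v.2
    M.popIf .inp r.2.1 (M.pushList .out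
      (M.actAll r.2.2.2 (M.finish r.1) Finset.univ.toList) r.2.2.1)

theorem stepAux_peekAll (M : StackMachine A O) (p : M.TStmt) (ks : List M.K) (v : M.Tops)
    (S : ∀ k, List (M.alph k)) :
    Turing.TM2.stepAux (M.peekAll p ks) v S =
      Turing.TM2.stepAux p
        (v.1, fun k => if k ∈ ks then (S (.wk k)).head? else v.2 k) S := by
  induction ks generalizing v with
  | nil => simp [peekAll]
  | cons k ks ih =>
    rw [peekAll, Turing.TM2.stepAux, ih]
    congr 2
    funext k'
    by_cases h : k' ∈ ks
    · simp [h]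
    · by_cases h' : k' = k
      · subst h'; simp
      · simp [h, h']

theorem stepAux_pushList (M : StackMachine A O) (k : Stk M.K) (p : M.TStmt)
    (l : List (M.alph k)) (v : M.Tops) (S : ∀ k, List (M.alph k)) :
    Turing.TM2.stepAux (M.pushList k p l) v S =
      Turing.TM2.stepAux p v (Function.update S k (l ++ S k)) := by
  induction l generalizing p with
  | nil => simp [pushList]
  | cons x l ih => rw [pushList, ih, Turing.TM2.stepAux]; simp

theorem stepAux_popIf (M : StackMachine A O) (k : Stk M.K) (b : Bool) (p : M.TStmt)
    (v : M.Tops) (S : ∀ k, List (M.alph k)) :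
    Turing.TM2.stepAux (M.popIf k b p) v S =
      Turing.TM2.stepAux p v (Function.update S k (if b then (S k).tail else S k)) := by
  cases b <;> simp [popIf]

theorem stepAux_actAll (M : StackMachine A O) (f : M.K → Bool × List M.W) (p : M.TStmt)
    (ks : List M.K) (hks : ks.Nodup) (v : M.Tops) (S S' : ∀ k, List (M.alph k))
    (hi : S' .inp = S .inp) (ho : S' .out = S .out)
    (hw : ∀ k, S' (.wk k) = if k ∈ ks then act (f k) (S (.wk k)) else S (.wk k)) :
    Turing.TM2.stepAux (M.actAll f p ks) v S = Turing.TM2.stepAux p v S' := by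
  induction ks generalizing S with
  | nil =>
    have : S' = S := by
      funext k
      cases k with
      | inp => exact hi
      | out => exact ho
      | wk k => simpa using hw k
    rw [actAll, this]
  | cons k ks ih =>
    rw [actAll, stepAux_popIf, stepAux_pushList]
    refine ih (List.nodup_cons.1 hks).2 _ (by simp [hi]) (by simp [ho]) fun k' => ?_
    rw [hw k']
    by_cases h : k' = k
    · subst h
      simp [(List.nodup_cons.1 hks).1, act]
    · simp [h]


/-- The associated `TM2` machine. -/
def toTM [Fintype A] (M : StackMachine A O) : Turing.FinTM2 where
  K := Stk M.K
  k₀ := .inp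
  k₁ := .out
  Γ := M.alph
  Λ := M.Lab
  main := .inl M.start
  σ := M.Tops
  initialState := M.noTops
  Γk₀Fin := inferInstanceAs (Fintype A)
  m := M.prog

def stackOf (M : StackMachine A O) (c : M.Conf) : ∀ k, List (M.alph k)
  | .inp => c.inp
  | .out => c.out
  | .wk k => c.stk k

def toCfg [Fintype A] (M : StackMachine A O) (c : M.Conf) : M.toTM.Cfg :=
  ⟨c.q.map .inl, M.noTops, M.stackOf c⟩

/-- A configuration of the `TM2` machine. -/
def plainCfg (M : StackMachine A O) (c : M.Conf) : Turing.TM2.Cfg M.alph M.Lab M.Tops :=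
  ⟨c.q.map .inl, M.noTops, M.stackOf c⟩

theorem step_peek (M : StackMachine A O) (c : M.Conf) (q : M.Q) (hq : c.q = some q) :
    Turing.TM2.step M.prog (M.plainCfg c) =
      some ⟨some (.inr (q, c.inp.head?, fun k => (c.stk k).head?)),
        (c.inp.head?, fun k => (c.stk k).head?), M.stackOf c⟩ := by
  rw [plainCfg, hq]
  simp only [Option.map_some, Turing.TM2.step, prog, Turing.TM2.stepAux, stepAux_peekAll]
  simp [stackOf]

theorem step_act (M : StackMachine A O) (c : M.Conf) (q : M.Q) (hq : c.q = some q) :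
    Turing.TM2.step M.prog ⟨some (.inr (q, c.inp.head?, fun k => (c.stk k).head?)),
        (c.inp.head?, fun k => (c.stk k).head?), M.stackOf c⟩ =
      some (M.plainCfg (M.step c)) := by
  simp only [Turing.TM2.step, prog, stepAux_popIf, stepAux_pushList]
  rw [stepAux_actAll (S' := M.stackOf (M.step c)) (hks := Finset.nodup_toList _)]
  · have hs : (M.step c).q = (M.δ q c.inp.head? fun k => (c.stk k).head?).1 := by
      simp [step, hq]
    rw [← hs]
    cases h : (M.step c).q <;> simp [finish, Turing.TM2.stepAux, plainCfg, h]
  · simp [stackOf, step, hq, act]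
  · simp [stackOf, step, hq, act]
  · simp [stackOf, step, hq]

theorem step_toCfg [Fintype A] (M : StackMachine A O) (c : M.Conf) (hc : c.q ≠ none) :
    (flip bind M.toTM.step)^[2] (some (M.toCfg c)) = some (M.toCfg (M.step c)) := by
  obtain ⟨q, hq⟩ := Option.ne_none_iff_exists'.1 hc
  change (Turing.TM2.step M.prog (M.plainCfg c)).bind (Turing.TM2.step M.prog) =
    some (M.plainCfg (M.step c))
  rw [M.step_peek c q hq]
  exact M.step_act c q hq

/-- The initial configuration. -/
def initConf (M : StackMachine A O) (w : List A) : M.Conf := ⟨some M.start, w, [], fun _ => []⟩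

/-- Only an upper bound for the number of steps is claimed, because halted configurations are fixed
by `step` while `TM2` has no step there; idle iterations have to be dropped. -/
theorem reaches_toCfg [Fintype A] (M : StackMachine A O) (c c' : M.Conf) (n : ℕ) (h : M.step^[n] c = c') :
    ∃ n' ≤ 2 * n, (flip bind M.toTM.step)^[n'] (some (M.toCfg c)) = some (M.toCfg c') := by
  induction n generalizing c with
  | zero => exact ⟨0, le_rfl, by simpa using congrArg _ h⟩
  | succ n ih =>
    by_cases hc : c.q = none
    · have : M.step c = c := by simp [step, hc]
      rw [Function.iterate_succ_apply, this] at h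
      obtain ⟨n', h1, h2⟩ := ih c h
      exact ⟨n', by omega, h2⟩
    · rw [Function.iterate_succ_apply] at h
      obtain ⟨n', h1, h2⟩ := ih _ h
      refine ⟨n' + 2, by omega, ?_⟩
      rw [Function.iterate_add_apply, step_toCfg M c hc, h2]

/-- A machine that halts with all stacks but the output stack empty yields a function that is
computable in polynomial time. -/
theorem polyTime_of_clean [Fintype A] {α β : Type} {ea : α → List A} {eb : β → List O} {f : α → β}
    (M : StackMachine A O) (p : Polynomial ℕ)
    (h : ∀ a, ∃ n ≤ p.eval (ea a).length,
      M.step^[n] (M.initConf (ea a)) = ⟨none, [], eb (f a), fun _ => []⟩) :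
    Nonempty (Turing.TM2ComputableInPolyTime ea eb f) := by
  refine ⟨⟨⟨M.toTM, Equiv.refl A, Equiv.refl O⟩, 2 * p, fun a => ?_⟩⟩
  choose n hn hs using h
  choose n' hn' hs' using fun a => M.reaches_toCfg _ _ _ (hs a)
  refine ⟨⟨n' a, ?_⟩, ?_⟩
  · have := hs' a
    have e1 : M.toCfg (M.initConf (ea a)) =
        Turing.initList M.toTM (List.map (Equiv.refl A).invFun (ea a)) := by
      unfold toCfg Turing.initList
      congr 1
      funext k
      cases k <;> simp [stackOf, initConf, toTM]
      rfl
    have e2 : M.toCfg ⟨none, [], eb (f a), fun _ => []⟩ =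
        Turing.haltList M.toTM (List.map (Equiv.refl O).invFun (eb (f a))) := by
      unfold toCfg Turing.haltList
      congr 1
      funext k
      cases k <;> simp [stackOf, toTM]
      rfl
    rw [e1, e2] at this
    exact this
  · calc n' a ≤ 2 * n a := hn' a
      _ ≤ 2 * p.eval (ea a).length := by have := hn a; omega
      _ = _ := by simp

open Classical in
/-- The machine that empties its work stacks before it halts. -/
def cleanup (M : StackMachine A O) : StackMachine A O where
  Q := Option M.Q
  K := M.K
  W := M.W
  start := some M.start
  δ q x v := match q with
    | some q => let r := M.δ q x v
      (some r.1, r.2)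
    | none => if x = none ∧ ∀ k, v k = none then (none, false, [], fun _ => (false, []))
      else (some none, true, [], fun _ => (true, []))

def lift (M : StackMachine A O) (c : M.Conf) : M.cleanup.Conf := ⟨some c.q, c.inp, c.out, c.stk⟩

theorem step_lift (M : StackMachine A O) (c : M.Conf) (hc : c.q ≠ none) :
    M.cleanup.step (M.lift c) = M.lift (M.step c) := by
  obtain ⟨q, hq⟩ := Option.ne_none_iff_exists'.1 hc
  ext1 <;> simp [step, lift, hq, cleanup]

theorem reaches_lift (M : StackMachine A O) (c c' : M.Conf) (n : ℕ) (h : M.step^[n] c = c') :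
    ∃ n' ≤ n, M.cleanup.step^[n'] (M.lift c) = M.lift c' := by
  induction n generalizing c with
  | zero => exact ⟨0, le_rfl, by simpa using congrArg _ h⟩
  | succ n ih =>
    by_cases hc : c.q = none
    · have : M.step c = c := by simp [step, hc]
      rw [Function.iterate_succ_apply, this] at h
      obtain ⟨n', h1, h2⟩ := ih c h
      exact ⟨n', by omega, h2⟩
    · rw [Function.iterate_succ_apply] at h
      obtain ⟨n', h1, h2⟩ := ih _ h
      refine ⟨n' + 1, by omega, ?_⟩
      rw [Function.iterate_add_apply, Function.iterate_one, step_lift M c hc, h2]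

/-- All stacks are popped simultaneously, so the height of the tallest one bounds the time, up to
the final halting step. -/
theorem reaches_clean (M : StackMachine A O) (o : List O) (L : ℕ) :
    ∀ (i : List A) (s : M.K → List M.W), i.length ≤ L → (∀ k, (s k).length ≤ L) →
    ∃ n ≤ L + 1, M.cleanup.step^[n] (⟨some none, i, o, s⟩ : M.cleanup.Conf) =
      ⟨none, [], o, fun _ => []⟩ := by
  induction L with
  | zero =>
    intro i s hi hs
    obtain rfl : i = [] := List.length_eq_zero_iff.1 (by omega)
    obtain rfl : s = fun _ => [] := funext fun k => List.length_eq_zero_iff.1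
      (by have := hs k; omega)
    refine ⟨1, le_rfl, ?_⟩
    simp [step, cleanup, act]
  | succ L ih =>
    intro i s hi hs
    by_cases h : i = [] ∧ ∀ k, s k = []
    · obtain ⟨rfl, h⟩ := h
      obtain rfl : s = fun _ => [] := funext h
      refine ⟨1, by omega, ?_⟩
      simp [step, cleanup, act]
    · obtain ⟨n, hn, e⟩ := ih i.tail (fun k => (s k).tail) (by simp; omega)
        (fun k => by have := hs k; simp; omega)
      refine ⟨n + 1, by omega, ?_⟩
      rw [Function.iterate_add_apply, Function.iterate_one, ← e]
      congr 1
      simp [step, cleanup, act, h]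
      rfl

/-- A bound on the number of symbols pushed on a stack in one step. -/
theorem exists_push_bound [Fintype A] (M : StackMachine A O) :
    ∃ b : ℕ, ∀ q x v k, ((M.δ q x v).2.2.2 k).2.length ≤ b := by
  classical
  refine ⟨Finset.univ.sup fun p : M.Q × Option A × (M.K → Option M.W) × M.K =>
    ((M.δ p.1 p.2.1 p.2.2.1).2.2.2 p.2.2.2).2.length, fun q x v k => ?_⟩
  exact Finset.le_sup (f := fun p : M.Q × Option A × (M.K → Option M.W) × M.K =>
    ((M.δ p.1 p.2.1 p.2.2.1).2.2.2 p.2.2.2).2.length) (Finset.mem_univ (q, x, v, k))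

theorem length_le (M : StackMachine A O) (b : ℕ)
    (hb : ∀ q x v k, ((M.δ q x v).2.2.2 k).2.length ≤ b) (n : ℕ) (c : M.Conf) :
    (M.step^[n] c).inp.length ≤ c.inp.length ∧
      ∀ k, ((M.step^[n] c).stk k).length ≤ (c.stk k).length + n * b := by
  induction n generalizing c with
  | zero => simp
  | succ n ih =>
    rw [Function.iterate_succ_apply]
    obtain ⟨h1, h2⟩ := ih (M.step c)
    have key : (M.step c).inp.length ≤ c.inp.length ∧
        ∀ k, ((M.step c).stk k).length ≤ (c.stk k).length + b := by
      rcases hq : c.q with _ | q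
      · simp [step, hq]
      · simp only [step, hq, act]
        refine ⟨?_, fun k => ?_⟩
        · simp only [List.nil_append]
          split_ifs <;> simp
        · have := hb q c.inp.head? (fun k => (c.stk k).head?) k
          rw [List.length_append]
          split_ifs <;> simp <;> omega
    refine ⟨h1.trans key.1, fun k => (h2 k).trans ?_⟩
    have := key.2 k
    rw [add_mul]
    omega

/-- A machine that halts with the right word on the output stack yields a function that is
computable in polynomial time. -/
theorem polyTime [Fintype A] {α β : Type} {ea : α → List A} {eb : β → List O} {f : α → β}
    (M : StackMachine A O) (p : Polynomial ℕ)
    (h : ∀ a, ∃ n ≤ p.eval (ea a).length, ∃ c : M.Conf, c.q = none ∧ c.out = eb (f a) ∧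
      M.step^[n] (M.initConf (ea a)) = c) :
    Nonempty (Turing.TM2ComputableInPolyTime ea eb f) := by
  obtain ⟨b, hb⟩ := M.exists_push_bound
  -- The first `p` is the original running time. The rest pays for the cleanup: a stack is no taller
  -- than the input plus `b` symbols for each step.
  refine M.cleanup.polyTime_of_clean (p + (Polynomial.X + p * Polynomial.C b + 1)) fun a => ?_
  obtain ⟨n, hn, c, hc, ho, e⟩ := h a
  obtain ⟨n', hn', e'⟩ := M.reaches_lift _ _ _ e
  have hlen := M.length_le b hb n (M.initConf (ea a))
  rw [e] at hlen
  have hnb : n * b ≤ p.eval (ea a).length * b := Nat.mul_le_mul_right _ hn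
  obtain ⟨n'', hn'', e''⟩ := M.reaches_clean c.out ((ea a).length + p.eval (ea a).length * b)
    c.inp c.stk (hlen.1.trans (by simp [initConf]))
    (fun k => (hlen.2 k).trans (by simpa [initConf] using by omega))
  refine ⟨n'' + n', ?_, ?_⟩
  · simp only [Polynomial.eval_add, Polynomial.eval_X, Polynomial.eval_mul, Polynomial.eval_C,
      Polynomial.eval_one]
    omega
  · rw [Function.iterate_add_apply]
    have : M.cleanup.initConf (ea a) = M.lift (M.initConf (ea a)) := rfl
    rw [this, e', lift, hc, e'', ho]

end StackMachine
end
end QPIP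

open Computability
namespace QPIP
noncomputable section

/-! ### Real-time controllers -/

/-- A machine with finitely many stacks, one of which initially holds the input. It makes one step
for every bit that it receives. -/
structure Controller (A : Type) where
  Q : Type
  [finQ : Fintype Q]
  K : Type
  [finK : Fintype K]
  [decK : DecidableEq K]
  W : Type
  [finW : Fintype W]
  start : Q
  inK : K
  emb : A → W
  tr : Q → (K → Option W) → Bool → Q × (K → Bool × List W)

attribute [instance] Controller.finQ Controller.finK Controller.decK Controller.finW

namespace Controller

variable {A : Type}

structure Conf (M : Controller A) where
  q : M.Q
  stk : M.K → List M.W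

def next (M : Controller A) (c : M.Conf) (b : Bool) : M.Conf :=
  let r := M.tr c.q (fun k => (c.stk k).head?) b
  ⟨r.1, fun k => StackMachine.act (r.2 k) (c.stk k)⟩

def init (M : Controller A) (x : List A) : M.Conf :=
  ⟨M.start, fun k => if k = M.inK then x.map M.emb else []⟩

/-- The state after the bits `h`. -/
def label (M : Controller A) (p : List A × List Bool) : M.Q := (p.2.foldl M.next (M.init p.1)).q

/-- The states of the machine that runs a controller on a list of bits: it first splits its input
into the input of the controller and the list of bits. -/
inductive SimState (Q : Type) where
  | rev
  | split
  | sim (q : Q)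
  deriving Fintype

/-- The stacks of the machine that runs a controller on a list of bits. -/
inductive SimStk (K : Type) where
  | tmp
  | bits
  | ctl (k : K)
  deriving DecidableEq, Fintype

/-- The machine that runs a controller on a list of bits. -/
def simulator (M : Controller A) [Fintype A] : StackMachine (A ⊕ Bool) M.Q where
  Q := SimState M.Q
  K := SimStk M.K
  W := (A ⊕ Bool) ⊕ M.W
  start := .rev
  δ q x v := match q with
    | .rev => match x with
      | some a => (some .rev, true, [], fun
        | .tmp => (false, [.inl a])
        | _ => (false, []))
      | none => (some .split, false, [], fun _ => (false, []))
    | .split => match v .tmp with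
      | some (.inl (.inl a)) => (some .split, false, [], fun
        | .tmp => (true, [])
        | .bits => (false, [])
        | .ctl k => (false, if k = M.inK then [.inr (M.emb a)] else []))
      | some (.inl (.inr b)) => (some .split, false, [], fun
        | .tmp => (true, [])
        | .bits => (false, [.inl (.inr b)])
        | .ctl _ => (false, []))
      | _ => (some (.sim M.start), false, [], fun _ => (false, []))
    | .sim q => match v .bits with
      | some (.inl (.inr b)) =>
        let r := M.tr q (fun k => (v (.ctl k)).bind Sum.getRight?) b
        (some (.sim r.1), false, [], fun
          | .tmp => (false, [])
          | .bits => (true, [])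
          | .ctl k => ((r.2 k).1, (r.2 k).2.map .inr))
      | _ => (none, false, [q], fun _ => (false, []))

variable (M : Controller A) [Fintype A]

def simStk (t : List (A ⊕ Bool)) (h : List Bool) (s : M.K → List M.W) :
    SimStk M.K → List ((A ⊕ Bool) ⊕ M.W)
  | .tmp => t.map .inl
  | .bits => h.map fun b => .inl (.inr b)
  | .ctl k => (s k).map .inr

/-- In the encoded pair the bits come after the input word, so after this reversal they are on top.
Unloading them reverses again and leaves the oldest bit on top, and the same happens to the input.
-/
theorem simulator_rev (w t : List (A ⊕ Bool)) :
    M.simulator.step^[w.length + 1] ⟨some .rev, w, [], M.simStk t [] fun _ => []⟩ =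
      ⟨some .split, [], [], M.simStk (w.reverse ++ t) [] fun _ => []⟩ := by
  induction w generalizing t with
  | nil =>
    ext1 <;> simp [StackMachine.step, simulator, StackMachine.act]
  | cons a w ih =>
    rw [List.length_cons, Function.iterate_succ_apply]
    have := ih (a :: t)
    rw [List.reverse_cons, List.append_assoc, List.singleton_append, ← this]
    congr 1
    ext1 <;> simp [StackMachine.step, simulator, StackMachine.act]
    funext k
    cases k <;> simp [simStk] <;> rfl

theorem simulator_split_bits (h r : List Bool) (x : List A) :
    M.simulator.step^[h.length] ⟨some .split, [], [], M.simStk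
      ((h.reverse.map .inr) ++ (x.reverse.map .inl)) r fun _ => []⟩ =
      ⟨some .split, [], [], M.simStk (x.reverse.map .inl) (h ++ r) fun _ => []⟩ := by
  induction h using List.reverseRecOn generalizing r with
  | nil => simp
  | append_singleton h b ih =>
    rw [List.length_append, List.length_singleton, Function.iterate_succ_apply]
    have := ih (b :: r)
    rw [List.append_assoc, List.singleton_append, ← this]
    congr 1
    ext1 <;> simp [StackMachine.step, simulator, StackMachine.act, simStk]
    funext k
    cases k <;> simp [simStk] <;> rfl

theorem simulator_split_input (x y : List A) (h : List Bool) :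
    M.simulator.step^[x.length + 1] ⟨some .split, [], [], M.simStk (x.reverse.map .inl) h
      fun k => if k = M.inK then y.map M.emb else []⟩ =
      ⟨some (.sim M.start), [], [], M.simStk [] h
        fun k => if k = M.inK then (x ++ y).map M.emb else []⟩ := by
  induction x using List.reverseRecOn generalizing y with
  | nil =>
    ext1 <;> simp [StackMachine.step, simulator, StackMachine.act, simStk]
    funext k
    cases k <;> simp [simStk]
  | append_singleton x a ih =>
    rw [List.length_append, List.length_singleton, Function.iterate_succ_apply]
    have := ih (a :: y)
    rw [List.append_assoc, List.singleton_append, ← this]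
    congr 1
    ext1 <;> simp [StackMachine.step, simulator, StackMachine.act, simStk]
    funext k
    cases k with
    | ctl k => by_cases hk : k = M.inK <;> simp [simStk, hk] <;> rfl
    | _ => simp [simStk]; rfl

theorem simulator_sim (h : List Bool) (c : M.Conf) :
    ∃ s, M.simulator.step^[h.length + 1] ⟨some (.sim c.q), [], [], M.simStk [] h c.stk⟩ =
      ⟨none, [], [(h.foldl M.next c).q], s⟩ := by
  induction h generalizing c with
  | nil =>
    refine ⟨M.simStk [] [] c.stk, ?_⟩
    ext1 <;> simp [StackMachine.step, simulator, StackMachine.act, simStk]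
    funext k
    cases k <;> simp [simStk]
  | cons b h ih =>
    obtain ⟨s, hs⟩ := ih (M.next c b)
    refine ⟨s, ?_⟩
    rw [List.length_cons, Function.iterate_succ_apply, List.foldl_cons, ← hs]
    congr 1
    have e : ∀ k, ((c.stk k).head?.map (Sum.inr (α := A ⊕ Bool))).bind (fun a => a.getRight?) =
        (c.stk k).head? := by
      intro k
      cases c.stk k <;> simp
    ext1 <;> simp [StackMachine.step, simulator, StackMachine.act, simStk, next, e]
    funext k
    cases k with
    | ctl k =>
      simp only [simStk, List.map_append]
      congr 1
      split_ifs <;> simp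
    | _ => simp [simStk]; rfl

/-- The state of a controller after a list of bits is computable in polynomial time. -/
theorem polyTime_label :
    Nonempty (Turing.TM2ComputableInPolyTime
      (encodingProd (encodingList A) (encodingList Bool)).encode (fun l => [l]) M.label) := by
  refine M.simulator.polyTime (3 * Polynomial.X + 3) fun p => ?_
  obtain ⟨x, h⟩ := p
  obtain ⟨s, hs⟩ := M.simulator_sim h (M.init x)
  refine ⟨(h.length + 1) + ((x.length + 1) + (h.length + ((x.length + h.length) + 1))), ?_,
    ⟨none, [], [(h.foldl M.next (M.init x)).q], s⟩, rfl, rfl, ?_⟩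
  · simp [encodingProd, encodingList]
    omega
  · have h1 := M.simulator_rev (x.map .inl ++ h.map .inr) []
    have h2 := M.simulator_split_bits h [] x
    have h3 := M.simulator_split_input x [] h
    simp only [List.map_nil, ite_self, List.append_nil] at h1 h2 h3
    rw [List.length_append, List.length_map, List.length_map, List.reverse_append,
      ← List.map_reverse, ← List.map_reverse] at h1
    have e : M.simulator.initConf ((encodingProd (encodingList A) (encodingList Bool)).encode (x, h))
        = ⟨some .rev, x.map .inl ++ h.map .inr, [], M.simStk [] [] fun _ => []⟩ := by
      ext1 <;> simp [StackMachine.initConf, simulator, encodingProd, encodingList]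
      funext k
      cases k <;> simp [simStk]
    rw [Function.iterate_add_apply M.simulator.step (h.length + 1),
      Function.iterate_add_apply M.simulator.step (x.length + 1),
      Function.iterate_add_apply M.simulator.step h.length (x.length + h.length + 1), e, h1, h2]
    exact (congrArg _ h3).trans hs

end Controller
end
end QPIP

open Computability
namespace QPIP
noncomputable section

/-! ### The circuits of the honest prover -/

instance : Fintype Channel :=
  haveI : DecidableEq Channel := Classical.decEq _
  Fintype.ofSurjective (fun b : Bool => if b then .quantum else .classical) fun c => by
    cases c
    · exact ⟨true, rfl⟩
    · exact ⟨false, rfl⟩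

theorem iterate_trans {X : Type*} {f : X → X} {m n : ℕ} {x y z : X} (h : f^[m] x = y)
    (h' : f^[n] y = z) : f^[n + m] x = z := by
  rw [Function.iterate_add_apply, h, h']

namespace Memory

variable {A : Type}

/-- Three controlled-NOT gates that exchange qubit `0` and qubit `p`. -/
def swapGates (p : ℕ) : List (Gate stdGates) :=
  [⟨StdOp.CNOT, [0, p]⟩, ⟨StdOp.CNOT, [p, 0]⟩, ⟨StdOp.CNOT, [0, p]⟩]

/-- The number of exchanges after which a qubit comes back. -/
def delay (B : ℕ) (isBit : A → Bool) (x : List A) : ℕ := B * (x.countP isBit - 1)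

/-- The circuit that stores the message qubit in a new place and fetches the qubit that has been
stored before. -/
def circuit (B : ℕ) (isBit : A → Bool) (p : List A × List Channel) : List (Gate stdGates) :=
  -- The place numbered by the current interaction is fresh and contains `0`. If the subtraction
  -- truncates to `0`, the second list has gates with the wires `0, 0`; these are invalid, act as
  -- the identity, and the fresh `0` is returned. With delay `0` the two exchanges cancel.
  swapGates p.2.length ++ swapGates (p.2.length - delay B isBit p.1)

/-- The stacks of the machine that computes the circuits. -/
inductive Stk where
  | lag
  | cnt (isP : Bool) (par : Bool)
  deriving DecidableEq, Fintype

/-- The states of the machine that computes the circuits. -/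
inductive State where
  | read (first : Bool)
  | sub
  | emit (i : Fin 6)
  | loop (i : Fin 6)
  deriving Fintype

/-- The output is a stack, so the gates are written from last to first: the numbers below `3` belong
to the second exchange, the others to the first. Reading a unary counter empties it, so its contents
move to a twin, and `parity` tells which of the two is full; it also marks the middle gate, whose
wires are in the opposite order. -/
def usesP (i : Fin 6) : Bool := decide (3 ≤ i.val)
def parity (i : Fin 6) : Bool := decide (i.val % 3 = 1)

/-- The word of the gate number `i`, counted from the end, with the wires `0` and `v`. -/
def word (i : Fin 6) (v : ℕ) : List (Token stdGates) :=
  (if parity i then [.op StdOp.CNOT] else [.op StdOp.CNOT, .sep]) ++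
    (List.replicate v .tick ++ if parity i then [.sep, .sep] else [.sep])

def after (i : Fin 6) : Option State := if h : i.val + 1 < 6 then some (.emit ⟨i.val + 1, h⟩) else none

/-- The machine that computes the circuits. -/
def machine (B : ℕ) (isBit : A → Bool) : StackMachine (A ⊕ Channel) (Token stdGates) where
  Q := State
  K := Stk
  W := Unit
  start := .read true
  δ q x v := match q with
    | .read first => match x with
      | some (.inl a) =>
        if isBit a then
          (some (.read false), true, [], fun
            -- The first input bit adds nothing, which accounts for the `- 1` in `delay`.
            | .lag => (false, if first then [] else List.replicate B ())
            | .cnt _ _ => (false, []))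
        else (some (.read first), true, [], fun _ => (false, []))
      | some (.inr _) => (some (.read first), true, [], fun
            | .lag => (false, [])
            | .cnt _ par => (false, if par then [] else [()]))
      | none => (some .sub, false, [], fun _ => (false, []))
    -- Stopping as soon as either counter is empty is truncated subtraction; an unused rest of the
    -- lag does no harm.
    | .sub => match v .lag, v (.cnt false false) with
      | some _, some _ => (some .sub, false, [], fun
            | .lag => (true, [])
            | .cnt isP par => (!isP && !par, []))
      | _, _ => (some (.emit 0), false, [], fun _ => (false, []))
    | .emit i => (some (.loop i), false, if parity i then [.sep, .sep] else [.sep],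
        fun _ => (false, []))
    | .loop i => match v (.cnt (usesP i) (parity i)) with
      | some _ => (some (.loop i), false, [.tick], fun
            | .lag => (false, [])
            | .cnt isP par => if isP = usesP i then
                (if par = parity i then (true, []) else (false, [()])) else (false, []))
      | none => (after i, false,
          if parity i then [.op StdOp.CNOT] else [.op StdOp.CNOT, .sep], fun _ => (false, []))

def stk (c : ℕ) (f : Bool → Bool → ℕ) : Stk → List Unit
  | .lag => List.replicate c ()
  | .cnt isP par => List.replicate (f isP par) ()

variable (B : ℕ) (isBit : A → Bool)

def readCount (f : Bool → Bool → ℕ) (k : ℕ) : Bool → Bool → ℕ :=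
  fun isP par => if par then f isP par else f isP par + k

theorem machine_read_channels (l : List Channel) (first : Bool) (c : ℕ) (f : Bool → Bool → ℕ) :
    (machine B isBit).step^[l.length + 1] ⟨some (.read first), l.map .inr, [], stk c f⟩ =
      ⟨some .sub, [], [], stk c (readCount f l.length)⟩ := by
  induction l generalizing f with
  | nil =>
    ext1 <;> simp [StackMachine.step, machine, StackMachine.act]
    funext k
    cases k <;> simp [stk, readCount]
  | cons a l ih =>
    rw [List.length_cons, Function.iterate_succ_apply]
    have e : readCount f (l.length + 1) = readCount (readCount f 1) l.length := by
      funext isP par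
      simp only [readCount]
      split_ifs <;> omega
    rw [e, ← ih]
    congr 1
    ext1 <;> simp [StackMachine.step, machine, StackMachine.act]
    funext k
    cases k with
    | lag => simp [stk]; rfl
    | cnt isP par => cases par <;> simp [stk, readCount, List.replicate_succ] <;> rfl

theorem machine_read (x : List A) (l : List Channel) (first : Bool) (c : ℕ)
    (f : Bool → Bool → ℕ) :
    (machine B isBit).step^[x.length + (l.length + 1)]
        ⟨some (.read first), x.map .inl ++ l.map .inr, [], stk c f⟩ =
      ⟨some .sub, [], [], stk (c + B * (x.countP isBit - if first then 1 else 0))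
        (readCount f l.length)⟩ := by
  induction x generalizing c first with
  | nil => simpa using machine_read_channels B isBit l first c f
  | cons a x ih =>
    rw [List.length_cons, add_right_comm, Function.iterate_succ_apply]
    by_cases ha : isBit a
    · have e : c + B * ((a :: x).countP isBit - if first = true then 1 else 0) =
          (c + if first then 0 else B) + B * (x.countP isBit - if false = true then 1 else 0) := by
        rw [List.countP_cons_of_pos ha]
        cases first <;> simp [mul_add]
        ring
      rw [e, ← ih]
      congr 1
      ext1 <;> simp [StackMachine.step, machine, StackMachine.act, ha]
      funext k
      cases k with
      | lag =>
        cases first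
        · simp only [stk, Bool.false_eq_true, if_false, add_comm c B, List.replicate_add]
          rfl
        · rfl
      | cnt isP par => simp [stk]; rfl
    · rw [List.countP_cons_of_neg ha, ← ih]
      congr 1
      ext1 <;> simp [StackMachine.step, machine, StackMachine.act, ha]
      funext k
      cases k <;> simp [stk] <;> rfl

theorem machine_sub (c q p : ℕ) :
    ∃ n ≤ q + 1, ∃ c', (machine B isBit).step^[n]
        ⟨some .sub, [], [], stk c fun isP par => if par then 0 else if isP then p else q⟩ =
      ⟨some (.emit 0), [], [],
        stk c' fun isP par => if par then 0 else if isP then p else q - c⟩ := by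
  induction c generalizing q with
  | zero =>
    refine ⟨1, by omega, 0, ?_⟩
    ext1 <;> simp [StackMachine.step, machine, StackMachine.act, stk]
    funext k
    cases k <;> simp [stk]
  | succ c ih =>
    rcases q with _ | q
    · refine ⟨1, by omega, c + 1, ?_⟩
      ext1 <;> simp [StackMachine.step, machine, StackMachine.act, stk]
      funext k
      cases k <;> simp [stk]
    · obtain ⟨n, hn, c', h⟩ := ih q
      refine ⟨n + 1, by omega, c', ?_⟩
      rw [Function.iterate_succ_apply, Nat.add_sub_add_right, ← h]
      congr 1
      ext1 <;> simp [StackMachine.step, machine, StackMachine.act, stk, List.replicate_succ]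
      funext k
      cases k with
      | lag => simp [stk]; rfl
      | cnt isP par => cases isP <;> cases par <;> simp [stk, List.replicate_succ] <;> rfl

theorem machine_loop (i : Fin 6) (c v v' : ℕ) (f : Bool → ℕ) (o : List (Token stdGates)) :
    (machine B isBit).step^[v + 1] ⟨some (.loop i), [], o,
        stk c fun isP par => if isP = usesP i then (if par = parity i then v else v') else f par⟩ =
      ⟨after i, [], (if parity i then [.op StdOp.CNOT] else [.op StdOp.CNOT, .sep]) ++
          (List.replicate v .tick ++ o),
        stk c fun isP par =>
          if isP = usesP i then (if par = parity i then 0 else v + v') else f par⟩ := by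
  induction v generalizing v' o with
  | zero =>
    ext1 <;> simp [StackMachine.step, machine, StackMachine.act, stk]
    funext k
    cases k <;> simp [stk]
  | succ v ih =>
    rw [Function.iterate_succ_apply]
    have := ih (v' + 1) (.tick :: o)
    have e : List.replicate (v + 1) Token.tick ++ o = List.replicate v Token.tick ++ .tick :: o := by
      rw [List.replicate_succ', List.append_assoc, List.singleton_append]
    have e' : v + 1 + v' = v + (v' + 1) := by omega
    rw [e, e', ← this]
    congr 1
    ext1 <;> simp [StackMachine.step, machine, StackMachine.act, stk, List.replicate_succ]
    funext k
    cases k with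
    | lag => simp [stk]; rfl
    | cnt isP par =>
      by_cases h1 : isP = usesP i <;> by_cases h2 : par = parity i <;>
        simp [stk, h1, h2, List.replicate_succ] <;> rfl

theorem machine_emit (i : Fin 6) (c v : ℕ) (f : Bool → ℕ) (o : List (Token stdGates)) :
    (machine B isBit).step^[v + 2] ⟨some (.emit i), [], o,
        stk c fun isP par => if isP = usesP i then (if par = parity i then v else 0) else f par⟩ =
      ⟨after i, [], word i v ++ o,
        stk c fun isP par =>
          if isP = usesP i then (if par = parity i then 0 else v) else f par⟩ := by
  have h := machine_loop B isBit i c v 0 f ((if parity i then [.sep, .sep] else [.sep]) ++ o)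
  have e : word i v ++ o = (if parity i then [.op StdOp.CNOT] else [.op StdOp.CNOT, .sep]) ++
      (List.replicate v .tick ++ ((if parity i then [.sep, .sep] else [.sep]) ++ o)) := by
    simp only [word, List.append_assoc]
  rw [show v + 2 = v + 1 + 1 by rfl, Function.iterate_succ_apply, e]
  rw [add_zero] at h
  rw [← h]
  congr 1

/-- The contents of the counters before the gate number `n` is written. -/
def counts (p q n : ℕ) (isP par : Bool) : ℕ :=
  if isP then (if par = (decide (n = 4) || decide (n = 6)) then p else 0)
  else if par = (decide (n = 1) || decide (3 ≤ n)) then q else 0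

theorem machine_emit_counts (i : Fin 6) (c p q : ℕ) (o : List (Token stdGates)) :
    (machine B isBit).step^[(if usesP i then p else q) + 2]
        ⟨some (.emit i), [], o, stk c (counts p q i)⟩ =
      ⟨after i, [], word i (if usesP i then p else q) ++ o, stk c (counts p q (i + 1))⟩ := by
  have h := machine_emit B isBit i c (if usesP i then p else q)
    (fun par => counts p q i (!usesP i) par) o
  have e1 : (fun isP par => if isP = usesP i then
      (if par = parity i then (if usesP i then p else q) else 0)
      else counts p q i (!usesP i) par) = counts p q i := by
    funext isP par
    fin_cases i <;> cases isP <;> cases par <;> simp [counts, usesP, parity]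
  have e2 : (fun isP par => if isP = usesP i then
      (if par = parity i then 0 else (if usesP i then p else q))
      else counts p q i (!usesP i) par) = counts p q (i + 1) := by
    funext isP par
    fin_cases i <;> cases isP <;> cases par <;> simp [counts, usesP, parity]
  rw [e1, e2] at h
  exact h

theorem machine_write (c p q : ℕ) :
    ∃ s, (machine B isBit).step^[3 * (q + 2) + 3 * (p + 2)]
        ⟨some (.emit 0), [], [], stk c (counts p q 0)⟩ =
      ⟨none, [], (circuitEncoding stdGates).encode (swapGates p ++ swapGates q), s⟩ := by
  refine ⟨stk c (counts p q 6), ?_⟩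
  have h0 := machine_emit_counts B isBit 0 c p q []
  have h1 := machine_emit_counts B isBit 1 c p q (word 0 q ++ [])
  have h2 := machine_emit_counts B isBit 2 c p q (word 1 q ++ (word 0 q ++ []))
  have h3 := machine_emit_counts B isBit 3 c p q (word 2 q ++ (word 1 q ++ (word 0 q ++ [])))
  have h4 := machine_emit_counts B isBit 4 c p q
    (word 3 p ++ (word 2 q ++ (word 1 q ++ (word 0 q ++ []))))
  have h5 := machine_emit_counts B isBit 5 c p q
    (word 4 p ++ (word 3 p ++ (word 2 q ++ (word 1 q ++ (word 0 q ++ [])))))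
  have e : (circuitEncoding stdGates).encode (swapGates p ++ swapGates q) =
      word 5 p ++ (word 4 p ++ (word 3 p ++ (word 2 q ++ (word 1 q ++ (word 0 q ++ []))))) := by
    simp [circuitEncoding, swapGates, Gate.encode, word, parity]
  rw [e]
  rw [show 3 * (q + 2) + 3 * (p + 2) = (p + 2) + ((p + 2) + ((p + 2) + ((q + 2) + ((q + 2) +
    (q + 2))))) by ring]
  exact iterate_trans (iterate_trans (iterate_trans (iterate_trans (iterate_trans h0 h1) h2) h3)
    h4) h5

/-- The circuits of the honest prover can be computed in polynomial time. -/
theorem polyTime_circuit [Fintype A] :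
    Nonempty (Turing.TM2ComputableInPolyTime
      (encodingProd (encodingList A) (encodingList Channel)).encode
      (circuitEncoding stdGates).encode (circuit B isBit)) := by
  refine (machine B isBit).polyTime (8 * Polynomial.X + 14) fun a => ?_
  obtain ⟨x, l⟩ := a
  have h1 := machine_read B isBit x l true 0 (fun _ _ => 0)
  obtain ⟨n, hn, c', h2⟩ := machine_sub B isBit (delay B isBit x) l.length l.length
  obtain ⟨s, h3⟩ := machine_write B isBit c' l.length (l.length - delay B isBit x)
  refine ⟨(3 * (l.length - delay B isBit x + 2) + 3 * (l.length + 2)) +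
    (n + (x.length + (l.length + 1))), ?_, ⟨none, [], _, s⟩, rfl, rfl, ?_⟩
  · simp [encodingProd, encodingList]
    omega
  · have e0 : (machine B isBit).initConf
        ((encodingProd (encodingList A) (encodingList Channel)).encode (x, l)) =
        ⟨some (.read true), x.map .inl ++ l.map .inr, [], stk 0 fun _ _ => 0⟩ := by
      ext1 <;> simp [StackMachine.initConf, machine, encodingProd, encodingList]
      funext k
      cases k <;> simp [stk]
    have e1 : stk (0 + B * (x.countP isBit - if true = true then 1 else 0))
        (readCount (fun _ _ => 0) l.length) = stk (delay B isBit x)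
          fun isP par => if par then 0 else if isP then l.length else l.length := by
      congr 1
      · simp [delay]
      · funext isP par
        simp [readCount]
    have e2 : (fun isP par : Bool => if par then 0 else if isP then l.length else
        l.length - delay B isBit x) = counts l.length (l.length - delay B isBit x) 0 := by
      funext isP par
      cases isP <;> cases par <;> simp [counts]
    rw [e1] at h1
    rw [e2] at h2
    rw [e0]
    exact iterate_trans (iterate_trans h1 h2) h3

end Memory
end
end QPIP

open Computability
namespace QPIP
noncomputable section

/-! ### A quantum authentication code -/

open ComplexConjugate

theorem normSq_eq_mul_conj (z : ℂ) : ((‖z‖ ^ 2 : ℝ) : ℂ) = z * conj z := by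
  rw [Complex.mul_conj, Complex.normSq_eq_norm_sq]

/-- Parseval's identity for a system of orthogonal vectors of equal norm. -/
theorem sum_norm_sq_of_orthogonal {I S : Type*} [Fintype I] [Fintype S] [DecidableEq S]
    (c : I → S → ℂ) (N : ℝ)
    (h : ∀ s s', ∑ i, c i s * conj (c i s') = if s = s' then (N : ℂ) else 0) (f : S → ℂ) :
    ∑ i, ‖∑ s, c i s * f s‖ ^ 2 = N * ∑ s, ‖f s‖ ^ 2 := by
  have : ((∑ i, ‖∑ s, c i s * f s‖ ^ 2 : ℝ) : ℂ) = ((N * ∑ s, ‖f s‖ ^ 2 : ℝ) : ℂ) := by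
    push_cast
    simp_rw [← Complex.ofReal_pow, normSq_eq_mul_conj, map_sum, map_mul, Finset.sum_mul_sum]
    rw [Finset.sum_comm, Finset.mul_sum]
    refine Finset.sum_congr rfl fun s _ => ?_
    rw [Finset.sum_comm]
    have e : ∀ s', ∑ i, c i s * f s * (conj (c i s') * conj (f s')) =
        if s = s' then N * (f s * conj (f s)) else 0 := by
      intro s'
      have : ∀ i, c i s * f s * (conj (c i s') * conj (f s')) =
          c i s * conj (c i s') * (f s * conj (f s')) := fun i => by ring
      simp_rw [this, ← Finset.sum_mul, h]
      split_ifs with hs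
      · rw [hs]
      · simp
    simp_rw [e]
    simp
  exact_mod_cast this

namespace AuthCode

variable {F : Type} [Field F] [Fintype F] [DecidableEq F]

/-- Vectors of three field elements. -/
abbrev Vec (F : Type) : Type := F × F × F

/-- The standard bilinear form. -/
def dot (t r : Vec F) : F := t.1 * r.1 + t.2.1 * r.2.1 + t.2.2 * r.2.2

omit [Fintype F] [DecidableEq F] in
theorem dot_add (t r s : Vec F) : dot t (r + s) = dot t r + dot t s := by
  simp [dot]; ring

omit [Fintype F] [DecidableEq F] in
theorem dot_neg (t r : Vec F) : dot t (-r) = -dot t r := by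
  simp [dot]; ring

variable (ψ : AddChar F ℂ)

theorem sum_dot (hψ : ψ.IsPrimitive) (s : Vec F) :
    ∑ v, ψ (dot v s) = if s = 0 then ((Fintype.card (Vec F) : ℝ) : ℂ) else 0 := by
  have e : ∀ v : Vec F, ψ (dot v s) =
      ψ (v.1 * s.1) * (ψ (v.2.1 * s.2.1) * ψ (v.2.2 * s.2.2)) := by
    intro v
    rw [dot, AddChar.map_add_eq_mul, AddChar.map_add_eq_mul, mul_assoc]
  simp_rw [e, Fintype.sum_prod_type, ← Finset.mul_sum, ← Finset.sum_mul,
    AddChar.sum_mulShift _ hψ]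
  obtain ⟨a, b, c⟩ := s
  simp only [Prod.mk_eq_zero, Fintype.card_prod]
  by_cases ha : a = 0 <;> by_cases hb : b = 0 <;> by_cases hc : c = 0 <;> simp [ha, hb, hc]

theorem parseval (hψ : ψ.IsPrimitive) (f : Vec F → ℂ) :
    ∑ v, ‖∑ s, ψ (-dot v s) * f s‖ ^ 2 = Fintype.card (Vec F) * ∑ s, ‖f s‖ ^ 2 := by
  refine sum_norm_sq_of_orthogonal _ _ (fun s s' => ?_) f
  have e : ∀ v, ψ (-dot v s) * conj (ψ (-dot v s')) = ψ (dot v (s' - s)) := by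
    intro v
    rw [← AddChar.map_neg_eq_conj, ← AddChar.map_add_eq_mul, neg_neg, sub_eq_add_neg, dot_add,
      dot_neg, add_comm]
  simp_rw [e, sum_dot ψ hψ, sub_eq_zero, eq_comm]

/-- The bits as field elements. -/
def bit (y : Bool) : F := if y then 1 else 0

omit [Fintype F] [DecidableEq F] in
theorem bit_injective : Function.Injective (bit (F := F)) := by
  intro a b h
  cases a <;> cases b <;> simp_all [bit]

/-- The code words without one-time pad, up to normalisation. -/
def plain (g : Vec F) (r : Vec F) (y : Bool) : ℂ :=
  if r.1 = bit y + g.2.2 * r.2.1 ∧ r.2.2 = g.1 * r.1 + g.2.1 * r.2.1 then 1 else 0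

/-- The overlap of code words with a Pauli operator. -/
def overlap (g s t : Vec F) (y' y : Bool) : ℂ :=
  ∑ r, conj (plain g (r + s) y') * plain g r y * ψ (dot t r)

/-- The condition that the code does not detect the Pauli operator. -/
def Undetected (g s t : Vec F) : Prop :=
  s.2.2 = g.1 * s.1 + g.2.1 * s.2.1 ∧
    g.2.2 * t.1 + t.2.1 + t.2.2 * (g.1 * g.2.2 + g.2.1) = 0

instance (g s t : Vec F) : Decidable (Undetected g s t) := by unfold Undetected; infer_instance

/-- With `g = (α, A, b)`, the code word of `y` is the sum over `w` of the basis vectors `(y + b w,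
w, α (y + b w) + A w)`. A shift by `s` respects the check of the third coordinate exactly under the
first condition in `Undetected`, and it then moves the data by `s.1 - b * s.2.1`. The phases of `t`
along the word form a character in `w`, whose sum vanishes unless its frequency, the second
condition, is `0`. -/
theorem overlap_eq (hψ : ψ.IsPrimitive) (g s t : Vec F) (y' y : Bool) :
    overlap ψ g s t y' y =
      if Undetected g s t ∧ bit y' = bit y + (s.1 - g.2.2 * s.2.1) then
        Fintype.card F * ψ ((t.1 + t.2.2 * g.1) * bit y) else 0 := by
  obtain ⟨α, A, b⟩ := g
  by_cases hP : s.2.2 = α * s.1 + A * s.2.1 ∧ bit y' = bit y + (s.1 - b * s.2.1)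
  · have e : ∀ r : Vec F, conj (plain (α, A, b) (r + s) y') * plain (α, A, b) r y * ψ (dot t r) =
        if r.1 = bit y + b * r.2.1 then (if r.2.2 = α * r.1 + A * r.2.1 then
          ψ (r.2.1 * (b * t.1 + t.2.1 + t.2.2 * (α * b + A))) *
            ψ ((t.1 + t.2.2 * α) * bit y) else 0) else 0 := by
      intro r
      by_cases h1 : r.1 = bit y + b * r.2.1
      · by_cases h2 : r.2.2 = α * r.1 + A * r.2.1
        · have h3 : r.1 + s.1 = bit y' + b * (r.2.1 + s.2.1) := by
            linear_combination -hP.2 + h1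
          have h4 : r.2.2 + s.2.2 = α * (r.1 + s.1) + A * (r.2.1 + s.2.1) := by
            linear_combination hP.1 + h2
          have h5 : dot t r = r.2.1 * (b * t.1 + t.2.1 + t.2.2 * (α * b + A)) +
              (t.1 + t.2.2 * α) * bit y := by
            rw [dot, h2, h1]
            ring
          have h6 : plain (α, A, b) (r + s) y' = 1 := if_pos ⟨h3, h4⟩
          have h7 : plain (α, A, b) r y = 1 := if_pos ⟨h1, h2⟩
          rw [if_pos h1, if_pos h2, h6, h7, h5, AddChar.map_add_eq_mul]
          simp
        · simp [plain, h2]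
      · simp [plain, h1]
    simp_rw [overlap, e, Fintype.sum_prod_type]
    rw [Finset.sum_comm]
    have e2 : ∀ w : F, (∑ η : F, ∑ z : F, if η = bit y + b * w then
        (if z = α * η + A * w then ψ (w * (b * t.1 + t.2.1 + t.2.2 * (α * b + A))) *
            ψ ((t.1 + t.2.2 * α) * bit y) else 0) else 0) =
        ψ (w * (b * t.1 + t.2.1 + t.2.2 * (α * b + A))) * ψ ((t.1 + t.2.2 * α) * bit y) := by
      intro w
      rw [Finset.sum_eq_single (bit y + b * w)]
      · simp
      · intro η _ hη
        simp [hη]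
      · simp
    rw [Finset.sum_congr rfl fun w _ => e2 w, ← Finset.sum_mul, AddChar.sum_mulShift _ hψ]
    by_cases hc : b * t.1 + t.2.1 + t.2.2 * (α * b + A) = 0
    · rw [if_pos hc, if_pos ⟨⟨hP.1, hc⟩, hP.2⟩]
    · rw [if_neg hc, if_neg fun h => hc h.1.2]
      simp
  · rw [if_neg fun h => hP ⟨h.1.1, h.2⟩]
    refine Finset.sum_eq_zero fun r _ => ?_
    by_cases h1 : r.1 = bit y + b * r.2.1
    · by_cases h2 : r.2.2 = α * r.1 + A * r.2.1
      · have h3 : plain (α, A, b) (r + s) y' = 0 := by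
          refine if_neg fun h => hP ?_
          obtain ⟨h4, h5⟩ := h
          simp only [Prod.fst_add, Prod.snd_add] at h4 h5
          constructor
          · linear_combination h5 - h2
          · linear_combination -h4 + h1
        simp [h3]
      · simp [plain, h2]
    · simp [plain, h1]

/-- An undetected Pauli operator acts on the data bit, up to the factor `q`, either as a diagonal
matrix of phases or, if it moves the data, as a matrix with at most one phase in each row and
column. Both are contractions. -/
theorem sum_overlap_le (hψ : ψ.IsPrimitive) (g s t : Vec F) (x : Bool → ℂ) :
    ∑ y', ‖∑ y, overlap ψ g s t y' y * x y‖ ^ 2 ≤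
      if Undetected g s t then (Fintype.card F : ℝ) ^ 2 * ∑ y, ‖x y‖ ^ 2 else 0 := by
  split_ifs with hU
  · have hn : ∀ z : F, ‖ψ z‖ = 1 := fun z => AddChar.norm_apply ψ z
    simp only [Fintype.sum_bool, overlap_eq ψ hψ, hU, true_and]
    have h01 : bit (F := F) true ≠ bit false := fun h => by simpa using bit_injective h
    generalize hc : s.1 - g.2.2 * s.2.1 = c
    have hx0 := sq_nonneg ‖x true‖
    have hx1 := sq_nonneg ‖x false‖
    by_cases h0 : c = 0
    · simp [h0, h01, h01.symm, hn, mul_pow]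
      linarith
    · have ht : ¬ bit true = bit true + c := by simpa using h0
      have hf : ¬ bit false = bit false + c := by simpa using h0
      simp only [ht, hf, if_false, zero_mul, zero_add, add_zero]
      have hq : (0 : ℝ) ≤ (Fintype.card F : ℝ) ^ 2 := by positivity
      split_ifs <;> simp [hn, mul_pow] <;> nlinarith
  · simp [overlap_eq ψ hψ, hU]

/-- For a nontrivial Pauli operator one of the two conditions is affine in some coordinate of the
key with a nonzero coefficient, so the other two coordinates determine it. The cases find this
coordinate. -/
theorem card_undetected (s t : Vec F) (h : (s, t) ≠ 0) :
    (Finset.univ.filter fun g : Vec F => Undetected g s t).card ≤ Fintype.card F ^ 2 := by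
  obtain ⟨s1, s2, s3⟩ := s
  obtain ⟨t1, t2, t3⟩ := t
  have key : ∀ f : Vec F → F × F, (∀ g g', Undetected g (s1, s2, s3) (t1, t2, t3) →
      Undetected g' (s1, s2, s3) (t1, t2, t3) → f g = f g' → g = g') →
      (Finset.univ.filter fun g : Vec F => Undetected g (s1, s2, s3) (t1, t2, t3)).card ≤
        Fintype.card F ^ 2 := by
    intro f hf
    refine (Finset.card_le_card_of_injOn f (t := Finset.univ) (by simp) ?_).trans
      (by simp [sq])
    intro g hg g' hg' e
    exact hf g g' (by simpa using hg) (by simpa using hg') e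
  by_cases h2 : s2 = 0
  · by_cases h1 : s1 = 0
    · subst h1 h2
      by_cases h3 : t3 = 0
      · subst h3
        by_cases h4 : t1 = 0
        -- Only `s3` and `t2` may be nonzero here, and the conditions say that both vanish: no key
        -- at all is bad.
        · refine key (fun _ => 0) fun g g' hg _ _ => ?_
          exfalso
          subst h4
          simp only [Undetected, mul_zero, add_zero, zero_add, zero_mul] at hg
          exact h (by rw [hg.1, hg.2]; rfl)
        · refine key (fun g => (g.1, g.2.1)) fun g g' hg hg' e => ?_
          simp only [Prod.mk.injEq] at e
          have : g.2.2 * t1 = g'.2.2 * t1 := by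
            have a1 := hg.2
            have a2 := hg'.2
            simp only at a1 a2
            linear_combination a1 - a2
          exact Prod.ext e.1 (Prod.ext e.2 (mul_right_cancel₀ h4 this))
      · refine key (fun g => (g.1, g.2.2)) fun g g' hg hg' e => ?_
        simp only [Prod.mk.injEq] at e
        have : t3 * g.2.1 = t3 * g'.2.1 := by
          have a1 := hg.2
          have a2 := hg'.2
          simp only at a1 a2
          rw [e.1, e.2] at a1
          linear_combination a1 - a2
        exact Prod.ext e.1 (Prod.ext (mul_left_cancel₀ h3 this) e.2)
    · subst h2
      refine key (fun g => g.2) fun g g' hg hg' e => ?_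
      have : g.1 * s1 = g'.1 * s1 := by
        have a1 := hg.1
        have a2 := hg'.1
        simp only at a1 a2
        linear_combination a2 - a1
      exact Prod.ext (mul_right_cancel₀ h1 this) e
  · refine key (fun g => (g.1, g.2.2)) fun g g' hg hg' e => ?_
    simp only [Prod.mk.injEq] at e
    have : g.2.1 * s2 = g'.2.1 * s2 := by
      have a1 := hg.1
      have a2 := hg'.1
      simp only at a1 a2
      rw [e.1] at a1
      linear_combination a2 - a1
    exact Prod.ext e.1 (Prod.ext (mul_right_cancel₀ h2 this) e.2)

/-- The keys: a Pauli operator and the parameters of the code. -/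
abbrev Key (F : Type) : Type := (Vec F × Vec F) × Vec F

/-- The code words, up to normalisation. -/
def rawCode (k : Key F) (h : Vec F) (y : Bool) : ℂ := ψ (dot k.1.2 h) * plain k.2 (h - k.1.1) y

theorem conj_rawCode_mul (k : Key F) (h r : Vec F) (y' y : Bool) :
    conj (rawCode ψ k h y') * rawCode ψ k r y =
      ψ (-dot k.1.2 (h - r)) * (conj (plain k.2 (h - k.1.1) y') * plain k.2 (r - k.1.1) y) := by
  have : ψ (-dot k.1.2 (h - r)) = conj (ψ (dot k.1.2 h)) * ψ (dot k.1.2 r) := by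
    rw [← AddChar.map_neg_eq_conj, ← AddChar.map_add_eq_mul, sub_eq_add_neg, dot_add, dot_neg]
    congr 1
    ring
  rw [this, rawCode, rawCode, map_mul]
  ring

theorem sum_plain (hψ : ψ.IsPrimitive) (g u : Vec F) (y' y : Bool) :
    ∑ h, conj (plain g (h - u) y') * plain g (h - u) y =
      if y = y' then (Fintype.card F : ℂ) else 0 := by
  rw [← Equiv.sum_comp (Equiv.addRight u)]
  have := overlap_eq ψ hψ g 0 0 y' y
  simp only [overlap, add_zero, dot, Prod.fst_zero, Prod.snd_zero, zero_mul, AddChar.map_zero_eq_one,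
    mul_one] at this
  simp only [Equiv.coe_addRight, add_sub_cancel_right]
  rw [this]
  have hb : (bit (F := F) y' = bit y) ↔ y = y' := bit_injective.eq_iff.trans eq_comm
  simp [Undetected, hb]

theorem sum_rawCode (hψ : ψ.IsPrimitive) (k : Key F) (y' y : Bool) :
    ∑ h, conj (rawCode ψ k h y') * rawCode ψ k h y =
      if y = y' then (Fintype.card F : ℂ) else 0 := by
  simp_rw [conj_rawCode_mul, sub_self]
  simpa [dot] using sum_plain ψ hψ k.2 k.1.1 y' y

/-- The phase pad forces `h = r` and contributes `q ^ 3`. The shift pad then turns the sum into an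
inner product of code words, worth `q`, and the inner keys give another `q ^ 3`. Averaged over its
key, a block shows nothing of the data. -/
theorem sum_keys (hψ : ψ.IsPrimitive) (h r : Vec F) (y' y : Bool) :
    ∑ k, conj (rawCode ψ k h y') * rawCode ψ k r y =
      if h = r ∧ y = y' then (Fintype.card F : ℂ) ^ 7 else 0 := by
  simp_rw [conj_rawCode_mul, Fintype.sum_prod_type (α₁ := Vec F × Vec F),
    Fintype.sum_prod_type (α₁ := Vec F) (α₂ := Vec F)]
  have e : ∀ u : Vec F, ∑ v : Vec F, ∑ g : Vec F, ψ (-dot v (h - r)) *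
      (conj (plain g (h - u) y') * plain g (r - u) y) =
      if h = r then Fintype.card (Vec F) *
        ∑ g : Vec F, conj (plain g (h - u) y') * plain g (r - u) y else 0 := by
    intro u
    simp_rw [← Finset.mul_sum, ← Finset.sum_mul]
    have : ∑ v, ψ (-dot v (h - r)) = if h = r then (Fintype.card (Vec F) : ℂ) else 0 := by
      have := sum_dot ψ hψ (r - h)
      simp only [sub_eq_zero, eq_comm (a := r)] at this
      rw [← Finset.sum_congr rfl fun v _ => ?_, this]
      · simp
      · rw [← dot_neg, neg_sub]
    rw [this]
    split_ifs <;> simp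
  simp_rw [e]
  by_cases hr : h = r
  · subst hr
    simp only [if_true, true_and, ← Finset.mul_sum]
    rw [Finset.sum_comm]
    have e2 : ∀ g : Vec F, ∑ u, conj (plain g (h - u) y') * plain g (h - u) y =
        if y = y' then (Fintype.card F : ℂ) else 0 := by
      intro g
      rw [← sum_plain ψ hψ g 0 y' y, ← Equiv.sum_comp (Equiv.subLeft h)]
      simp
    simp_rw [e2]
    split_ifs
    · simp [Fintype.card_prod]
      ring
    · simp
  · simp [hr]

/-- Averages over the one-time pads. -/
theorem sum_pads (hψ : ψ.IsPrimitive) (g : Vec F) (y' : Bool) (A : Bool → Vec F → Vec F → ℂ) :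
    ∑ p : Vec F × Vec F, ‖∑ y, ∑ r, ∑ h, conj (rawCode ψ (p, g) h y') * rawCode ψ (p, g) r y *
        A y r h‖ ^ 2 =
      ∑ s, ∑ t, ‖∑ y, overlap ψ g s t y' y * ∑ r, ψ (-dot t r) * A y r (r + s)‖ ^ 2 := by
  have e1 : ∀ u v : Vec F, (∑ y, ∑ r, ∑ h, conj (rawCode ψ ((u, v), g) h y') *
      rawCode ψ ((u, v), g) r y * A y r h) = ∑ s, ψ (-dot v s) * ∑ y, ∑ r,
        (conj (plain g (r + s - u) y') * plain g (r - u) y) * A y r (r + s) := by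
    intro u v
    have : ∀ y r, ∑ h, conj (rawCode ψ ((u, v), g) h y') * rawCode ψ ((u, v), g) r y * A y r h =
        ∑ s, ψ (-dot v s) * ((conj (plain g (r + s - u) y') * plain g (r - u) y) *
          A y r (r + s)) := by
      intro y r
      rw [← Equiv.sum_comp (Equiv.addLeft r)]
      refine Finset.sum_congr rfl fun s _ => ?_
      rw [Equiv.coe_addLeft, conj_rawCode_mul, add_sub_cancel_left, mul_assoc]
    simp_rw [this, Finset.mul_sum]
    exact (Finset.sum_congr rfl fun y _ => Finset.sum_comm).trans Finset.sum_comm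
  rw [Fintype.sum_prod_type]
  -- Parseval's identity in the phase pad `v` separates the displacements `s = h - r`.
  simp_rw [e1, parseval ψ hψ]
  rw [← Finset.mul_sum, Finset.sum_comm, Finset.mul_sum]
  refine Finset.sum_congr rfl fun s _ => ?_
  -- Parseval's identity in the shift pad `u`, read backwards, introduces the phase part `t` of the
  -- Pauli operator.
  rw [← parseval ψ hψ]
  refine Finset.sum_congr rfl fun t _ => ?_
  congr 2
  have e2 : ∀ y r, ∑ u, ψ (-dot t u) * (conj (plain g (r + s - u) y') * plain g (r - u) y) =
      ψ (-dot t r) * overlap ψ g s t y' y := by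
    intro y r
    rw [← Equiv.sum_comp (Equiv.subLeft r), overlap, Finset.mul_sum]
    refine Finset.sum_congr rfl fun w _ => ?_
    have h1 : r + s - (r - w) = w + s := by abel
    have h2 : -dot t (r - w) = -dot t r + dot t w := by
      rw [sub_eq_add_neg, dot_add, dot_neg]
      ring
    rw [Equiv.subLeft_apply, h1, sub_sub_cancel, h2, AddChar.map_add_eq_mul]
    ring
  simp_rw [Finset.mul_sum]
  rw [Finset.sum_comm]
  refine Finset.sum_congr rfl fun y _ => ?_
  rw [Finset.sum_comm]
  refine Finset.sum_congr rfl fun r _ => ?_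
  simp_rw [← mul_assoc]
  rw [← Finset.sum_mul]
  simp_rw [mul_assoc]
  rw [e2]
  ring

/-- After the twirl by the pads only the weights of the Pauli components matter. The identity passes
for all `q ^ 3` inner keys and every other component for at most `q ^ 2`; the identity is therefore
singled out with the excess `q ^ 3 - q ^ 2`, and Parseval's identity sums all weights. -/
theorem second_moment (hψ : ψ.IsPrimitive) (A : Bool → Vec F → Vec F → ℂ) :
    ∑ k : Key F, ∑ y', ‖∑ y, ∑ r, ∑ h, conj (rawCode ψ k h y') * rawCode ψ k r y *
        A y r h‖ ^ 2 ≤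
      ((Fintype.card F : ℝ) ^ 5 - (Fintype.card F : ℝ) ^ 4) * ∑ y, ‖∑ r, A y r r‖ ^ 2 +
        (Fintype.card F : ℝ) ^ 7 * ∑ y, ∑ r, ∑ h, ‖A y r h‖ ^ 2 := by
  set q : ℝ := (Fintype.card F : ℝ) with hq
  have hq1 : 1 ≤ q := by
    rw [hq]
    exact_mod_cast Fintype.card_pos
  -- The unnormalised weight of the attack on the Pauli operator `(s, t)`.
  let S : Vec F → Vec F → ℝ := fun s t => ∑ y, ‖∑ r, ψ (-dot t r) * A y r (r + s)‖ ^ 2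
  have hS : ∀ s t, 0 ≤ S s t := fun s t => Finset.sum_nonneg fun y _ => by positivity
  have hsum : ∑ s, ∑ t, S s t = q ^ 3 * ∑ y, ∑ r, ∑ h, ‖A y r h‖ ^ 2 := by
    have e : ∀ s, ∑ t, S s t = q ^ 3 * ∑ y, ∑ r, ‖A y r (r + s)‖ ^ 2 := by
      intro s
      rw [Finset.sum_comm, Finset.mul_sum]
      refine Finset.sum_congr rfl fun y _ => ?_
      rw [parseval ψ hψ]
      simp [Fintype.card_prod, hq]
      left
      ring
    simp_rw [e]
    rw [← Finset.mul_sum, Finset.sum_comm]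
    congr 1
    refine Finset.sum_congr rfl fun y _ => ?_
    rw [Finset.sum_comm]
    refine Finset.sum_congr rfl fun r _ => ?_
    exact Equiv.sum_comp (Equiv.addLeft r) fun h => ‖A y r h‖ ^ 2
  have h0 : S 0 0 = ∑ y, ‖∑ r, A y r r‖ ^ 2 := by simp [S, dot]
  have hcount : ∀ s t, ((Finset.univ.filter fun g : Vec F => Undetected g s t).card : ℝ) ≤
      q ^ 2 + if (s, t) = 0 then q ^ 3 - q ^ 2 else 0 := by
    intro s t
    split_ifs with h
    · refine (Nat.cast_le.2 (Finset.card_le_univ _)).trans (le_of_eq ?_)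
      simp [Fintype.card_prod, hq]
      ring
    · rw [add_zero, hq]
      exact_mod_cast card_undetected s t h
  calc ∑ k : Key F, ∑ y', ‖∑ y, ∑ r, ∑ h, conj (rawCode ψ k h y') * rawCode ψ k r y *
        A y r h‖ ^ 2
      = ∑ g : Vec F, ∑ y', ∑ s, ∑ t,
          ‖∑ y, overlap ψ g s t y' y * ∑ r, ψ (-dot t r) * A y r (r + s)‖ ^ 2 := by
        rw [Fintype.sum_prod_type, Finset.sum_comm]
        refine Finset.sum_congr rfl fun g _ => ?_
        rw [Finset.sum_comm]
        exact Finset.sum_congr rfl fun y' _ => sum_pads ψ hψ g y' A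
    _ = ∑ g : Vec F, ∑ s, ∑ t, ∑ y',
          ‖∑ y, overlap ψ g s t y' y * ∑ r, ψ (-dot t r) * A y r (r + s)‖ ^ 2 := by
        refine Finset.sum_congr rfl fun g _ => ?_
        rw [Finset.sum_comm]
        exact Finset.sum_congr rfl fun s _ => Finset.sum_comm
    _ ≤ ∑ g : Vec F, ∑ s, ∑ t, if Undetected g s t then q ^ 2 * S s t else 0 :=
        Finset.sum_le_sum fun g _ => Finset.sum_le_sum fun s _ => Finset.sum_le_sum fun t _ =>
          sum_overlap_le ψ hψ g s t _
    _ = ∑ s, ∑ t, (Finset.univ.filter fun g : Vec F => Undetected g s t).card *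
          (q ^ 2 * S s t) := by
        rw [Finset.sum_comm]
        refine Finset.sum_congr rfl fun s _ => ?_
        rw [Finset.sum_comm]
        refine Finset.sum_congr rfl fun t _ => ?_
        rw [← Finset.sum_filter, Finset.sum_const, nsmul_eq_mul]
    _ ≤ ∑ s, ∑ t, (q ^ 2 + if (s, t) = 0 then q ^ 3 - q ^ 2 else 0) * (q ^ 2 * S s t) :=
        Finset.sum_le_sum fun s _ => Finset.sum_le_sum fun t _ =>
          mul_le_mul_of_nonneg_right (hcount s t) (mul_nonneg (by positivity) (hS s t))
    _ = (q ^ 5 - q ^ 4) * S 0 0 + q ^ 4 * ∑ s, ∑ t, S s t := by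
        have : ∀ s t, (q ^ 2 + if (s, t) = 0 then q ^ 3 - q ^ 2 else 0) * (q ^ 2 * S s t) =
            q ^ 4 * S s t + if s = 0 then (if t = 0 then (q ^ 5 - q ^ 4) * S s t else 0) else 0 := by
          intro s t
          by_cases hs : s = 0 <;> by_cases ht : t = 0 <;> simp [hs, ht, Prod.mk_eq_zero] <;> ring
        simp_rw [this, Finset.sum_add_distrib, ← Finset.mul_sum]
        simp
        ring
    _ = _ := by rw [hsum, h0]; ring

end AuthCode
end
end QPIP

/-! ### The authentication code on qubits and with keys of bits -/

open Computability
namespace QPIP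
noncomputable section

open ComplexConjugate

/-- A family of encodings of one qubit in `c + 1` qubits, with keys of `m` bits, that detects all
but a fraction `δ` of the attacks. -/
structure Code (c m : ℕ) (δ : ℝ) where
  enc : (Fin m → Bool) → (Fin (c + 1) → Bool) → Bool → ℂ
  iso : ∀ k y' y, ∑ h, conj (enc k h y') * enc k h y = if y = y' then 1 else 0
  mean : ∀ h r y' y, ∑ k, conj (enc k h y') * enc k r y =
    if h = r ∧ y = y' then (2 : ℂ) ^ m / 2 ^ (c + 1) else 0
  second : ∀ A : Bool → (Fin (c + 1) → Bool) → (Fin (c + 1) → Bool) → ℂ,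
    (2 : ℝ) ^ (c + 1) * ∑ k, ∑ y', ‖∑ y, ∑ r, ∑ h, conj (enc k h y') * enc k r y * A y r h‖ ^ 2 ≤
      2 ^ m * ((1 - δ) * (∑ y, ‖∑ r, A y r r‖ ^ 2 / 2 ^ (c + 1)) + δ * ∑ y, ∑ r, ∑ h, ‖A y r h‖ ^ 2)

/-- Over the field with `2 ^ d` elements a block of three field elements is a string of `3 * d`
bits, and a key of nine field elements is one of `9 * d` bits. Arbitrary bijections serve for both,
since the properties of a code are sums over all blocks and keys. -/
theorem exists_code (d : ℕ) (hd : d ≠ 0) :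
    Nonempty (Code (3 * d - 1) (9 * d) ((2 : ℝ) ^ d)⁻¹) := by
  classical
  have : Fact (Nat.Prime 2) := ⟨Nat.prime_two⟩
  let F := GaloisField 2 d
  have : Fintype F := Fintype.ofFinite F
  have hF : Fintype.card F = 2 ^ d := by
    rw [← Nat.card_eq_fintype_card, GaloisField.card 2 d hd]
  obtain ⟨ψ, hψ⟩ : ∃ ψ : AddChar F ℂ, ψ.IsPrimitive := by
    obtain ⟨ψ, hψ⟩ := AddChar.exists_apply_ne_zero.2 (one_ne_zero (α := F))
    refine ⟨ψ, AddChar.IsPrimitive.of_ne_one fun h => hψ ?_⟩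
    rw [h, AddChar.one_apply]
  have hd3 : 3 * d - 1 + 1 = 3 * d := by omega
  have eH : Nonempty ((Fin (3 * d - 1 + 1) → Bool) ≃ AuthCode.Vec F) := by
    refine Fintype.card_eq.1 ?_
    simp only [Fintype.card_pi, Fintype.card_bool, Finset.prod_const, Finset.card_univ,
      Fintype.card_fin, Fintype.card_prod, hF, hd3]
    ring
  have eK : Nonempty ((Fin (9 * d) → Bool) ≃ AuthCode.Key F) := by
    refine Fintype.card_eq.1 ?_
    simp only [Fintype.card_pi, Fintype.card_bool, Finset.prod_const, Finset.card_univ,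
      Fintype.card_fin, Fintype.card_prod, hF]
    ring
  obtain ⟨eH⟩ := eH
  obtain ⟨eK⟩ := eK
  set q : ℝ := (2 : ℝ) ^ d with hq
  have hq0 : 0 < q := by positivity
  have hFq : (Fintype.card F : ℝ) = q := by rw [hF]; push_cast; rfl
  have hFc : (Fintype.card F : ℂ) = (q : ℂ) := by rw [← hFq]; push_cast; rfl
  have hqc : (q : ℂ) ≠ 0 := by exact_mod_cast hq0.ne'
  -- Raw code words have squared norm `q`.
  let a : ℂ := ((Real.sqrt q)⁻¹ : ℝ)
  have ha : conj a * a = (q : ℂ)⁻¹ := by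
    rw [Complex.conj_ofReal, ← Complex.ofReal_mul, ← mul_inv, Real.mul_self_sqrt hq0.le]
    push_cast
    rfl
  have hmul : ∀ k h r y' y, conj (a * AuthCode.rawCode ψ k h y') * (a * AuthCode.rawCode ψ k r y) =
      (q : ℂ)⁻¹ * (conj (AuthCode.rawCode ψ k h y') * AuthCode.rawCode ψ k r y) := by
    intro k h r y' y
    rw [← ha, map_mul]
    ring
  have hH : (2 : ℝ) ^ (3 * d - 1 + 1) = q ^ 3 := by rw [hd3, hq]; ring
  have hK : (2 : ℝ) ^ (9 * d) = q ^ 9 := by rw [hq]; ring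
  refine ⟨⟨fun k h y => a * AuthCode.rawCode ψ (eK k) (eH h) y, ?_, ?_, ?_⟩⟩
  · intro k y' y
    simp_rw [hmul, ← Finset.mul_sum]
    rw [Equiv.sum_comp eH fun h => conj (AuthCode.rawCode ψ (eK k) h y') *
      AuthCode.rawCode ψ (eK k) h y, AuthCode.sum_rawCode ψ hψ, hFc]
    split_ifs
    · field_simp
    · simp
  · intro h r y' y
    simp_rw [hmul, ← Finset.mul_sum]
    rw [Equiv.sum_comp eK fun k => conj (AuthCode.rawCode ψ k (eH h) y') *
      AuthCode.rawCode ψ k (eH r) y, AuthCode.sum_keys ψ hψ, hFc]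
    simp only [eH.apply_eq_iff_eq]
    split_ifs
    · have h1 : (2 : ℂ) ^ (3 * d - 1 + 1) = (q : ℂ) ^ 3 := by exact_mod_cast congrArg (Complex.ofReal) hH
      have h2 : (2 : ℂ) ^ (9 * d) = (q : ℂ) ^ 9 := by exact_mod_cast congrArg (Complex.ofReal) hK
      rw [h1, h2]
      field_simp
    · simp
  · intro A
    have h1 := AuthCode.second_moment ψ hψ fun y r h => A y (eH.symm r) (eH.symm h)
    simp_rw [hmul]
    have e1 : ∀ k y', (∑ y, ∑ r, ∑ h, (q : ℂ)⁻¹ * (conj (AuthCode.rawCode ψ (eK k) (eH h) y') *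
        AuthCode.rawCode ψ (eK k) (eH r) y) * A y r h) = (q : ℂ)⁻¹ * ∑ y, ∑ r, ∑ h,
        (conj (AuthCode.rawCode ψ (eK k) h y') * AuthCode.rawCode ψ (eK k) r y) *
          A y (eH.symm r) (eH.symm h) := by
      intro k y'
      simp_rw [Finset.mul_sum]
      refine Finset.sum_congr rfl fun y _ => ?_
      rw [← Equiv.sum_comp eH]
      refine Finset.sum_congr rfl fun r _ => ?_
      rw [← Equiv.sum_comp eH]
      refine Finset.sum_congr rfl fun h _ => ?_
      rw [eH.symm_apply_apply, eH.symm_apply_apply]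
      ring
    have e2 : ∑ y, ‖∑ r, A y (eH.symm r) (eH.symm r)‖ ^ 2 = ∑ y, ‖∑ r, A y r r‖ ^ 2 := by
      refine Finset.sum_congr rfl fun y _ => ?_
      rw [Equiv.sum_comp eH.symm fun r => A y r r]
    have e3 : ∑ y, ∑ r, ∑ h, ‖A y (eH.symm r) (eH.symm h)‖ ^ 2 =
        ∑ y, ∑ r, ∑ h, ‖A y r h‖ ^ 2 := by
      refine Finset.sum_congr rfl fun y _ => ?_
      rw [Equiv.sum_comp eH.symm fun r => ∑ h, ‖A y r (eH.symm h)‖ ^ 2]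
      refine Finset.sum_congr rfl fun r _ => ?_
      rw [Equiv.sum_comp eH.symm fun h => ‖A y r h‖ ^ 2]
    rw [e2, e3, hFq] at h1
    simp_rw [e1, norm_mul, mul_pow, ← Finset.mul_sum]
    rw [Equiv.sum_comp eK fun k => ∑ y', ‖∑ y, ∑ r, ∑ h, (conj (AuthCode.rawCode ψ k h y') *
        AuthCode.rawCode ψ k r y) * A y (eH.symm r) (eH.symm h)‖ ^ 2, hH, hK]
    have e4 : ‖(q : ℂ)⁻¹‖ = q⁻¹ := by
      rw [norm_inv, Complex.norm_real, Real.norm_of_nonneg hq0.le]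
    rw [e4, ← Finset.sum_div]
    refine (mul_le_mul_of_nonneg_left (mul_le_mul_of_nonneg_left h1 (by positivity))
      (by positivity)).trans (le_of_eq ?_)
    field_simp

/-- Orthonormal vectors are columns of a unitary matrix. -/
theorem exists_unitary_extension {H Y : Type} [Fintype H] [DecidableEq H] [DecidableEq Y]
    (h₀ : Y → H) (inj : Function.Injective h₀) (v : H → Y → ℂ)
    (hv : ∀ y' y, ∑ h, conj (v h y') * v h y = if y = y' then 1 else 0) :
    ∃ U : Unitary H, ∀ h y, U.1 h (h₀ y) = v h y := by
  classical
  let w : H → EuclideanSpace ℂ H := fun i =>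
    if hi : ∃ y, h₀ y = i then WithLp.toLp 2 fun h => v h hi.choose else 0
  have hw : ∀ y, w (h₀ y) = WithLp.toLp 2 fun h => v h y := by
    intro y
    have hi : ∃ y', h₀ y' = h₀ y := ⟨y, rfl⟩
    simp only [w, dif_pos hi, inj hi.choose_spec]
  have ho : Orthonormal ℂ ((Set.range h₀).domRestrict w) := by
    rw [orthonormal_iff_ite]
    rintro ⟨i, hi⟩ ⟨j, hj⟩
    have key : inner ℂ (w i) (w j) = if i = j then (1 : ℂ) else 0 := ?_
    · simp only [Subtype.mk.injEq]
      exact key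
    obtain ⟨y', rfl⟩ := hi
    obtain ⟨y, rfl⟩ := hj
    simp only [inj.eq_iff, eq_comm (a := y')]
    rw [← hv y' y]
    simp only [hw, PiLp.inner_apply, RCLike.inner_apply]
    exact Finset.sum_congr rfl fun h _ => mul_comm _ _
  obtain ⟨b, hb⟩ := ho.exists_orthonormalBasis_extension_of_card_eq (by simp)
  refine ⟨⟨Matrix.of fun h i => b i h, ?_⟩, ?_⟩
  · rw [Matrix.mem_unitaryGroup_iff']
    ext i j
    have := orthonormal_iff_ite.1 b.orthonormal i j
    simp only [PiLp.inner_apply, RCLike.inner_apply] at this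
    simp only [Matrix.mul_apply, Matrix.star_apply, Matrix.one_apply, Matrix.of_apply, ← this]
    exact Finset.sum_congr rfl fun h _ => mul_comm _ _
  · intro h y
    change b (h₀ y) h = v h y
    rw [hb _ ⟨y, rfl⟩, hw]

/-- The block with cleared ancilla qubits and the data bit `y`. -/
def clearBlock {c : ℕ} (y : Bool) : Fin (c + 1) → Bool :=
  Function.update (fun _ => false) (Fin.last c) y

theorem clearBlock_injective {c : ℕ} : Function.Injective (clearBlock (c := c)) := by
  intro y y' h
  simpa [clearBlock] using congrFun h (Fin.last c)

namespace Code

variable {c m : ℕ} {δ : ℝ} (𝒞 : Code c m δ)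

/-- A unitary operator that encodes a qubit. -/
def unitary (k : Fin m → Bool) : Unitary (Fin (c + 1) → Bool) :=
  (exists_unitary_extension clearBlock clearBlock_injective (𝒞.enc k) (𝒞.iso k)).choose

theorem unitary_apply (k : Fin m → Bool) (h : Fin (c + 1) → Bool) (y : Bool) :
    (𝒞.unitary k).1 h (clearBlock y) = 𝒞.enc k h y :=
  (exists_unitary_extension clearBlock clearBlock_injective (𝒞.enc k) (𝒞.iso k)).choose_spec h y

end Code
end
end QPIP

open Computability
namespace QPIP
noncomputable section

open ComplexConjugate

/-! ### Runs of a controller -/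

/-- The instructions for a register of `a` work qubits and a block of `b` qubits. -/
inductive BlockInstr (a b : ℕ) where
  | flip
  | unitary (U : Unitary ((Fin a → Bool) × (Fin b → Bool)))
  | measure (i : Fin b)
  | exchange (i : Fin b)
  | accept
  | reject

/-- States of the work qubits, the block and the prover. -/
abbrev State (a b : ℕ) (M : Type) : Type := (Fin a → Bool) → (Fin b → Bool) → M → ℂ

variable {a b : ℕ} {M : Type} [Fintype M]

/-- The squared norm of a state. -/
def sqNorm (ψ : State a b M) : ℝ := ∑ w, ∑ h, ∑ m, ‖ψ w h m‖ ^ 2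

/-- The prover acts on qubit `i` of the block. -/
def exchangeBit (U : Matrix (Bool × M) (Bool × M) ℂ) (i : Fin b) :
    Module.End ℂ ((Fin b → Bool) → M → ℂ) where
  toFun φ := fun h m => ∑ r : Bool × M, U (h i, m) r * φ (Function.update h i r.1) r.2
  map_add' φ φ' := by
    funext h m
    simp [mul_add, Finset.sum_add_distrib]
  map_smul' z φ := by
    funext h m
    simp only [Pi.smul_apply, smul_eq_mul, RingHom.id_apply, Finset.mul_sum]
    exact Finset.sum_congr rfl fun r _ => by ring

def applyReg (U : Unitary ((Fin a → Bool) × (Fin b → Bool))) (ψ : State a b M) : State a b M :=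
  fun w h m => ∑ q : (Fin a → Bool) × (Fin b → Bool), U.1 (w, h) q * ψ q.1 q.2 m

def projectBit (i : Fin b) (v : Bool) (ψ : State a b M) : State a b M :=
  fun w h m => if h i = v then ψ w h m else 0

/-- The acceptance probability of a controller whose states are labelled with instructions, when
the prover applies `U t` in the interaction number `t`. -/
def blockRun {A : Type} (V : Controller A) (instr : V.Q → BlockInstr a b)
    (U : ℕ → Matrix (Bool × M) (Bool × M) ℂ) : ℕ → V.Conf → ℕ → State a b M → ℝ
  | 0, c, _, ψ =>
    match instr c.q with
    | .accept => sqNorm ψ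
    | _ => 0
  | k + 1, c, t, ψ =>
    match instr c.q with
    | .accept => sqNorm ψ
    | .reject => 0
    | .flip => (blockRun V instr U k (V.next c false) t ψ +
        blockRun V instr U k (V.next c true) t ψ) / 2
    | .unitary W => blockRun V instr U k (V.next c false) t (applyReg W ψ)
    | .measure i => ∑ v, blockRun V instr U k (V.next c v) t (projectBit i v ψ)
    | .exchange i => blockRun V instr U k (V.next c false) (t + 1)
        fun w => exchangeBit (U t) i (ψ w)

/-- The registers of `a + b` qubits. -/
def regEquiv (a b : ℕ) : (Fin a → Bool) × (Fin b → Bool) ≃ (Fin (a + b) → Bool) :=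
  Fin.appendEquiv a b

theorem regEquiv_apply (p : (Fin a → Bool) × (Fin b → Bool)) :
    regEquiv a b p = Fin.append p.1 p.2 := rfl

theorem regEquiv_natAdd (w : Fin a → Bool) (h : Fin b → Bool) (i : Fin b) :
    regEquiv a b (w, h) (Fin.natAdd a i) = h i := by
  simp [regEquiv_apply]

theorem update_regEquiv (w : Fin a → Bool) (h : Fin b → Bool) (i : Fin b) (v : Bool) :
    Function.update (regEquiv a b (w, h)) (Fin.natAdd a i) v =
      regEquiv a b (w, Function.update h i v) := by
  funext j
  refine Fin.addCases (fun j => ?_) (fun j => ?_) j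
  · have : Fin.castAdd b j ≠ Fin.natAdd a i := by
      intro h
      have := congrArg Fin.val h
      simp at this
      omega
    simp [regEquiv_apply, Function.update_of_ne this]
  · by_cases h : j = i
    · subst h
      simp [regEquiv_apply]
    · have : Fin.natAdd a j ≠ Fin.natAdd a i := fun h' => h (Fin.natAdd_injective _ _ h')
      simp [regEquiv_apply, Function.update_of_ne this, Function.update_of_ne h]

/-- An operator on the two parts of the register as an operator on all qubits. -/
def regUnitary (U : Unitary ((Fin a → Bool) × (Fin b → Bool))) : Unitary (Fin (a + b) → Bool) :=
  ⟨U.1.submatrix (regEquiv a b).symm (regEquiv a b).symm, by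
    rw [Matrix.mem_unitaryGroup_iff, Matrix.star_eq_conjTranspose, Matrix.conjTranspose_submatrix,
      Matrix.submatrix_mul_equiv, ← Matrix.star_eq_conjTranspose,
      Matrix.mem_unitaryGroup_iff.1 U.2, Matrix.submatrix_one_equiv]⟩

def BlockInstr.toInstr : BlockInstr a b → Instr (a + b)
  | .flip => .flip
  | .unitary U => .unitary (regUnitary U)
  | .measure i => .measure (Fin.natAdd a i)
  | .exchange i => .exchange (Fin.natAdd a i)
  | .accept => .accept
  | .reject => .reject

/-- The verifier that is controlled by a real-time machine. -/
def Controller.verifier {A : Type} [Fintype A] (V : Controller A) (instr : V.Q → BlockInstr a b)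
    (rounds : Polynomial ℕ) : Verifier A (a + b) where
  Label := V.Q
  instr q := (instr q).toInstr
  next := V.label
  polyTime := V.polyTime_label
  rounds := rounds

theorem sum_regEquiv {β : Type} [AddCommMonoid β] (f : (Fin (a + b) → Bool) × M → β) :
    ∑ p, f p = ∑ w, ∑ h, ∑ m, f (regEquiv a b (w, h), m) := by
  rw [Fintype.sum_prod_type, ← Equiv.sum_comp (regEquiv a b), Fintype.sum_prod_type]

/-- This verifier never uses the classical channel, so the list of channels carries only its length.
This is why the strategy may be replaced by a sequence of operators indexed by the number of
exchanges. -/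
theorem run_verifier {A : Type} [Fintype A] (V : Controller A) (instr : V.Q → BlockInstr a b)
    (rounds : Polynomial ℕ) (S : Strategy) (x : List A) (k : ℕ) (l : List Bool) (t : ℕ)
    (ψ : (Fin (a + b) → Bool) × S.M → ℂ) :
    run (V.verifier instr rounds) S x k l (List.replicate t .quantum) ψ =
      blockRun V instr (fun t => (S.act (List.replicate (t + 1) .quantum)).1) k
        (l.foldl V.next (V.init x)) t fun w h m => ψ (regEquiv a b (w, h), m) := by
  have hq : ∀ l, (V.verifier instr rounds).instr ((V.verifier instr rounds).next (x, l)) =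
      (instr (l.foldl V.next (V.init x)).q).toInstr := fun l => rfl
  induction k generalizing l t ψ with
  | zero =>
    rw [run, blockRun.eq_def, hq]
    dsimp only
    cases instr (l.foldl V.next (V.init x)).q <;> simp [BlockInstr.toInstr, sqNorm, sum_regEquiv]
  | succ k ih =>
    rw [run, blockRun.eq_def, hq]
    dsimp only
    cases hi : instr (l.foldl V.next (V.init x)).q with
    | flip => simp only [BlockInstr.toInstr, ih, List.foldl_append, List.foldl_cons, List.foldl_nil]
    | unitary U =>
      simp only [BlockInstr.toInstr, ih, List.foldl_append, List.foldl_cons, List.foldl_nil]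
      congr 1
      funext w h m
      rw [applyReg, ← Equiv.sum_comp (regEquiv a b)]
      simp [regUnitary]
    | measure i =>
      simp only [BlockInstr.toInstr, ih, List.foldl_append, List.foldl_cons, List.foldl_nil]
      simp only [regEquiv_natAdd]
      rfl
    | exchange i =>
      simp only [BlockInstr.toInstr, ← List.replicate_succ', ih, List.foldl_append,
        List.foldl_cons, List.foldl_nil]
      simp only [regEquiv_natAdd, update_regEquiv]
      rfl
    | accept => simp [BlockInstr.toInstr, sqNorm, sum_regEquiv]
    | reject => simp [BlockInstr.toInstr]

/-- The initial state. -/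
def initState (S : Strategy) : State a b S.M :=
  fun w h m => if w = (fun _ => false) ∧ h = (fun _ => false) then S.init m else 0

theorem acceptProb_verifier {A : Type} [Fintype A] (V : Controller A)
    (instr : V.Q → BlockInstr a b) (rounds : Polynomial ℕ) (S : Strategy) (x : List A) :
    acceptProb (V.verifier instr rounds) S x =
      blockRun V instr (fun t => (S.act (List.replicate (t + 1) .quantum)).1)
        (rounds.eval x.length) (V.init x) 0 (initState S) := by
  rw [acceptProb]
  refine (run_verifier V instr rounds S x _ [] 0 _).trans ?_
  congr 1
  funext w h m
  have : regEquiv a b (w, h) = (fun _ => false) ↔ w = (fun _ => false) ∧ h = (fun _ => false) := by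
    have e : (fun _ => false) = regEquiv a b (fun _ => false, fun _ => false) := by
      rw [regEquiv_apply]
      funext i
      refine Fin.addCases (fun i => ?_) (fun i => ?_) i <;> simp
    rw [e, (regEquiv a b).apply_eq_iff_eq, Prod.mk.injEq]
  simp only [initState, this]

end
end QPIP

open Computability
namespace QPIP
noncomputable section

open ComplexConjugate BigOperators

/-! ### Quantum operations on encoded qubits -/

theorem sum_norm_sq_unitary {B : Type} [Fintype B] [DecidableEq B] (U : Unitary B) (v : B → ℂ) :
    ∑ b, ‖∑ q, U.1 b q * v q‖ ^ 2 = ∑ b, ‖v b‖ ^ 2 := by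
  have := sum_norm_sq_of_orthogonal (fun i s => U.1 i s) 1 (fun s s' => ?_) v
  · simpa using this
  · have h := congrFun (congrFun (Matrix.mem_unitaryGroup_iff'.1 U.2) s') s
    rw [Matrix.mul_apply, Matrix.one_apply] at h
    simp only [Matrix.star_apply] at h
    rw [Complex.ofReal_one]
    simp only [eq_comm (a := s)]
    rw [← h]
    exact Finset.sum_congr rfl fun i _ => mul_comm _ _

/-- States of the work qubits, one decoded qubit and the prover. -/
abbrev Opened (a : ℕ) (M : Type) : Type := (Fin a → Bool) → Bool → M → ℂ

variable {c m n a b : ℕ} {δ : ℝ} {M : Type} [Fintype M]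

def Opened.sqNorm (φ : Opened a M) : ℝ := ∑ w, ∑ y, ∑ z, ‖φ w y z‖ ^ 2

namespace Code

variable (𝒞 : Code c m δ)

/-- Decoding of a block. -/
def decode (k : Fin m → Bool) : State a (c + 1) M →ₗ[ℂ] Opened a M where
  toFun ψ := fun w y z => ∑ h, conj (𝒞.enc k h y) * ψ w h z
  map_add' ψ ψ' := by
    funext w y z
    simp [mul_add, Finset.sum_add_distrib]
  map_smul' r ψ := by
    funext w y z
    simp only [Pi.smul_apply, smul_eq_mul, RingHom.id_apply, Finset.mul_sum]
    exact Finset.sum_congr rfl fun h _ => by ring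

/-- Encoding of a qubit. -/
def encode (k : Fin m → Bool) : Opened a M →ₗ[ℂ] State a (c + 1) M where
  toFun φ := fun w h z => ∑ y, 𝒞.enc k h y * φ w y z
  map_add' φ φ' := by
    funext w h z
    simp [mul_add, Finset.sum_add_distrib]
  map_smul' r φ := by
    funext w h z
    simp only [Pi.smul_apply, smul_eq_mul, RingHom.id_apply, Finset.mul_sum]
    exact Finset.sum_congr rfl fun y _ => by ring

omit [Fintype M] in
theorem decode_apply (k : Fin m → Bool) (ψ : State a (c + 1) M) (w y z) :
    𝒞.decode k ψ w y z = ∑ h, conj (𝒞.enc k h y) * ψ w h z := rfl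

omit [Fintype M] in
theorem encode_apply (k : Fin m → Bool) (φ : Opened a M) (w h z) :
    𝒞.encode k φ w h z = ∑ y, 𝒞.enc k h y * φ w y z := rfl

/-- Decoding is the adjoint of the encoding unitary followed by the restriction to blocks with
cleared ancillas; the discarded part is what the verifier rejects. -/
theorem sqNorm_decode_le (k : Fin m → Bool) (ψ : State a (c + 1) M) :
    (𝒞.decode k ψ).sqNorm ≤ sqNorm ψ := by
  refine Finset.sum_le_sum fun w _ => ?_
  rw [Finset.sum_comm, Finset.sum_comm (s := (Finset.univ : Finset (Fin (c + 1) → Bool)))]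
  refine Finset.sum_le_sum fun z _ => ?_
  let V : Unitary (Fin (c + 1) → Bool) := star (𝒞.unitary k)
  have h1 := sum_norm_sq_unitary V fun h => ψ w h z
  rw [← h1]
  have h2 : ∀ y, 𝒞.decode k ψ w y z = ∑ q, V.1 (clearBlock y) q * ψ w q z := by
    intro y
    rw [decode_apply]
    refine Finset.sum_congr rfl fun h _ => ?_
    rw [← 𝒞.unitary_apply]
    rfl
  simp_rw [h2]
  rw [← Finset.sum_image (g := clearBlock)
    (f := fun b => ‖∑ q, V.1 b q * ψ w q z‖ ^ 2) (clearBlock_injective.injOn)]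
  exact Finset.sum_le_sum_of_subset_of_nonneg (Finset.subset_univ _) fun _ _ _ => by positivity

theorem sqNorm_encode (k : Fin m → Bool) (φ : Opened a M) :
    sqNorm (𝒞.encode k φ) = φ.sqNorm := by
  refine Finset.sum_congr rfl fun w _ => ?_
  rw [Finset.sum_comm, Finset.sum_comm (s := (Finset.univ : Finset Bool))]
  refine Finset.sum_congr rfl fun z _ => ?_
  have := sum_norm_sq_of_orthogonal (fun h y => 𝒞.enc k h y) 1 (fun s s' => ?_) fun y => φ w y z
  · simpa [encode_apply] using this
  · rw [Complex.ofReal_one, ← 𝒞.iso k s' s]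
    exact Finset.sum_congr rfl fun h _ => mul_comm _ _

end Code

/-- A permutation of the basis states of the work qubits and the decoded qubit. -/
def permute (σ : Equiv.Perm ((Fin a → Bool) × Bool)) : Opened a M →ₗ[ℂ] Opened a M where
  toFun φ := fun w y z => φ (σ (w, y)).1 (σ (w, y)).2 z
  map_add' _ _ := rfl
  map_smul' _ _ := rfl

theorem sqNorm_permute (σ : Equiv.Perm ((Fin a → Bool) × Bool)) (φ : Opened a M) :
    (permute σ φ).sqNorm = φ.sqNorm := by
  have e : ∀ φ : Opened a M, φ.sqNorm = ∑ p : (Fin a → Bool) × Bool, ∑ z, ‖φ p.1 p.2 z‖ ^ 2 :=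
    fun φ => by rw [Opened.sqNorm, Fintype.sum_prod_type]
  rw [e, e]
  exact Equiv.sum_comp σ fun p => ∑ z, ‖φ p.1 p.2 z‖ ^ 2

/-- A unitary operator on the work qubits. -/
def workGate (U : Unitary (Fin a → Bool)) : State a b M →ₗ[ℂ] State a b M where
  toFun ψ := fun w h z => ∑ v, U.1 w v * ψ v h z
  map_add' ψ ψ' := by
    funext w h z
    simp [mul_add, Finset.sum_add_distrib]
  map_smul' r ψ := by
    funext w h z
    simp only [Pi.smul_apply, smul_eq_mul, RingHom.id_apply, Finset.mul_sum]
    exact Finset.sum_congr rfl fun h _ => by ring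

theorem sqNorm_workGate (U : Unitary (Fin a → Bool)) (ψ : State a b M) :
    sqNorm (workGate U ψ) = sqNorm ψ := by
  rw [sqNorm, sqNorm, Finset.sum_comm,
    Finset.sum_comm (s := (Finset.univ : Finset (Fin a → Bool)))]
  refine Finset.sum_congr rfl fun h _ => ?_
  rw [Finset.sum_comm, Finset.sum_comm (s := (Finset.univ : Finset (Fin a → Bool)))]
  exact Finset.sum_congr rfl fun z _ => sum_norm_sq_unitary U fun v => ψ v h z

/-- An operator on the block and the prover. -/
def onBlock (X : Module.End ℂ ((Fin b → Bool) → M → ℂ)) : State a b M →ₗ[ℂ] State a b M where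
  toFun ψ := fun w => X (ψ w)
  map_add' ψ ψ' := by
    funext w
    simp
  map_smul' r ψ := by
    funext w
    simp

/-- An operator that preserves norms. -/
def IsIsometry (X : Module.End ℂ ((Fin b → Bool) → M → ℂ)) : Prop :=
  ∀ φ, ∑ h, ∑ z, ‖X φ h z‖ ^ 2 = ∑ h, ∑ z, ‖φ h z‖ ^ 2

theorem sqNorm_onBlock {X : Module.End ℂ ((Fin b → Bool) → M → ℂ)} (hX : IsIsometry X)
    (ψ : State a b M) : sqNorm (onBlock X ψ) = sqNorm ψ :=
  Finset.sum_congr rfl fun w _ => hX (ψ w)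

omit [Fintype M] in
theorem IsIsometry.mul [Fintype M] {X Y : Module.End ℂ ((Fin b → Bool) → M → ℂ)}
    (hX : IsIsometry X) (hY : IsIsometry Y) : IsIsometry (X * Y) := fun φ => by
  rw [Module.End.mul_apply, hX, hY]

theorem isIsometry_one : IsIsometry (1 : Module.End ℂ ((Fin b → Bool) → M → ℂ)) := fun _ => rfl

theorem isIsometry_exchangeBit [DecidableEq M] (U : Unitary (Bool × M)) (i : Fin (c + 1)) :
    IsIsometry (exchangeBit U.1 i) := by
  intro φ
  rw [← Equiv.sum_comp (Fin.insertNthEquiv (fun _ => Bool) i),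
    ← Equiv.sum_comp (Fin.insertNthEquiv (fun _ => Bool) i), Fintype.sum_prod_type,
    Fintype.sum_prod_type, Finset.sum_comm, Finset.sum_comm (s := (Finset.univ : Finset Bool))]
  refine Finset.sum_congr rfl fun h _ => ?_
  have := sum_norm_sq_unitary U fun r => φ (Fin.insertNth i r.1 h) r.2
  rw [Fintype.sum_prod_type, Fintype.sum_prod_type] at this
  simpa [exchangeBit, Fin.insertNthEquiv] using this

/-! ### Quadratic forms and averages -/

/-- The identity for the variance that holds for sums of squares of norms of linear forms. -/
def HasVariance {V : Type} [AddCommGroup V] [Module ℂ V] (m : ℕ) (Q : V → ℝ) : Prop :=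
  ∀ (Φ : (Fin m → Bool) → V) (μ : V), ∑ k, Φ k = (2 : ℂ) ^ m • μ →
    𝔼 k, Q (Φ k) = Q μ + 𝔼 k, Q (Φ k - μ)

namespace HasVariance

variable {V W : Type} [AddCommGroup V] [Module ℂ V] [AddCommGroup W] [Module ℂ W]

/-- The identity is inherited under linear substitutions, sums and averages. Starting from `norm_sq`
it thereby reaches the acceptance probabilities of whole scripts. -/
theorem comp {Q : W → ℝ} (hQ : HasVariance m Q) (T : V →ₗ[ℂ] W) :
    HasVariance m fun v => Q (T v) := by
  intro Φ μ h
  have := hQ (fun k => T (Φ k)) (T μ) (by rw [← map_sum, h, map_smul])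
  simpa only [← map_sub] using this

theorem sum {I : Type} (s : Finset I) {Q : I → V → ℝ} (hQ : ∀ i ∈ s, HasVariance m (Q i)) :
    HasVariance m fun v => ∑ i ∈ s, Q i v := by
  intro Φ μ h
  rw [Finset.expect_sum_comm, Finset.expect_sum_comm, ← Finset.sum_add_distrib]
  exact Finset.sum_congr rfl fun i hi => hQ i hi Φ μ h

theorem expect {I : Type} (s : Finset I) {Q : I → V → ℝ} (hQ : ∀ i ∈ s, HasVariance m (Q i)) :
    HasVariance m fun v => 𝔼 i ∈ s, Q i v := by
  intro Φ μ h
  rw [Finset.expect_comm, Finset.expect_comm (s := Finset.univ), ← Finset.expect_add_distrib]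
  exact Finset.expect_congr rfl fun i hi => hQ i hi Φ μ h

theorem norm_sq : HasVariance m fun z : ℂ => ‖z‖ ^ 2 := by
  intro Φ μ h
  have e : ∀ k, ‖Φ k - μ‖ ^ 2 = ‖Φ k‖ ^ 2 + ‖μ‖ ^ 2 - 2 * (Φ k * conj μ).re := by
    intro k
    rw [← Complex.normSq_eq_norm_sq, ← Complex.normSq_eq_norm_sq, ← Complex.normSq_eq_norm_sq,
      Complex.normSq_sub]
  have hs : ∑ k, (Φ k * conj μ).re = 2 ^ m * ‖μ‖ ^ 2 := by
    rw [← Complex.re_sum, ← Finset.sum_mul, h, smul_eq_mul, mul_assoc, Complex.mul_conj,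
      Complex.normSq_eq_norm_sq]
    norm_cast
  simp only [Fintype.expect_eq_sum_div_card, e, Finset.sum_sub_distrib, Finset.sum_add_distrib,
    ← Finset.mul_sum, hs]
  simp
  field_simp
  ring

end HasVariance

end
end QPIP

open Computability
namespace QPIP
noncomputable section

open ComplexConjugate BigOperators

/-! ### Virtual states -/

theorem expect_insertNth {n : ℕ} {K : Type} [Fintype K] (j : Fin (n + 1))
    (f : (Fin (n + 1) → K) → ℝ) :
    𝔼 κ, f κ = 𝔼 κ : Fin n → K, 𝔼 k, f (Fin.insertNth j k κ) := by
  rw [Finset.expect_comm, ← Finset.expect_product', Finset.univ_product_univ]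
  exact (Fintype.expect_equiv (Fin.insertNthEquiv (fun _ => K) j) _ _ fun _ => rfl).symm

theorem sum_insertNth {n : ℕ} {K V : Type} [Fintype K] [AddCommMonoid V] (j : Fin (n + 1))
    (f : (Fin (n + 1) → K) → V) :
    ∑ κ, f κ = ∑ κ : Fin n → K, ∑ k, f (Fin.insertNth j k κ) := by
  rw [Finset.sum_comm, ← Fintype.sum_prod_type']
  exact ((Fin.insertNthEquiv (fun _ => K) j).sum_comp _).symm

variable {c m n a b : ℕ} {δ : ℝ} {M : Type} [Fintype M]

/-- The number of basis states of a block. -/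
def blockDim (c : ℕ) : ℝ := 2 ^ (c + 1)

theorem blockDim_pos (c : ℕ) : 0 < blockDim c := by
  unfold blockDim
  positivity

/-- The labels of the basis states of a maximally entangled block and its encoded qubit. -/
abbrev Sym (c : ℕ) : Type := (Fin (c + 1) → Bool) × Bool

namespace Code

variable (𝒞 : Code c m δ)

/-- The scaled coefficients of the code. For a random key they form an orthonormal system. -/
def frame (k : Fin m → Bool) (s : Sym c) : ℂ := (Real.sqrt (blockDim c) : ℂ) * 𝒞.enc k s.1 s.2

/-- This is the property `mean` of the code. It allows the key of a block to be traded for a label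
consisting of a basis state of the block and an independent data bit. -/
theorem frame_orthogonal (s s' : Sym c) :
    ∑ k, 𝒞.frame k s * conj (𝒞.frame k s') = if s = s' then ((2 ^ m : ℝ) : ℂ) else 0 := by
  have hN : (Real.sqrt (blockDim c) : ℂ) * (Real.sqrt (blockDim c) : ℂ) = 2 ^ (c + 1) := by
    rw [← Complex.ofReal_mul, Real.mul_self_sqrt (blockDim_pos c).le, blockDim]
    push_cast
    rfl
  have : ∀ k, 𝒞.frame k s * conj (𝒞.frame k s') =
      2 ^ (c + 1) * (conj (𝒞.enc k s'.1 s'.2) * 𝒞.enc k s.1 s.2) := by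
    intro k
    rw [frame, frame, map_mul, Complex.conj_ofReal, ← hN]
    ring
  simp_rw [this, ← Finset.mul_sum, 𝒞.mean]
  have e : (s'.1 = s.1 ∧ s.2 = s'.2) ↔ s = s' := by
    rw [Prod.ext_iff, eq_comm (a := s'.1)]
  simp only [e]
  split_ifs
  · field_simp
    push_cast
    rfl
  · simp

/-- The vector obtained from a family of vectors by means of the codes with the keys `κ`. -/
def realize {V : Type} [AddCommGroup V] [Module ℂ V] (κ : Fin n → Fin m → Bool)
    (F : (Fin n → Sym c) → V) : V :=
  ∑ s, (∏ i, 𝒞.frame (κ i) (s i)) • F s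

theorem map_realize {V W : Type} [AddCommGroup V] [Module ℂ V] [AddCommGroup W] [Module ℂ W]
    (T : V →ₗ[ℂ] W) (κ : Fin n → Fin m → Bool) (F : (Fin n → Sym c) → V) :
    T (𝒞.realize κ F) = 𝒞.realize κ fun s => T (F s) := by
  simp [realize]

theorem realize_insertNth {V : Type} [AddCommGroup V] [Module ℂ V] (j : Fin (n + 1))
    (k : Fin m → Bool) (κ : Fin n → Fin m → Bool) (F : (Fin (n + 1) → Sym c) → V) :
    𝒞.realize (Fin.insertNth j k κ) F =
      ∑ s₀, 𝒞.frame k s₀ • 𝒞.realize κ fun s => F (Fin.insertNth j s₀ s) := by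
  simp only [realize, Finset.smul_sum]
  rw [sum_insertNth j, Finset.sum_comm]
  refine Finset.sum_congr rfl fun s₀ _ => Finset.sum_congr rfl fun s _ => ?_
  rw [Fin.prod_univ_succAbove _ j, smul_smul]
  simp

/-- Products of frames are again orthogonal, so this is Parseval's identity: secret independent keys
are equivalent to a purification that is traced out. -/
theorem expect_norm_sq_realize (f : (Fin n → Sym c) → ℂ) :
    𝔼 κ, ‖𝒞.realize κ f‖ ^ 2 = ∑ s, ‖f s‖ ^ 2 := by
  have := sum_norm_sq_of_orthogonal
    (fun (κ : Fin n → Fin m → Bool) (s : Fin n → Sym c) => ∏ i, 𝒞.frame (κ i) (s i))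
    ((2 ^ m) ^ n) (fun s s' => ?_) f
  · rw [Fintype.expect_eq_sum_div_card]
    simp only [realize, smul_eq_mul]
    rw [this]
    simp
  · simp_rw [map_prod, ← Finset.prod_mul_distrib]
    rw [← Fintype.prod_sum fun i k => 𝒞.frame k (s i) * conj (𝒞.frame k (s' i))]
    simp_rw [frame_orthogonal]
    by_cases h : s = s'
    · simp [h]
    · obtain ⟨i, hi⟩ := Function.ne_iff.1 h
      rw [if_neg h]
      exact Finset.prod_eq_zero (Finset.mem_univ i) (if_neg hi)

theorem realize_apply₃ {A B C : Type} (κ : Fin n → Fin m → Bool)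
    (F : (Fin n → Sym c) → A → B → C → ℂ) (x y z) :
    𝒞.realize κ F x y z = 𝒞.realize κ fun s => F s x y z := by
  simp [realize, Finset.sum_apply]

omit [Fintype M] in
theorem expect_sum_realize {A B C : Type} [Fintype A] [Fintype B] [Fintype C]
    (F : (Fin n → Sym c) → A → B → C → ℂ) :
    𝔼 κ, ∑ x, ∑ y, ∑ z, ‖𝒞.realize κ F x y z‖ ^ 2 = ∑ s, ∑ x, ∑ y, ∑ z, ‖F s x y z‖ ^ 2 := by
  simp_rw [realize_apply₃]
  rw [Finset.expect_sum_comm, Finset.sum_comm]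
  refine Finset.sum_congr rfl fun x _ => ?_
  rw [Finset.expect_sum_comm, Finset.sum_comm]
  refine Finset.sum_congr rfl fun y _ => ?_
  rw [Finset.expect_sum_comm, Finset.sum_comm]
  refine Finset.sum_congr rfl fun z _ => ?_
  exact 𝒞.expect_norm_sq_realize _

/-- The state after an ideal decoding of block `j`. -/
def _root_.QPIP.contract (j : Fin (n + 1)) (F : (Fin (n + 1) → Sym c) → State a (c + 1) M) :
    (Fin n → Sym c) → Opened a M :=
  fun s w y z => (Real.sqrt (blockDim c) : ℂ)⁻¹ * ∑ ρ, F (Fin.insertNth j (ρ, y) s) w ρ z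

/-- The state after an ideal encoding of block `j`. -/
def _root_.QPIP.expand (j : Fin (n + 1)) (f : (Fin n → Sym c) → Opened a M) :
    (Fin (n + 1) → Sym c) → State a (c + 1) M :=
  fun s w h z => if h = (s j).1 then
    (Real.sqrt (blockDim c) : ℂ)⁻¹ * f (Fin.removeNth j s) w (s j).2 z else 0

-- A fresh key adds a slot whose label agrees with the block that is sent, as in a maximally
-- entangled pair. The factor in `expand` cancels the one in `frame`.
omit [Fintype M] in
theorem encode_realize (j : Fin (n + 1)) (k : Fin m → Bool) (κ : Fin n → Fin m → Bool)
    (f : (Fin n → Sym c) → Opened a M) :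
    𝒞.encode k (𝒞.realize κ f) = 𝒞.realize (Fin.insertNth j k κ) (expand j f) := by
  funext w h z
  have h0 : (Real.sqrt (blockDim c) : ℂ) ≠ 0 := by
    exact_mod_cast (Real.sqrt_pos.2 (blockDim_pos c)).ne'
  rw [realize_insertNth, encode_apply]
  simp only [Finset.sum_apply, Pi.smul_apply, realize_apply₃, smul_eq_mul]
  rw [Fintype.sum_prod_type, Finset.sum_eq_single h]
  · refine Finset.sum_congr rfl fun y _ => ?_
    simp only [expand, Fin.insertNth_apply_same, if_true, Fin.removeNth_insertNth, frame, realize,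
      smul_eq_mul, Finset.mul_sum]
    refine Finset.sum_congr rfl fun s _ => ?_
    field_simp
  · intro r _ hr
    refine Finset.sum_eq_zero fun y _ => ?_
    simp [expand, Fin.insertNth_apply_same, hr.symm, realize]
  · simp

omit [Fintype M] in
theorem decode_realize (j : Fin (n + 1)) (k : Fin m → Bool) (κ : Fin n → Fin m → Bool)
    (F : (Fin (n + 1) → Sym c) → State a (c + 1) M) (w y' z) :
    𝒞.decode k (𝒞.realize (Fin.insertNth j k κ) F) w y' z =
      (Real.sqrt (blockDim c) : ℂ) * ∑ y, ∑ r, ∑ h, conj (𝒞.enc k h y') * 𝒞.enc k r y *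
        𝒞.realize κ (fun s => F (Fin.insertNth j (r, y) s)) w h z := by
  rw [realize_insertNth, map_sum]
  simp only [Finset.sum_apply, map_smul, Pi.smul_apply, smul_eq_mul, decode_apply, frame]
  rw [Fintype.sum_prod_type, Finset.sum_comm, Finset.mul_sum]
  refine Finset.sum_congr rfl fun y _ => ?_
  rw [Finset.mul_sum]
  refine Finset.sum_congr rfl fun r _ => ?_
  rw [Finset.mul_sum, Finset.mul_sum]
  exact Finset.sum_congr rfl fun h _ => by ring

omit [Fintype M] in
theorem realize_contract (j : Fin (n + 1)) (κ : Fin n → Fin m → Bool)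
    (F : (Fin (n + 1) → Sym c) → State a (c + 1) M) (w y z) :
    𝒞.realize κ (contract j F) w y z = (Real.sqrt (blockDim c) : ℂ)⁻¹ *
      ∑ r, 𝒞.realize κ (fun s => F (Fin.insertNth j (r, y) s)) w r z := by
  simp only [realize_apply₃]
  simp only [realize, contract, smul_eq_mul, Finset.mul_sum]
  rw [Finset.sum_comm]
  exact Finset.sum_congr rfl fun r _ => Finset.sum_congr rfl fun s _ => by ring

-- On average over the key of the block only the terms survive in which the returned block equals
-- its label and the data bit is unchanged. So the mean of the decoding is the projection to the
-- entangled pair, whatever the other keys are.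
omit [Fintype M] in
theorem sum_decode_realize (j : Fin (n + 1)) (κ : Fin n → Fin m → Bool)
    (F : (Fin (n + 1) → Sym c) → State a (c + 1) M) :
    ∑ k, 𝒞.decode k (𝒞.realize (Fin.insertNth j k κ) F) =
      (2 : ℂ) ^ m • 𝒞.realize κ (contract j F) := by
  have hN : (Real.sqrt (blockDim c) : ℂ) * (Real.sqrt (blockDim c) : ℂ) = 2 ^ (c + 1) := by
    rw [← Complex.ofReal_mul, Real.mul_self_sqrt (blockDim_pos c).le, blockDim]
    push_cast
    rfl
  have h0 : (Real.sqrt (blockDim c) : ℂ) ≠ 0 := by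
    exact_mod_cast (Real.sqrt_pos.2 (blockDim_pos c)).ne'
  funext w y' z
  simp only [Finset.sum_apply, decode_realize, Pi.smul_apply, smul_eq_mul, realize_contract]
  rw [← Finset.mul_sum, Finset.sum_comm, Finset.sum_eq_single y']
  · rw [Finset.sum_comm, ← mul_assoc, Finset.mul_sum, Finset.mul_sum]
    refine Finset.sum_congr rfl fun r _ => ?_
    rw [Finset.sum_comm, Finset.sum_eq_single r]
    · rw [← Finset.sum_mul, 𝒞.mean, if_pos ⟨rfl, rfl⟩, ← hN]
      field_simp
    · intro h _ hr
      rw [← Finset.sum_mul, 𝒞.mean, if_neg (fun h' => hr h'.1), zero_mul]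
    · simp
  · intro y _ hy
    rw [Finset.sum_comm]
    refine Finset.sum_eq_zero fun r _ => ?_
    rw [Finset.sum_comm]
    refine Finset.sum_eq_zero fun h _ => ?_
    rw [← Finset.sum_mul, 𝒞.mean, if_neg (fun h' => hy h'.2), zero_mul]
  · simp

/-- The squared norm of a virtual state. -/
def _root_.QPIP.virtNorm (F : (Fin n → Sym c) → State a b M) : ℝ := ∑ s, sqNorm (F s)

/-- The squared norm of a virtual state with an opened block. -/
def _root_.QPIP.openNorm (F : (Fin n → Sym c) → Opened a M) : ℝ := ∑ s, (F s).sqNorm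

/-- This is the property `second` of the code, used for each basis state of the work qubits and of
the prover, with the amplitudes as the attack. -/
theorem expect_decode_le (j : Fin (n + 1)) (κ : Fin n → Fin m → Bool)
    (F : (Fin (n + 1) → Sym c) → State a (c + 1) M) :
    𝔼 k, (𝒞.decode k (𝒞.realize (Fin.insertNth j k κ) F)).sqNorm ≤
      (1 - δ) * (𝒞.realize κ (contract j F)).sqNorm +
        δ * ∑ s₀, sqNorm (𝒞.realize κ fun s => F (Fin.insertNth j s₀ s)) := by
  have hs : ‖(Real.sqrt (blockDim c) : ℂ)‖ ^ 2 = blockDim c := by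
    rw [Complex.norm_real, Real.norm_of_nonneg (Real.sqrt_nonneg _),
      Real.sq_sqrt (blockDim_pos c).le]
  have hsi : ‖(Real.sqrt (blockDim c) : ℂ)⁻¹‖ ^ 2 = (blockDim c)⁻¹ := by
    rw [norm_inv, inv_pow, hs]
  have key : ∀ w z, ∑ k, ∑ y', ‖𝒞.decode k (𝒞.realize (Fin.insertNth j k κ) F) w y' z‖ ^ 2 ≤
      2 ^ m * ((1 - δ) * (∑ y, ‖𝒞.realize κ (contract j F) w y z‖ ^ 2) + δ * ∑ y, ∑ r, ∑ h,
        ‖𝒞.realize κ (fun s => F (Fin.insertNth j (r, y) s)) w h z‖ ^ 2) := by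
    intro w z
    have := 𝒞.second fun y r h => 𝒞.realize κ (fun s => F (Fin.insertNth j (r, y) s)) w h z
    simp only [decode_realize, realize_contract, norm_mul, mul_pow, hs, hsi, ← Finset.mul_sum]
    refine this.trans_eq ?_
    rw [← Finset.sum_div, blockDim, div_eq_inv_mul]
  rw [Fintype.expect_eq_sum_div_card, div_le_iff₀ (by simp)]
  have h1 : ∑ k, (𝒞.decode k (𝒞.realize (Fin.insertNth j k κ) F)).sqNorm =
      ∑ w, ∑ z, ∑ k, ∑ y', ‖𝒞.decode k (𝒞.realize (Fin.insertNth j k κ) F) w y' z‖ ^ 2 := by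
    simp only [Opened.sqNorm]
    rw [Finset.sum_comm]
    refine Finset.sum_congr rfl fun w _ => ?_
    rw [Finset.sum_comm' (t' := Finset.univ) (s' := fun _ => Finset.univ) (by simp)]
    rw [Finset.sum_comm]
    conv_rhs => rw [Finset.sum_comm]
    refine Finset.sum_congr rfl fun k _ => ?_
    rw [Finset.sum_comm]
  rw [h1]
  refine (Finset.sum_le_sum fun w _ => Finset.sum_le_sum fun z _ => key w z).trans_eq ?_
  simp only [← Finset.mul_sum, Finset.sum_add_distrib]
  have h2 : (𝒞.realize κ (contract j F)).sqNorm =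
      ∑ w, ∑ z, ∑ y, ‖𝒞.realize κ (contract j F) w y z‖ ^ 2 :=
    Finset.sum_congr rfl fun w _ => Finset.sum_comm
  have h3 : ∑ s₀, sqNorm (𝒞.realize κ fun s => F (Fin.insertNth j s₀ s)) = ∑ w, ∑ z, ∑ y, ∑ r, ∑ h,
      ‖𝒞.realize κ (fun s => F (Fin.insertNth j (r, y) s)) w h z‖ ^ 2 := by
    simp only [sqNorm]
    rw [Finset.sum_comm]
    refine Finset.sum_congr rfl fun w _ => ?_
    rw [Finset.sum_congr rfl fun s₀ _ => Finset.sum_comm, Finset.sum_comm]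
    refine Finset.sum_congr rfl fun z _ => ?_
    rw [Fintype.sum_prod_type, Finset.sum_comm]
  rw [← h2, ← h3]
  simp
  ring

theorem expect_sqNorm_realize (F : (Fin n → Sym c) → State a b M) :
    𝔼 κ, sqNorm (𝒞.realize κ F) = virtNorm F :=
  𝒞.expect_sum_realize F

theorem expect_sqNorm_realize_open (F : (Fin n → Sym c) → Opened a M) :
    𝔼 κ, (𝒞.realize κ F).sqNorm = openNorm F :=
  𝒞.expect_sum_realize F

/-- Evaluation of a state at a basis vector. -/
def _root_.QPIP.Opened.eval (w : Fin a → Bool) (y : Bool) (z : M) : Opened a M →ₗ[ℂ] ℂ where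
  toFun φ := φ w y z
  map_add' _ _ := rfl
  map_smul' _ _ := rfl

theorem _root_.QPIP.Opened.hasVariance_sqNorm :
    HasVariance m (Opened.sqNorm (a := a) (M := M)) :=
  HasVariance.sum _ fun w _ => HasVariance.sum _ fun y _ => HasVariance.sum _ fun z _ =>
    HasVariance.norm_sq.comp (Opened.eval w y z)

/-- Decoding with a random key is ideal up to an error that is proportional to the loss of norm. -/
theorem expect_decode_bounds (j : Fin (n + 1)) (Q : (Fin n → Fin m → Bool) → Opened a M → ℝ)
    (hQ0 : ∀ κ φ, 0 ≤ Q κ φ) (hQ1 : ∀ κ φ, Q κ φ ≤ φ.sqNorm) (hQ : ∀ κ, HasVariance m (Q κ))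
    (F : (Fin (n + 1) → Sym c) → State a (c + 1) M) :
    𝔼 κ, Q κ (𝒞.realize κ (contract j F)) ≤
        𝔼 κ : Fin n → Fin m → Bool, 𝔼 k, Q κ (𝒞.decode k (𝒞.realize (Fin.insertNth j k κ) F)) ∧
      𝔼 κ : Fin n → Fin m → Bool, 𝔼 k, Q κ (𝒞.decode k (𝒞.realize (Fin.insertNth j k κ) F)) ≤
        𝔼 κ, Q κ (𝒞.realize κ (contract j F)) +
          δ * (virtNorm F - openNorm (contract j F)) := by
  have hvar : ∀ κ, _ := fun κ => hQ κ _ _ (𝒞.sum_decode_realize j κ F)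
  have hvar' : ∀ κ, _ := fun κ => Opened.hasVariance_sqNorm _ _ (𝒞.sum_decode_realize j κ F)
  constructor
  -- The lower bound drops the variance, which is nonnegative.
  · refine Finset.expect_le_expect fun κ _ => ?_
    rw [hvar]
    linarith [Finset.expect_nonneg (s := (Finset.univ : Finset (Fin m → Bool)))
      fun k _ => hQ0 κ (𝒞.decode k (𝒞.realize (Fin.insertNth j k κ) F) -
        𝒞.realize κ (contract j F))]
  -- The variance of `Q` is at most that of the squared norm because `Q` is dominated by it. The
  -- variance identity for the squared norm itself rewrites the latter as mean square minus square
  -- of the mean, to which `expect_decode_le` applies.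
  · have h1 : ∀ κ, 𝔼 k, Q κ (𝒞.decode k (𝒞.realize (Fin.insertNth j k κ) F)) ≤
        Q κ (𝒞.realize κ (contract j F)) +
          δ * (∑ s₀, sqNorm (𝒞.realize κ fun s => F (Fin.insertNth j s₀ s)) -
            (𝒞.realize κ (contract j F)).sqNorm) := by
      intro κ
      rw [hvar]
      have h2 := Finset.expect_le_expect (s := (Finset.univ : Finset (Fin m → Bool)))
        fun k _ => hQ1 κ (𝒞.decode k (𝒞.realize (Fin.insertNth j k κ) F) -
          𝒞.realize κ (contract j F))
      have h3 := 𝒞.expect_decode_le j κ F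
      have h4 := hvar' κ
      linarith
    refine (Finset.expect_le_expect fun κ _ => h1 κ).trans_eq ?_
    rw [Finset.expect_add_distrib, ← Finset.mul_expect, Finset.expect_sub_distrib,
      expect_sqNorm_realize_open, Finset.expect_sum_comm]
    simp only [expect_sqNorm_realize]
    congr 3
    rw [virtNorm, sum_insertNth j, Finset.sum_comm]
    rfl

end Code

end
end QPIP

open Computability
namespace QPIP
noncomputable section

open ComplexConjugate BigOperators

variable {c m n a b : ℕ} {δ : ℝ} {M : Type} [Fintype M]

/-! ### Scripts -/

/-- A job for a verifier with `a` work qubits and `n` qubits in the memory of the prover: to fetch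
and return an encoded qubit, applying a permutation to it and the work qubits,
or to apply a unitary operator to the work qubits. -/
inductive Job (a n : ℕ) where
  | cycle (j : Fin n) (σ : Equiv.Perm ((Fin a → Bool) × Bool))
  | work (U : Unitary (Fin a → Bool))

/-- The probability that a decoded qubit is measured to be `1`. -/
def acceptNorm (φ : Opened a M) : ℝ := ∑ w, ∑ z, ‖φ w true z‖ ^ 2

/-- The acceptance probability for a list of jobs, if the keys are `κ`. At the end
qubit `j₀` is measured. -/
def script (𝒞 : Code c m δ) (X : ℕ → Module.End ℂ ((Fin (c + 1) → Bool) → M → ℂ)) (j₀ : Fin n) :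
    List (Job a n) → (Fin n → Fin m → Bool) → ℕ → State a (c + 1) M → ℝ
  | [], κ, t, ψ => acceptNorm (𝒞.decode (κ j₀) (onBlock (X t) ψ))
  | .cycle j σ :: js, κ, t, ψ =>
    𝔼 k, script 𝒞 X j₀ js (Function.update κ j k) (t + 1)
      (𝒞.encode k (permute σ (𝒞.decode (κ j) (onBlock (X t) ψ))))
  | .work U :: js, κ, t, ψ => script 𝒞 X j₀ js κ t (workGate U ψ)

theorem acceptNorm_nonneg (φ : Opened a M) : 0 ≤ acceptNorm φ := by
  unfold acceptNorm
  positivity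

theorem acceptNorm_le (φ : Opened a M) : acceptNorm φ ≤ φ.sqNorm := by
  refine Finset.sum_le_sum fun w _ => ?_
  rw [Fintype.sum_bool]
  exact le_add_of_nonneg_right (by positivity)

theorem hasVariance_acceptNorm : HasVariance m (acceptNorm (a := a) (M := M)) :=
  HasVariance.sum _ fun w _ => HasVariance.sum _ fun z _ =>
    HasVariance.norm_sq.comp (Opened.eval w true z)

section Script

variable (𝒞 : Code c m δ) {X : ℕ → Module.End ℂ ((Fin (c + 1) → Bool) → M → ℂ)} (j₀ : Fin n)

theorem script_nonneg (js : List (Job a n)) (κ t ψ) : 0 ≤ script 𝒞 X j₀ js κ t ψ := by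
  induction js generalizing κ t ψ with
  | nil => exact acceptNorm_nonneg _
  | cons J js ih =>
    cases J with
    | cycle j σ => exact Finset.expect_nonneg fun k _ => ih _ _ _
    | work U => exact ih _ _ _

/-- For fixed keys everything up to the final measurement is linear in the state, and rejection
merely deletes a part of it. So a script is an average of squared seminorms. -/
theorem hasVariance_script (js : List (Job a n)) (κ t) :
    HasVariance m (script 𝒞 X j₀ js κ t) := by
  induction js generalizing κ t with
  | nil => exact hasVariance_acceptNorm.comp ((𝒞.decode (κ j₀)).comp (onBlock (X t)))
  | cons J js ih =>
    cases J with
    | cycle j σ =>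
      exact HasVariance.expect _ fun k _ => (ih _ _).comp ((𝒞.encode k).comp ((permute σ).comp
        ((𝒞.decode (κ j)).comp (onBlock (X t)))))
    | work U => exact (ih _ _).comp (workGate U)

theorem script_le (hX : ∀ t, IsIsometry (X t)) (js : List (Job a n)) (κ t ψ) :
    script 𝒞 X j₀ js κ t ψ ≤ sqNorm ψ := by
  induction js generalizing κ t ψ with
  | nil =>
    exact (acceptNorm_le _).trans ((𝒞.sqNorm_decode_le _ _).trans_eq (sqNorm_onBlock (hX t) ψ))
  | cons J js ih =>
    cases J with
    | cycle j σ =>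
      refine Finset.expect_le (by simp) fun k _ => (ih _ _ _).trans ?_
      rw [𝒞.sqNorm_encode, sqNorm_permute]
      exact (𝒞.sqNorm_decode_le _ _).trans_eq (sqNorm_onBlock (hX t) ψ)
    | work U => exact (ih _ _ _).trans_eq (sqNorm_workGate U ψ)

end Script

/-! ### Product states -/

/-- States of the logical qubits and the work qubits. -/
abbrev Data (n a : ℕ) : Type := (Fin n → Bool) → (Fin a → Bool) → ℂ

/-- States of the prover and the block, relative to the blocks that have been sent. -/
abbrev Memo (n b : ℕ) (M : Type) : Type := (Fin n → Fin b → Bool) → (Fin b → Bool) → M → ℂ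

def Data.sqNorm (χ : Data n a) : ℝ := ∑ d, ∑ w, ‖χ d w‖ ^ 2

def Memo.sqNorm (J : Memo n b M) : ℝ := ∑ r, ∑ h, ∑ z, ‖J r h z‖ ^ 2

/-- The probability that the logical qubit `j₀` is `1`. -/
def Data.prob (j₀ : Fin n) (χ : Data n a) : ℝ :=
  ∑ d : Fin n → Bool, if d j₀ = true then ∑ w, ‖χ d w‖ ^ 2 else 0

def prodState (χ : Data n a) (J : Memo n (c + 1) M) : (Fin n → Sym c) → State a (c + 1) M :=
  fun s w h z => χ (fun i => (s i).2) w * J (fun i => (s i).1) h z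

def Job.onData : Job a n → Data n a → Data n a
  | .cycle j σ, χ => fun d w => χ (Function.update d j (σ (w, d j)).2) (σ (w, d j)).1
  | .work U, χ => fun d w => ∑ v, U.1 w v * χ d v

/-- The ideal effect of decoding block `j` and sending it again. -/
def collapse (j : Fin n) (J : Memo n (c + 1) M) : Memo n (c + 1) M :=
  fun r h z => if h = r j then (blockDim c : ℂ)⁻¹ * ∑ ρ, J (Function.update r j ρ) ρ z else 0

/-- The ideal effect of a script on the prover. -/
def attack (X : ℕ → Module.End ℂ ((Fin (c + 1) → Bool) → M → ℂ)) (j₀ : Fin n) :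
    List (Job a n) → ℕ → Memo n (c + 1) M → Memo n (c + 1) M
  | [], t, J => collapse j₀ fun r => X t (J r)
  | .cycle j _ :: js, t, J => attack X j₀ js (t + 1) (collapse j fun r => X t (J r))
  | .work _ :: js, t, J => attack X j₀ js t J

theorem sum_sym (f : (Fin n → Fin (c + 1) → Bool) → ℝ) (g : (Fin n → Bool) → ℝ) :
    ∑ s : Fin n → Sym c, g (fun i => (s i).2) * f (fun i => (s i).1) = (∑ d, g d) * ∑ r, f r := by
  rw [← Equiv.sum_comp (Equiv.arrowProdEquivProdArrow _ _ _).symm, Fintype.sum_prod_type,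
    Finset.sum_comm, Finset.sum_mul_sum]
  rfl

theorem virtNorm_prodState (χ : Data n a) (J : Memo n (c + 1) M) :
    virtNorm (prodState χ J) = χ.sqNorm * J.sqNorm := by
  rw [Data.sqNorm, Memo.sqNorm, ← sum_sym]
  refine Finset.sum_congr rfl fun s _ => ?_
  simp only [sqNorm, prodState, norm_mul, mul_pow, ← Finset.mul_sum, ← Finset.sum_mul]

/-- The ideal effect of decoding block `j`. -/
def contractMemo (j : Fin (n + 1)) (J : Memo (n + 1) (c + 1) M) :
    (Fin n → Fin (c + 1) → Bool) → M → ℂ :=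
  fun r z => (Real.sqrt (blockDim c) : ℂ)⁻¹ * ∑ ρ, J (Fin.insertNth j ρ r) ρ z

theorem fst_insertNth (j : Fin (n + 1)) (s₀ : Sym c) (s : Fin n → Sym c) :
    (fun i => ((Fin.insertNth j s₀ s : Fin (n + 1) → Sym c) i).1) =
      Fin.insertNth j s₀.1 fun i => (s i).1 := by
  funext i
  refine Fin.succAboveCases j ?_ (fun i => ?_) i <;> simp

theorem snd_insertNth (j : Fin (n + 1)) (s₀ : Sym c) (s : Fin n → Sym c) :
    (fun i => ((Fin.insertNth j s₀ s : Fin (n + 1) → Sym c) i).2) =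
      Fin.insertNth j s₀.2 fun i => (s i).2 := by
  funext i
  refine Fin.succAboveCases j ?_ (fun i => ?_) i <;> simp

omit [Fintype M] in
theorem contract_prodState (j : Fin (n + 1)) (χ : Data (n + 1) a) (J : Memo (n + 1) (c + 1) M)
    (s : Fin n → Sym c) (w y z) :
    contract j (prodState χ J) s w y z = χ (Fin.insertNth j y fun i => (s i).2) w *
      contractMemo j J (fun i => (s i).1) z := by
  simp only [contract, prodState, fst_insertNth, snd_insertNth, contractMemo, ← Finset.mul_sum]
  ring

-- An ideal cycle keeps product states: the data undergo the permutation and the memory undergoes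
-- `collapse`, with no interaction between the two. Thus the prover cannot correlate himself with
-- the data in the branch that is not charged to `δ`.
omit [Fintype M] in
theorem expand_contract_prodState (j : Fin (n + 1)) (σ : Equiv.Perm ((Fin a → Bool) × Bool))
    (χ : Data (n + 1) a) (J : Memo (n + 1) (c + 1) M) :
    expand j (fun s => permute σ (contract j (prodState χ J) s)) =
      prodState ((Job.cycle j σ).onData χ) (collapse j J) := by
  have hN : (Real.sqrt (blockDim c) : ℂ) * (Real.sqrt (blockDim c) : ℂ) = blockDim c := by
    rw [← Complex.ofReal_mul, Real.mul_self_sqrt (blockDim_pos c).le]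
  funext s
  obtain ⟨s₀, s', rfl⟩ : ∃ s₀ s', s = Fin.insertNth j s₀ s' :=
    ⟨s j, Fin.removeNth j s, (Fin.insertNth_self_removeNth j s).symm⟩
  funext w h z
  simp only [expand, Fin.insertNth_apply_same, Fin.removeNth_insertNth,
    permute, LinearMap.coe_mk, AddHom.coe_mk, contract_prodState, prodState, Job.onData, collapse,
    fst_insertNth, snd_insertNth, Fin.update_insertNth, contractMemo, ← hN, mul_inv]
  split_ifs <;> ring

/-- The re-encoded block takes each of the `blockDim c` labels with weight `(blockDim c)⁻¹`, so
encoding preserves the norm of the contracted state. -/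
theorem sqNorm_collapse (j : Fin (n + 1)) (J : Memo (n + 1) (c + 1) M) :
    (collapse j J).sqNorm = ∑ r, ∑ z, ‖contractMemo j J r z‖ ^ 2 := by
  have hN := blockDim_pos c
  have h1 : ∀ z : ℂ, ‖(Real.sqrt (blockDim c) : ℂ)⁻¹ * z‖ ^ 2 = (blockDim c)⁻¹ * ‖z‖ ^ 2 := by
    intro z
    rw [norm_mul, mul_pow, norm_inv, inv_pow, Complex.norm_real,
      Real.norm_of_nonneg (Real.sqrt_nonneg _), Real.sq_sqrt hN.le]
  have h2 : ∀ z : ℂ, ‖(blockDim c : ℂ)⁻¹ * z‖ ^ 2 = (blockDim c)⁻¹ ^ 2 * ‖z‖ ^ 2 := by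
    intro z
    rw [norm_mul, mul_pow, norm_inv, Complex.norm_real, Real.norm_of_nonneg hN.le]
  rw [Memo.sqNorm, sum_insertNth j]
  refine Finset.sum_congr rfl fun r _ => ?_
  have h3 : ∀ (r₀ h : Fin (c + 1) → Bool), ∑ z, ‖collapse j J (Fin.insertNth j r₀ r) h z‖ ^ 2 =
      if h = r₀ then ∑ z, (blockDim c)⁻¹ * ‖contractMemo j J r z‖ ^ 2 else 0 := by
    intro r₀ h
    simp only [collapse, Fin.insertNth_apply_same, Fin.update_insertNth, contractMemo, h1]
    split_ifs
    · simp only [h2]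
      exact Finset.sum_congr rfl fun z _ => by ring
    · simp
  simp only [h3, Finset.sum_ite_eq', Finset.mem_univ, if_true, Finset.sum_const, Finset.card_univ,
    Fintype.card_pi, Fintype.card_bool, Finset.prod_const, Fintype.card_fin, ← Finset.mul_sum,
    nsmul_eq_mul]
  rw [← mul_assoc]
  push_cast
  rw [← blockDim, mul_inv_cancel₀ hN.ne', one_mul]

theorem openNorm_contract_prodState (j : Fin (n + 1)) (χ : Data (n + 1) a)
    (J : Memo (n + 1) (c + 1) M) :
    openNorm (contract j (prodState χ J)) = χ.sqNorm * (collapse j J).sqNorm := by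
  rw [Data.sqNorm, sum_insertNth j, sqNorm_collapse, ← sum_sym]
  refine Finset.sum_congr rfl fun s _ => ?_
  simp only [Opened.sqNorm, contract_prodState, norm_mul, mul_pow, ← Finset.mul_sum,
    ← Finset.sum_mul]
  rw [Finset.sum_comm]

theorem sum_acceptNorm_contract_prodState (j : Fin (n + 1)) (χ : Data (n + 1) a)
    (J : Memo (n + 1) (c + 1) M) :
    ∑ s, acceptNorm (contract j (prodState χ J) s) = χ.prob j * (collapse j J).sqNorm := by
  rw [Data.prob, sum_insertNth j, sqNorm_collapse, ← sum_sym]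
  refine Finset.sum_congr rfl fun s _ => ?_
  simp only [acceptNorm, contract_prodState, norm_mul, mul_pow, ← Finset.mul_sum,
    ← Finset.sum_mul]
  simp

theorem Job.sqNorm_onData (J : Job a n) (χ : Data n a) : (J.onData χ).sqNorm = χ.sqNorm := by
  cases J with
  | work U => exact Finset.sum_congr rfl fun d _ => sum_norm_sq_unitary U fun v => χ d v
  | cycle j σ =>
    cases n with
    | zero => exact j.elim0
    | succ n =>
      rw [Data.sqNorm, Data.sqNorm, sum_insertNth j, sum_insertNth j]
      refine Finset.sum_congr rfl fun d _ => ?_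
      have h := Equiv.sum_comp σ fun p => ‖χ (Fin.insertNth j p.2 d) p.1‖ ^ 2
      rw [Fintype.sum_prod_type, Fintype.sum_prod_type, Finset.sum_comm,
        Finset.sum_comm (s := (Finset.univ : Finset (Fin a → Bool)))] at h
      simpa only [onData, Fin.insertNth_apply_same, Fin.update_insertNth] using h

/-- The data after a script. -/
def onData (js : List (Job a n)) (χ : Data n a) : Data n a := js.foldl (fun χ J => J.onData χ) χ

/-- Induction on the jobs. A cycle replaces the actual state by the ideal one at the cost of `δ`
times the norm that the prover's part loses in it. The ideal state is again a virtual product state,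
for the fresh key takes the place of the old one, so the losses telescope. -/
theorem script_bounds (𝒞 : Code c m δ) {X : ℕ → Module.End ℂ ((Fin (c + 1) → Bool) → M → ℂ)}
    (hX : ∀ t, IsIsometry (X t)) (j₀ : Fin (n + 1)) (js : List (Job a (n + 1))) (t : ℕ)
    (χ : Data (n + 1) a) (hχ : χ.sqNorm = 1) (J : Memo (n + 1) (c + 1) M) :
    (onData js χ).prob j₀ * (attack X j₀ js t J).sqNorm ≤
        𝔼 κ, script 𝒞 X j₀ js κ t (𝒞.realize κ (prodState χ J)) ∧
      𝔼 κ, script 𝒞 X j₀ js κ t (𝒞.realize κ (prodState χ J)) ≤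
        (onData js χ).prob j₀ * (attack X j₀ js t J).sqNorm +
          δ * (J.sqNorm - (attack X j₀ js t J).sqNorm) := by
  have hXJ : ∀ (t : ℕ) (J : Memo (n + 1) (c + 1) M),
      Memo.sqNorm (fun r => X t (J r)) = J.sqNorm :=
    fun t J => Finset.sum_congr rfl fun r _ => hX t (J r)
  have hXr : ∀ (t : ℕ) κ (χ : Data (n + 1) a) (J : Memo (n + 1) (c + 1) M),
      onBlock (X t) (𝒞.realize κ (prodState χ J)) =
        𝒞.realize κ (prodState χ fun r => X t (J r)) := by
    intro t κ χ J
    rw [𝒞.map_realize]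
    congr 1
    funext s w
    have : prodState χ J s w = χ (fun i => (s i).2) w • J (fun i => (s i).1) := rfl
    change X t (prodState χ J s w) = _
    rw [this, map_smul]
    rfl
  induction js generalizing t χ J with
  | nil =>
    have h := 𝒞.expect_decode_bounds j₀ (fun _ => acceptNorm) (fun _ => acceptNorm_nonneg)
      (fun _ => acceptNorm_le) (fun _ => hasVariance_acceptNorm)
      (prodState χ fun r => X t (J r))
    have h1 : 𝔼 κ, acceptNorm (𝒞.realize κ (contract j₀ (prodState χ fun r => X t (J r)))) =
        χ.prob j₀ * (attack X j₀ ([] : List (Job a (n + 1))) t J).sqNorm := by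
      rw [attack, ← sum_acceptNorm_contract_prodState]
      have := 𝒞.expect_sum_realize (A := Fin a → Bool) (B := Unit) (C := M)
        (fun (s : Fin n → Sym c) w _ z => contract j₀ (prodState χ fun r => X t (J r)) s w true z)
      simp only [Code.realize_apply₃, Fintype.sum_unique] at this
      simpa only [acceptNorm, Code.realize_apply₃] using this
    rw [h1, virtNorm_prodState, openNorm_contract_prodState, hχ, one_mul, one_mul, hXJ] at h
    rw [expect_insertNth j₀]
    simp only [script, Fin.insertNth_apply_same, hXr]
    exact h
  | cons K js ih =>
    cases K with
    | work U =>
      have h := ih t ((Job.work U).onData χ) (by rw [Job.sqNorm_onData, hχ]) J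
      have e : ∀ κ, workGate U (𝒞.realize κ (prodState χ J)) =
          𝒞.realize κ (prodState ((Job.work U).onData χ) J) := by
        intro κ
        rw [𝒞.map_realize]
        congr 1
        funext s w h z
        simp only [workGate, LinearMap.coe_mk, AddHom.coe_mk, prodState, Job.onData,
          Finset.sum_mul, mul_assoc]
      simp only [script, e, attack]
      exact h
    | cycle j σ =>
      -- Here `Q` is the whole remaining protocol, fresh keys included, as a function of the opened
      -- state and of the keys of the other blocks.
      have h := 𝒞.expect_decode_bounds j
        (fun κ φ => 𝔼 k, script 𝒞 X j₀ js (Fin.insertNth j k κ) (t + 1)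
          (𝒞.encode k (permute σ φ)))
        (fun κ φ => Finset.expect_nonneg fun k _ => script_nonneg _ _ _ _ _ _)
        (fun κ φ => Finset.expect_le (by simp) fun k _ => (script_le _ _ hX _ _ _ _).trans_eq (by
          rw [𝒞.sqNorm_encode, sqNorm_permute]))
        (fun κ => HasVariance.expect _ fun k _ => (hasVariance_script _ _ _ _ _).comp
          ((𝒞.encode k).comp (permute σ)))
        (prodState χ fun r => X t (J r))
      have h1 : 𝔼 κ : Fin n → Fin m → Bool, 𝔼 k, script 𝒞 X j₀ js (Fin.insertNth j k κ) (t + 1)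
          (𝒞.encode k (permute σ
            (𝒞.realize κ (contract j (prodState χ fun r => X t (J r)))))) =
          𝔼 κ, script 𝒞 X j₀ js κ (t + 1) (𝒞.realize κ
            (prodState ((Job.cycle j σ).onData χ) (collapse j fun r => X t (J r)))) := by
        rw [expect_insertNth j]
        simp only [𝒞.map_realize (permute σ), 𝒞.encode_realize j, expand_contract_prodState]
      have h2 := ih (t + 1) ((Job.cycle j σ).onData χ) (by rw [Job.sqNorm_onData, hχ])
        (collapse j fun r => X t (J r))
      rw [h1, virtNorm_prodState, openNorm_contract_prodState, hχ, one_mul, one_mul, hXJ] at h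
      rw [expect_insertNth j]
      simp only [script, Fin.insertNth_apply_same, hXr, Fin.update_insertNth]
      simp only [attack]
      have e : onData (Job.cycle j σ :: js) χ = onData js ((Job.cycle j σ).onData χ) := rfl
      rw [e]
      -- The loss in this cycle and the losses in the later ones add up to the total loss.
      exact ⟨h2.1.trans h.1, h.2.trans (by linarith [h2.2])⟩

end
end QPIP

open Computability
namespace QPIP
noncomputable section

open ComplexConjugate BigOperators

variable {c m n a b : ℕ} {δ : ℝ} {M : Type} [Fintype M]

/-! ### The preparation of the input -/

/-- The state of the opened qubit is the basis vector `b` if the block has been measured to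
be `0`. -/
def prepareBit (b : Bool) : State a (c + 1) M →ₗ[ℂ] Opened a M where
  toFun ψ := fun w y z => if y = b then ψ w (fun _ => false) z else 0
  map_add' ψ ψ' := by
    funext w y z
    by_cases h : y = b <;> simp [h]
  map_smul' r ψ := by
    funext w y z
    by_cases h : y = b <;> simp [h]

/-- The acceptance probability when first the bits of a list are encoded and sent. The function
`rest` gives the acceptance probability afterwards. -/
def prepare (𝒞 : Code c m δ) (X : ℕ → Module.End ℂ ((Fin (c + 1) → Bool) → M → ℂ))
    (rest : ∀ s, (Fin s → Fin m → Bool) → State a (c + 1) M → ℝ) :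
    List Bool → ∀ s, (Fin s → Fin m → Bool) → State a (c + 1) M → ℝ
  | [], s, κ, ψ => rest s κ ψ
  | b :: bs, s, κ, ψ => 𝔼 k, prepare 𝒞 X rest bs (s + 1) (Fin.snoc κ k)
      (𝒞.encode k (prepareBit b (onBlock (X s) ψ)))

/-- The state of `s` logical qubits with the basis state `x` and the work qubits in the state `0`. -/
def basisData (a s : ℕ) (x : ℕ → Bool) : Data s a :=
  fun d w => if (∀ i, d i = x i) ∧ w = fun _ => false then 1 else 0

/-- The effect of the preparation of `s` qubits on the prover. -/
def initMemo (X : ℕ → Module.End ℂ ((Fin (c + 1) → Bool) → M → ℂ))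
    (J : (Fin (c + 1) → Bool) → M → ℂ) : ∀ s, Memo s (c + 1) M
  | 0 => fun _ => J
  | s + 1 => fun r h z => if h = r (Fin.last s) then
      (Real.sqrt (blockDim c) : ℂ)⁻¹ * X s (initMemo X J s (Fin.init r)) (fun _ => false) z else 0

omit [Fintype M] in
theorem onBlock_realize_prodState (𝒞 : Code c m δ)
    (X : Module.End ℂ ((Fin (c + 1) → Bool) → M → ℂ)) (κ : Fin n → Fin m → Bool)
    (χ : Data n a) (J : Memo n (c + 1) M) :
    onBlock X (𝒞.realize κ (prodState χ J)) = 𝒞.realize κ (prodState χ fun r => X (J r)) := by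
  rw [𝒞.map_realize]
  congr 1
  funext s w
  have : prodState χ J s w = χ (fun i => (s i).2) w • J (fun i => (s i).1) := rfl
  change X (prodState χ J s w) = _
  rw [this, map_smul]
  rfl

-- The preparation is followed exactly, without an error term, since nothing is decoded: what the
-- prover returns is measured to be `0` and replaced by a freshly encoded bit, which appends a slot
-- to the virtual product state.
omit [Fintype M] in
theorem prepare_eq (𝒞 : Code c m δ) (X : ℕ → Module.End ℂ ((Fin (c + 1) → Bool) → M → ℂ))
    (rest : ∀ s, (Fin s → Fin m → Bool) → State a (c + 1) M → ℝ)
    (J : (Fin (c + 1) → Bool) → M → ℂ) (x : ℕ → Bool) (bs : List Bool) (s N : ℕ)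
    (hN : s + bs.length = N) (hx : ∀ i (hi : i < bs.length), bs[i] = x (s + i)) :
    𝔼 κ : Fin s → Fin m → Bool, prepare 𝒞 X rest bs s κ
        (𝒞.realize κ (prodState (basisData a s x) (initMemo X J s))) =
      𝔼 κ : Fin N → Fin m → Bool, rest N κ
        (𝒞.realize κ (prodState (basisData a N x) (initMemo X J N))) := by
  induction bs generalizing s with
  | nil =>
    obtain rfl : s = N := hN
    rfl
  | cons b bs ih =>
    have hb : b = x s := hx 0 (by simp)
    rw [← ih (s + 1) (by rw [← hN, List.length_cons]; ring) fun i hi => by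
      have := hx (i + 1) (by simpa using hi)
      rw [List.getElem_cons_succ] at this
      rw [this, add_right_comm, add_assoc]]
    rw [expect_insertNth (Fin.last s)]
    refine Finset.expect_congr rfl fun κ _ => Finset.expect_congr rfl fun k _ => ?_
    rw [Fin.insertNth_last']
    congr 1
    rw [onBlock_realize_prodState, 𝒞.map_realize, 𝒞.encode_realize (Fin.last s),
      Fin.insertNth_last']
    congr 1
    funext s' w h z
    have e : Fin.removeNth (Fin.last s) s' = Fin.init s' := by
      funext i
      simp [Fin.removeNth, Fin.init]
    have e2 : (∀ i, (s' i).2 = x i) ↔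
        (∀ i, (Fin.init s' i).2 = x i) ∧ (s' (Fin.last s)).2 = x s := by
      rw [Fin.forall_fin_succ']
      simp [Fin.init]
    simp only [expand, prepareBit, LinearMap.coe_mk, AddHom.coe_mk, e, prodState, basisData,
      initMemo, hb, e2]
    by_cases h1 : h = (s' (Fin.last s)).1
    · rw [if_pos h1, if_pos h1]
      by_cases h2 : (s' (Fin.last s)).2 = x s
      · simp only [h2, if_true, and_true]
        have : (Fin.init fun i => (s' i).1) = fun i => (Fin.init s' i).1 := rfl
        rw [this]
        ring
      · simp [h2]
    · simp [h1]

/-- Norm is lost only when a prover returns a block that is not `0` during the preparation;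
re-encoding preserves it. -/
theorem sqNorm_initMemo_le {X : ℕ → Module.End ℂ ((Fin (c + 1) → Bool) → M → ℂ)}
    (hX : ∀ t, IsIsometry (X t)) (J : (Fin (c + 1) → Bool) → M → ℂ) (s : ℕ) :
    (initMemo X J s).sqNorm ≤ ∑ h, ∑ z, ‖J h z‖ ^ 2 := by
  induction s with
  | zero => simp [Memo.sqNorm, initMemo]
  | succ s ih =>
    refine le_trans ?_ ih
    have hN := blockDim_pos c
    rw [Memo.sqNorm, sum_insertNth (Fin.last s)]
    refine Finset.sum_le_sum fun r _ => ?_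
    rw [← hX s (initMemo X J s r)]
    have h3 : ∀ (r₀ h : Fin (c + 1) → Bool),
        ∑ z, ‖initMemo X J (s + 1) (Fin.insertNth (Fin.last s) r₀ r) h z‖ ^ 2 =
        if h = r₀ then ∑ z, (blockDim c)⁻¹ *
          ‖X s (initMemo X J s r) (fun _ => false) z‖ ^ 2 else 0 := by
      intro r₀ h
      simp only [initMemo, Fin.insertNth_last', Fin.snoc_last, Fin.init_snoc]
      split_ifs
      · simp only [norm_mul, mul_pow, norm_inv, inv_pow, Complex.norm_real,
          Real.norm_of_nonneg (Real.sqrt_nonneg _), Real.sq_sqrt hN.le]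
      · simp
    simp only [h3, Finset.sum_ite_eq', Finset.mem_univ, if_true, Finset.sum_const,
      Finset.card_univ, Fintype.card_pi, Fintype.card_bool, Finset.prod_const, Fintype.card_fin,
      ← Finset.mul_sum, nsmul_eq_mul]
    rw [← mul_assoc]
    push_cast
    rw [← blockDim, mul_inv_cancel₀ hN.ne', one_mul]
    exact Finset.single_le_sum (f := fun h => ∑ z, ‖X s (initMemo X J s r) h z‖ ^ 2)
      (fun _ _ => by positivity) (Finset.mem_univ _)

theorem sqNorm_basisData (a s : ℕ) (x : ℕ → Bool) : (basisData a s x).sqNorm = 1 := by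
  rw [Data.sqNorm, Finset.sum_eq_single (fun i : Fin s => x i),
    Finset.sum_eq_single (fun _ => false)]
  · simp [basisData]
  · intro w _ hw
    simp [basisData, hw]
  · simp
  · intro d _ hd
    have : ¬ ∀ i, d i = x i := fun h => hd (funext h)
    simp [basisData, this]
  · simp

/-- The bounds for the acceptance probability of the protocol. -/
theorem prepare_bounds (𝒞 : Code c m δ) {X : ℕ → Module.End ℂ ((Fin (c + 1) → Bool) → M → ℂ)}
    (hX : ∀ t, IsIsometry (X t)) (hδ : 0 ≤ δ)
    (rest : ∀ s, (Fin s → Fin m → Bool) → State a (c + 1) M → ℝ) (j₀ : Fin (n + 1))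
    (js : List (Job a (n + 1)))
    (hrest : ∀ κ ψ, rest (n + 1) κ ψ = script 𝒞 X j₀ js κ (n + 1) ψ)
    (J : (Fin (c + 1) → Bool) → M → ℂ) (hJ : ∑ h, ∑ z, ‖J h z‖ ^ 2 = 1) (x : ℕ → Bool)
    (bs : List Bool) (hn : bs.length = n + 1) (hx : ∀ i (hi : i < bs.length), bs[i] = x i) :
    (onData js (basisData a (n + 1) x)).prob j₀ *
        (attack X j₀ js (n + 1) (initMemo X J (n + 1))).sqNorm ≤
      prepare 𝒞 X rest bs 0 ![] (fun w h z => if w = fun _ => false then J h z else 0) ∧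
    prepare 𝒞 X rest bs 0 ![] (fun w h z => if w = fun _ => false then J h z else 0) ≤
      (onData js (basisData a (n + 1) x)).prob j₀ *
        (attack X j₀ js (n + 1) (initMemo X J (n + 1))).sqNorm +
      δ * (1 - (attack X j₀ js (n + 1) (initMemo X J (n + 1))).sqNorm) := by
  have h1 := prepare_eq (a := a) 𝒞 X rest J x bs 0 (n + 1) (by rw [hn, zero_add])
    (fun i hi => by rw [hx, zero_add])
  -- Before the first bit there are no keys and no labels, and the virtual state is the actual one.
  have h2 : 𝔼 κ : Fin 0 → Fin m → Bool, prepare 𝒞 X rest bs 0 κ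
        (𝒞.realize κ (prodState (basisData a 0 x) (initMemo X J 0))) =
      prepare 𝒞 X rest bs 0 ![] (fun w h z => if w = fun _ => false then J h z else 0) := by
    rw [Fintype.expect_eq_sum_div_card]
    rw [Fintype.sum_eq_single ![] fun κ h => absurd (Subsingleton.elim _ _) h]
    simp only [Fintype.card_unique, Nat.cast_one, div_one]
    congr 1
    funext w h z
    simp [Code.realize, prodState, basisData, initMemo]
  rw [← h2, h1]
  simp only [hrest]
  have h3 := script_bounds 𝒞 hX j₀ js (n + 1) (basisData a (n + 1) x) (sqNorm_basisData _ _ _)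
    (initMemo X J (n + 1))
  refine ⟨h3.1, h3.2.trans ?_⟩
  have h4 := sqNorm_initMemo_le hX J (n + 1)
  rw [hJ] at h4
  have := mul_le_mul_of_nonneg_left h4 hδ
  linarith

end
end QPIP

open Computability
namespace QPIP
noncomputable section

open ComplexConjugate BigOperators Matrix

/-! ### Rounds of a controller -/

section Round

variable {A : Type} {a b : ℕ} {M : Type} [Fintype M] (V : Controller A)
  (instr : V.Q → BlockInstr a b) (U : ℕ → Matrix (Bool × M) (Bool × M) ℂ) {x : V.Conf} {t : ℕ}
  {ψ : State a b M} {k : ℕ}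

theorem blockRun_unitary {W} (h : instr x.q = .unitary W) :
    blockRun V instr U (k + 1) x t ψ =
      blockRun V instr U k (V.next x false) t (applyReg W ψ) := by
  rw [blockRun.eq_def]
  simp only [h]

theorem blockRun_measure {i} (h : instr x.q = .measure i) :
    blockRun V instr U (k + 1) x t ψ =
      ∑ v, blockRun V instr U k (V.next x v) t (projectBit i v ψ) := by
  rw [blockRun.eq_def]
  simp only [h]

theorem blockRun_flip (h : instr x.q = .flip) :
    blockRun V instr U (k + 1) x t ψ = 𝔼 v, blockRun V instr U k (V.next x v) t ψ := by
  rw [blockRun.eq_def, Fintype.expect_eq_sum_div_card, Fintype.sum_bool, Fintype.card_bool,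
    add_comm (blockRun V instr U k (V.next x true) t ψ)]
  simp only [h]
  rfl

theorem blockRun_exchange {i} (h : instr x.q = .exchange i) :
    blockRun V instr U (k + 1) x t ψ =
      blockRun V instr U k (V.next x false) (t + 1) fun w => exchangeBit (U t) i (ψ w) := by
  rw [blockRun.eq_def]
  simp only [h]

theorem blockRun_accept (h : instr x.q = .accept) : blockRun V instr U k x t ψ = sqNorm ψ := by
  rw [blockRun.eq_def]
  cases k <;> simp only [h]

theorem blockRun_reject (h : instr x.q = .reject) : blockRun V instr U k x t ψ = 0 := by
  rw [blockRun.eq_def]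
  cases k <;> simp only [h]

end Round

/-! ### Unitary operators on the parts of the register -/

variable {a b c m : ℕ} {δ : ℝ} {M : Type} [Fintype M]

def liftWork (U : Unitary (Fin a → Bool)) : Unitary ((Fin a → Bool) × (Fin b → Bool)) :=
  ⟨kroneckerMap (· * ·) U.1 1, kronecker_mem_unitary U.2 (one_mem _)⟩

def liftBlock (V : Unitary (Fin b → Bool)) : Unitary ((Fin a → Bool) × (Fin b → Bool)) :=
  ⟨kroneckerMap (· * ·) 1 V.1, kronecker_mem_unitary (one_mem _) V.2⟩

def permUnitary {B : Type} [Fintype B] [DecidableEq B] (τ : Equiv.Perm B) : Unitary B :=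
  ⟨Matrix.of fun p q => if τ p = q then 1 else 0, by
    rw [Matrix.mem_unitaryGroup_iff]
    ext p q
    rw [Matrix.mul_apply, Matrix.one_apply]
    simp [Matrix.star_apply, eq_comm (a := p)]⟩

omit [Fintype M] in
theorem applyReg_one (ψ : State a b M) : applyReg 1 ψ = ψ := by
  funext w h z
  simp [applyReg, Matrix.one_apply]

omit [Fintype M] in
theorem applyReg_liftWork (U : Unitary (Fin a → Bool)) (ψ : State a b M) :
    applyReg (liftWork U) ψ = workGate U ψ := by
  funext w h z
  simp [applyReg, liftWork, workGate, Fintype.sum_prod_type, Matrix.one_apply]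

omit [Fintype M] in
theorem applyReg_liftBlock (V : Unitary (Fin b → Bool)) (ψ : State a b M) (w h z) :
    applyReg (liftBlock V) ψ w h z = ∑ h', V.1 h h' * ψ w h' z := by
  simp [applyReg, liftBlock, Fintype.sum_prod_type, Matrix.one_apply]

omit [Fintype M] in
theorem applyReg_permUnitary (τ : Equiv.Perm ((Fin a → Bool) × (Fin b → Bool)))
    (ψ : State a b M) (w h z) :
    applyReg (permUnitary τ) ψ w h z = ψ (τ (w, h)).1 (τ (w, h)).2 z := by
  simp [applyReg, permUnitary]

/-- A permutation of the basis states of the work qubits and the data qubit of the block. -/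
def blockPerm (σ : Equiv.Perm ((Fin a → Bool) × Bool)) :
    Equiv.Perm ((Fin a → Bool) × (Fin (c + 1) → Bool)) where
  toFun p := ((σ (p.1, p.2 (Fin.last c))).1,
    Function.update p.2 (Fin.last c) (σ (p.1, p.2 (Fin.last c))).2)
  invFun p := ((σ.symm (p.1, p.2 (Fin.last c))).1,
    Function.update p.2 (Fin.last c) (σ.symm (p.1, p.2 (Fin.last c))).2)
  left_inv p := by simp
  right_inv p := by simp

/-- Adding the bit `b` to the data qubit. -/
def xorPerm (b : Bool) : Equiv.Perm ((Fin a → Bool) × Bool) where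
  toFun p := (p.1, xor b p.2)
  invFun p := (p.1, xor b p.2)
  left_inv p := by simp
  right_inv p := by simp

/-! ### Programs -/

/-- The commands of a program. A block is fetched and decoded with the key `k`, a permutation is
applied, and it is encoded with a new key and returned; or the data bit `b` is
encoded and sent; or a block is decoded and its data qubit is measured. -/
inductive Cmd (a m : ℕ) where
  | nop
  | work (U : Unitary (Fin a → Bool))
  | cycle (k : Fin m → Bool) (σ : Equiv.Perm ((Fin a → Bool) × Bool))
  | prep (b : Bool)
  | final (k : Fin m → Bool)

/-- A machine with stacks whose states are labelled with commands. After every command it obtains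
the new key, if there is one. -/
structure Program (A : Type) (a m : ℕ) where
  Q : Type
  [finQ : Fintype Q]
  K : Type
  [finK : Fintype K]
  [decK : DecidableEq K]
  W : Type
  [finW : Fintype W]
  start : Q
  inK : K
  emb : A → W
  cmd : Q → Cmd a m
  tr : Q → (K → Option W) → (Fin m → Bool) → Q × (K → Bool × List W)

attribute [instance] Program.finQ Program.finK Program.decK Program.finW

/-- The phases of the execution of a command. -/
inductive Phase (c m : ℕ) where
  | ex (i : Fin (c + 2))
  | meas (i : Fin (c + 2))
  | toss (i : Fin (m + 1)) (k : Fin m → Bool)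
  | enc (k : Fin m → Bool)
  | halt (v : Bool)
  deriving Fintype

namespace Program

variable {A : Type} (P : Program A a m)

@[ext] structure Conf where
  q : P.Q
  stk : P.K → List P.W

variable {P} in
def Conf.next (s : P.Conf) (k : Fin m → Bool) : P.Conf :=
  let r := P.tr s.q (fun l => (s.stk l).head?) k
  ⟨r.1, fun l => StackMachine.act (r.2 l) (s.stk l)⟩

def init (x : List A) : P.Conf := ⟨P.start, fun k => if k = P.inK then x.map P.emb else []⟩

/-- The controller that executes a program. -/
def controller (c : ℕ) : Controller A where
  Q := P.Q × Phase c m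
  K := P.K
  W := P.W
  start := (P.start, .ex 0)
  inK := P.inK
  emb := P.emb
  tr p v b :=
    let stay (ph : Phase c m) : (P.Q × Phase c m) × (P.K → Bool × List P.W) :=
      ((p.1, ph), fun _ => (false, []))
    let done (k : Fin m → Bool) : (P.Q × Phase c m) × (P.K → Bool × List P.W) :=
      let r := P.tr p.1 v k
      ((r.1, .ex 0), r.2)
    match p.2 with
    | .ex i => match P.cmd p.1 with
      | .nop => done fun _ => false
      | .work _ => done fun _ => false
      | _ => if h : i.val < c + 1 then stay (.ex ⟨i + 1, by omega⟩) else stay (.meas 0)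
    | .meas i =>
      -- The qubits below `c` are ancillas, and the outcome `1` means rejection. Qubit `c` carries
      -- the data: it is measured to clear it in a preparation and to get the result at the end; in
      -- a cycle this round is idle.
      if h : i.val < c then
        if b then stay (.halt false) else stay (.meas ⟨i + 1, by omega⟩)
      else match P.cmd p.1 with
        | .prep _ => if b then stay (.halt false) else stay (.toss 0 fun _ => false)
        | .final _ => stay (.halt b)
        | _ => stay (.toss 0 fun _ => false)
    | .toss i k =>
      if h : i.val < m then stay (.toss ⟨i + 1, by omega⟩ (Function.update k ⟨i, h⟩ b))
      else stay (.enc k)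
    | .enc k => done k
    | .halt v => stay (.halt v)

/-- The instructions that execute a program. -/
def instr (𝒞 : Code c m δ) (p : P.Q × Phase c m) : BlockInstr a (c + 1) :=
  match p.2 with
  | .ex i => match P.cmd p.1 with
    | .nop => .unitary 1
    | .work U => .unitary (liftWork U)
    | .prep _ => if h : i.val < c + 1 then .exchange ⟨i, h⟩ else .unitary 1
    | .cycle k _ => if h : i.val < c + 1 then .exchange ⟨i, h⟩ else
        .unitary (liftBlock (star (𝒞.unitary k)))
    | .final k => if h : i.val < c + 1 then .exchange ⟨i, h⟩ else
        .unitary (liftBlock (star (𝒞.unitary k)))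
  | .meas i =>
    if h : i.val < c then .measure ⟨i, by omega⟩
    else match P.cmd p.1 with
      | .prep _ => .measure (Fin.last c)
      | .final _ => .measure (Fin.last c)
      | _ => .unitary 1
  | .toss i _ =>
    if i.val < m then .flip
    else match P.cmd p.1 with
      | .prep b => .unitary (permUnitary (blockPerm (xorPerm b)))
      | .cycle _ σ => .unitary (permUnitary (blockPerm σ))
      | _ => .unitary 1
  | .enc k => .unitary (liftBlock (𝒞.unitary k))
  | .halt v => if v then .accept else .reject

section Run

variable (𝒞 : Code c m δ) (U : ℕ → Matrix (Bool × M) (Bool × M) ℂ)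

/-- The operator for the exchange of the first qubits of a block. -/
def exchangeUpTo (U : ℕ → Matrix (Bool × M) (Bool × M) ℂ) (t : ℕ) :
    ℕ → Module.End ℂ ((Fin (c + 1) → Bool) → M → ℂ)
  | 0 => 1
  | i + 1 => (if h : i < c + 1 then exchangeBit (U (t + i)) ⟨i, h⟩ else 1) * exchangeUpTo U t i

/-- The operator for the exchange of the block number `s`. -/
def exchangeBlock (U : ℕ → Matrix (Bool × M) (Bool × M) ℂ) (s : ℕ) :
    Module.End ℂ ((Fin (c + 1) → Bool) → M → ℂ) :=
  exchangeUpTo U (s * (c + 1)) (c + 1)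

abbrev bRun (k : ℕ) (q : P.Q) (ph : Phase c m) (stk : P.K → List P.W) (t : ℕ)
    (ψ : State a (c + 1) M) : ℝ :=
  blockRun (P.controller c) (P.instr 𝒞) U k ⟨(q, ph), stk⟩ t ψ

theorem bRun_unitary {q : P.Q} {ph : Phase c m} {stk : P.K → List P.W} {t : ℕ}
    {ψ : State a (c + 1) M} {k : ℕ} {W} (h : P.instr 𝒞 (q, ph) = .unitary W) :
    P.bRun 𝒞 U (k + 1) q ph stk t ψ = blockRun (P.controller c) (P.instr 𝒞) U k
      ((P.controller c).next ⟨(q, ph), stk⟩ false) t (applyReg W ψ) := by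
  exact blockRun_unitary _ _ _ h

theorem bRun_measure {q : P.Q} {ph : Phase c m} {stk : P.K → List P.W} {t : ℕ}
    {ψ : State a (c + 1) M} {k : ℕ} {i} (h : P.instr 𝒞 (q, ph) = .measure i) :
    P.bRun 𝒞 U (k + 1) q ph stk t ψ = ∑ v, blockRun (P.controller c) (P.instr 𝒞) U k
      ((P.controller c).next ⟨(q, ph), stk⟩ v) t (projectBit i v ψ) := by
  exact blockRun_measure _ _ _ h

theorem bRun_flip {q : P.Q} {ph : Phase c m} {stk : P.K → List P.W} {t : ℕ}
    {ψ : State a (c + 1) M} {k : ℕ} (h : P.instr 𝒞 (q, ph) = .flip) :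
    P.bRun 𝒞 U (k + 1) q ph stk t ψ = 𝔼 v, blockRun (P.controller c) (P.instr 𝒞) U k
      ((P.controller c).next ⟨(q, ph), stk⟩ v) t ψ := by
  exact blockRun_flip _ _ _ h

theorem bRun_exchange {q : P.Q} {ph : Phase c m} {stk : P.K → List P.W} {t : ℕ}
    {ψ : State a (c + 1) M} {k : ℕ} {i} (h : P.instr 𝒞 (q, ph) = .exchange i) :
    P.bRun 𝒞 U (k + 1) q ph stk t ψ = blockRun (P.controller c) (P.instr 𝒞) U k
      ((P.controller c).next ⟨(q, ph), stk⟩ false) (t + 1) fun w => exchangeBit (U t) i (ψ w) := by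
  exact blockRun_exchange _ _ _ h

theorem act_id {X : Type} (l : List X) : StackMachine.act (false, []) l = l := rfl

theorem bRun_ex (q : P.Q) (hq : ∀ W, P.cmd q ≠ .work W) (hn : P.cmd q ≠ .nop) (stk t)
    (ψ : State a (c + 1) M) (i : ℕ) (hi : i < c + 2) (k : ℕ) :
    P.bRun 𝒞 U (k + i) q (.ex 0) stk t ψ =
      P.bRun 𝒞 U k q (.ex ⟨i, hi⟩) stk (t + i) (onBlock (exchangeUpTo U t i) ψ) := by
  induction i generalizing k with
  | zero => rfl
  | succ i ih =>
    have hi' : i < c + 1 := by omega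
    rw [show k + (i + 1) = (k + 1) + i by omega, ih (by omega) (k + 1)]
    have h1 : P.instr 𝒞 (q, .ex ⟨i, by omega⟩) = .exchange ⟨i, hi'⟩ := by
      unfold instr
      cases h : P.cmd q <;> simp_all
    have h2 : ∀ b, (P.controller c).next ⟨(q, .ex ⟨i, by omega⟩), stk⟩ b =
        ⟨(q, .ex ⟨i + 1, hi⟩), stk⟩ := by
      intro b
      unfold Controller.next controller
      cases h : P.cmd q <;> simp_all [act_id]
    rw [bRun_exchange P 𝒞 U h1, h2]
    congr 1
    funext w
    simp [onBlock, exchangeUpTo, hi']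

theorem bRun_halt_false (q : P.Q) (stk t) (ψ : State a (c + 1) M) (k : ℕ) :
    P.bRun 𝒞 U k q (.halt false) stk t ψ = 0 :=
  blockRun_reject _ _ _ rfl

theorem bRun_halt_true (q : P.Q) (stk t) (ψ : State a (c + 1) M) (k : ℕ) :
    P.bRun 𝒞 U k q (.halt true) stk t ψ = sqNorm ψ :=
  blockRun_accept _ _ _ rfl

/-- The projection to the states in which the first `i` qubits of the block are `0`. -/
def project (i : ℕ) (ψ : State a b M) : State a b M :=
  fun w h z => if ∀ l : Fin b, l.val < i → h l = false then ψ w h z else 0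

omit [Fintype M] in
theorem projectBit_project (i : ℕ) (hi : i < b) (ψ : State a b M) :
    projectBit ⟨i, hi⟩ false (project i ψ) = project (i + 1) ψ := by
  funext w h z
  simp only [projectBit, project]
  have : (∀ l : Fin b, l.val < i + 1 → h l = false) ↔
      (∀ l : Fin b, l.val < i → h l = false) ∧ h ⟨i, hi⟩ = false := by
    constructor
    · exact fun H => ⟨fun l hl => H l (by omega), H _ (by simp)⟩
    · rintro ⟨H1, H2⟩ l hl
      rcases Nat.lt_succ_iff_lt_or_eq.1 hl with h | h
      · exact H1 l h
      · have : l = ⟨i, hi⟩ := Fin.ext h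
        rw [this, H2]
  simp only [this]
  by_cases h1 : h ⟨i, hi⟩ = false <;> simp [h1]

omit [Fintype M] in
theorem project_zero (ψ : State a b M) : project 0 ψ = ψ := by
  funext w h z
  simp [project]

theorem bRun_meas (q : P.Q) (stk t) (ψ : State a (c + 1) M) (i : ℕ) (hi : i ≤ c) (k : ℕ) :
    P.bRun 𝒞 U (k + i) q (.meas 0) stk t ψ =
      P.bRun 𝒞 U k q (.meas ⟨i, by omega⟩) stk t (project i ψ) := by
  induction i generalizing k with
  | zero => rw [project_zero]; rfl
  | succ i ih =>
    have hi' : i < c := by omega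
    rw [show k + (i + 1) = (k + 1) + i by omega, ih (by omega) (k + 1)]
    have h1 : P.instr 𝒞 (q, .meas ⟨i, by omega⟩) = .measure ⟨i, by omega⟩ := by
      simp [instr, hi']
    have h2 : (P.controller c).next ⟨(q, .meas ⟨i, by omega⟩), stk⟩ false =
        ⟨(q, .meas ⟨i + 1, by omega⟩), stk⟩ := by
      simp [Controller.next, controller, hi', act_id]
    have h3 : (P.controller c).next ⟨(q, .meas ⟨i, by omega⟩), stk⟩ true =
        ⟨(q, .halt false), stk⟩ := by
      simp [Controller.next, controller, hi', act_id]
    have h4 := P.bRun_halt_false 𝒞 U q stk t (projectBit ⟨i, by omega⟩ true (project i ψ)) k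
    rw [bRun] at h4
    rw [bRun_measure P 𝒞 U h1]
    simp only [Fintype.sum_bool, h2, h3, h4, zero_add, projectBit_project]

/-- A string of bits, extended by zeros. -/
def zeroExtend {i : ℕ} (κ : Fin i → Bool) : Fin m → Bool :=
  fun l => if h : l.val < i then κ ⟨l, h⟩ else false

theorem zeroExtend_snoc {i : ℕ} (hi : i < m) (κ : Fin i → Bool) (b : Bool) :
    (zeroExtend (Fin.snoc κ b : Fin (i + 1) → Bool) : Fin m → Bool) =
      Function.update (zeroExtend κ) ⟨i, hi⟩ b := by
  funext l
  rcases Nat.lt_trichotomy l.val i with h | h | h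
  · rw [Function.update_of_ne (by intro e; rw [e] at h; simp at h)]
    simp [zeroExtend, h, Fin.snoc, show l.val < i + 1 by omega]
  · have : l = ⟨i, hi⟩ := Fin.ext h
    subst this
    simp [zeroExtend, Fin.snoc]
  · rw [Function.update_of_ne (by intro e; rw [e] at h; simp at h)]
    simp [zeroExtend, show ¬ l.val < i by omega, show ¬ l.val < i + 1 by omega]

theorem bRun_toss (q : P.Q) (stk t) (ψ : State a (c + 1) M) (i : ℕ) (hi : i ≤ m) (k : ℕ) :
    P.bRun 𝒞 U (k + i) q (.toss 0 fun _ => false) stk t ψ =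
      𝔼 κ : Fin i → Bool, P.bRun 𝒞 U k q (.toss ⟨i, by omega⟩ (zeroExtend κ)) stk t ψ := by
  induction i generalizing k with
  | zero =>
    have h : (zeroExtend ![] : Fin m → Bool) = fun _ => false := by
      funext l
      simp [zeroExtend]
    rw [Fintype.expect_eq_sum_div_card,
      Fintype.sum_eq_single ![] fun κ h => absurd (Subsingleton.elim _ _) h, h]
    simp
  | succ i ih =>
    have hi' : i < m := by omega
    rw [show k + (i + 1) = (k + 1) + i by omega, ih (by omega) (k + 1), expect_insertNth (Fin.last i)]
    refine Finset.expect_congr rfl fun κ _ => ?_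
    have h1 : P.instr 𝒞 (q, .toss ⟨i, by omega⟩ (zeroExtend κ)) = .flip := by
      simp [instr, hi']
    have h2 : ∀ b, (P.controller c).next ⟨(q, .toss ⟨i, by omega⟩ (zeroExtend κ)), stk⟩ b =
        ⟨(q, .toss ⟨i + 1, by omega⟩ (zeroExtend (Fin.snoc κ b : Fin (i + 1) → Bool))), stk⟩ := by
      intro b
      rw [zeroExtend_snoc hi']
      simp [Controller.next, controller, hi', act_id]
    rw [bRun_flip P 𝒞 U h1]
    simp only [h2, Fin.insertNth_last']

theorem zeroExtend_self (κ : Fin m → Bool) : zeroExtend κ = κ := by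
  funext l
  simp [zeroExtend]

/-- The number of rounds that a command takes at most. -/
def cost (c m : ℕ) : ℕ := 2 * c + m + 5

/-- If `s` commands can be executed, then the acceptance probability is given by `f`. -/
def Runs (s : ℕ) (x : P.Conf) (t : ℕ) (f : State a (c + 1) M → ℝ) : Prop :=
  ∀ k, s * cost c m ≤ k → ∀ ψ, P.bRun 𝒞 U k x.q (.ex 0) x.stk (t * (c + 1)) ψ = f ψ

variable {P 𝒞 U}

theorem Runs.mono {s s' : ℕ} {x : P.Conf} {t : ℕ} {f : State a (c + 1) M → ℝ}
    (h : P.Runs 𝒞 U s x t f) (hs : s ≤ s') : P.Runs 𝒞 U s' x t f :=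
  fun k hk ψ => h k ((Nat.mul_le_mul_right _ hs).trans hk) ψ

theorem Runs.nop {s : ℕ} {x : P.Conf} {t : ℕ} {f : State a (c + 1) M → ℝ}
    (hx : P.cmd x.q = .nop) (h : P.Runs 𝒞 U s (x.next fun _ => false) t f) :
    P.Runs 𝒞 U (s + 1) x t f := by
  intro k hk ψ
  rw [Nat.add_mul, one_mul] at hk
  obtain ⟨k, rfl⟩ : ∃ k', k = k' + 1 := ⟨k - 1, by unfold cost at hk; omega⟩
  have h1 : P.instr 𝒞 (x.q, .ex 0) = .unitary 1 := by simp [instr, hx]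
  have h2 : (P.controller c).next ⟨(x.q, .ex 0), x.stk⟩ false =
      ⟨((x.next fun _ => false).q, .ex 0), (x.next fun _ => false).stk⟩ := by
    simp [Controller.next, controller, hx, Conf.next]
  rw [bRun_unitary P 𝒞 U h1]
  simp only [h2, applyReg_one]
  exact h k (by unfold cost at hk ⊢; omega) ψ

theorem Runs.work {s : ℕ} {x : P.Conf} {t : ℕ} {f : State a (c + 1) M → ℝ}
    {V : Unitary (Fin a → Bool)}
    (hx : P.cmd x.q = .work V) (h : P.Runs 𝒞 U s (x.next fun _ => false) t f) :
    P.Runs 𝒞 U (s + 1) x t fun ψ => f (workGate V ψ) := by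
  intro k hk ψ
  rw [Nat.add_mul, one_mul] at hk
  obtain ⟨k, rfl⟩ : ∃ k', k = k' + 1 := ⟨k - 1, by unfold cost at hk; omega⟩
  have h1 : P.instr 𝒞 (x.q, .ex 0) = .unitary (liftWork V) := by simp [instr, hx]
  have h2 : (P.controller c).next ⟨(x.q, .ex 0), x.stk⟩ false =
      ⟨((x.next fun _ => false).q, .ex 0), (x.next fun _ => false).stk⟩ := by
    simp [Controller.next, controller, hx, Conf.next]
  rw [bRun_unitary P 𝒞 U h1]
  simp only [h2, applyReg_liftWork]
  exact h k (by unfold cost at hk ⊢; omega) _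

theorem bRun_enc {s : ℕ} {x : P.Conf} {t : ℕ} {f : State a (c + 1) M → ℝ} {key : Fin m → Bool}
    (h : P.Runs 𝒞 U s (x.next key) t f) (k : ℕ) (hk : s * cost c m ≤ k) (ψ : State a (c + 1) M) :
    P.bRun 𝒞 U (k + 1) x.q (.enc key) x.stk (t * (c + 1)) ψ =
      f (applyReg (liftBlock (𝒞.unitary key)) ψ) := by
  have h1 : P.instr 𝒞 (x.q, .enc key) = .unitary (liftBlock (𝒞.unitary key)) := rfl
  rw [bRun_unitary P 𝒞 U h1]
  exact h k hk _

omit [Fintype M] in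
theorem sum_clearBlock {V : Type} [AddCommMonoid V] (f : (Fin (c + 1) → Bool) → V)
    (hf : ∀ h, (∃ l : Fin (c + 1), l.val < c ∧ h l ≠ false) → f h = 0) :
    ∑ h, f h = ∑ y, f (clearBlock y) := by
  symm
  refine Finset.sum_of_injOn clearBlock clearBlock_injective.injOn (by simp) ?_ fun _ _ => rfl
  intro h _ hh
  apply hf
  by_contra hcon
  push Not at hcon
  apply hh
  refine ⟨h (Fin.last c), by simp, ?_⟩
  funext l
  by_cases hl : l = Fin.last c
  · rw [hl, clearBlock, Function.update_self]
  · rw [clearBlock, Function.update_of_ne hl]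
    exact (hcon l (Fin.val_lt_last hl)).symm

theorem clearBlock_of_lt (y : Bool) (l : Fin (c + 1)) (hl : l.val < c) : clearBlock y l = false := by
  rw [clearBlock, Function.update_of_ne]
  intro h
  rw [h] at hl
  simp at hl

-- Outside the cleared blocks `𝒞.unitary` is an arbitrary extension. The projection by the
-- measurements leaves only cleared blocks, and on these it acts as the isometry of the code; the
-- permutation of the data qubit keeps them cleared.
omit [Fintype M] in
theorem encode_project_decode (k k' : Fin m → Bool) (σ : Equiv.Perm ((Fin a → Bool) × Bool))
    (ψ : State a (c + 1) M) :
    applyReg (liftBlock (𝒞.unitary k)) (applyReg (permUnitary (blockPerm σ))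
      (project c (applyReg (liftBlock (star (𝒞.unitary k'))) ψ))) =
      𝒞.encode k (permute σ (𝒞.decode k' ψ)) := by
  have hdec : ∀ w y z, applyReg (liftBlock (star (𝒞.unitary k'))) ψ w (clearBlock y) z =
      𝒞.decode k' ψ w y z := by
    intro w y z
    rw [applyReg_liftBlock, 𝒞.decode_apply]
    refine Finset.sum_congr rfl fun h _ => ?_
    rw [← 𝒞.unitary_apply]
    rfl
  have hcl : ∀ y y', Function.update (clearBlock y : Fin (c + 1) → Bool) (Fin.last c) y' =
      clearBlock y' := by
    intro y y'
    simp [clearBlock]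
  funext w h z
  rw [applyReg_liftBlock, sum_clearBlock]
  · rw [𝒞.encode_apply]
    refine Finset.sum_congr rfl fun y _ => ?_
    rw [𝒞.unitary_apply, applyReg_permUnitary]
    have : (clearBlock y : Fin (c + 1) → Bool) (Fin.last c) = y := by simp [clearBlock]
    simp only [blockPerm, Equiv.coe_fn_mk, this, hcl, project, hdec]
    rw [if_pos fun l hl => clearBlock_of_lt _ l hl]
    rfl
  · rintro h' ⟨l, hl, hl'⟩
    rw [applyReg_permUnitary, project, if_neg, mul_zero]
    intro H
    apply hl'
    rw [← H l hl]
    simp only [blockPerm, Equiv.coe_fn_mk]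
    rw [Function.update_of_ne]
    intro h
    rw [h] at hl
    simp at hl

-- After all qubits of the block have been found to be `0`, adding `b` to the data qubit produces
-- the basis state `b`.
omit [Fintype M] in
theorem encode_project (k : Fin m → Bool) (b : Bool) (ψ : State a (c + 1) M) :
    applyReg (liftBlock (𝒞.unitary k)) (applyReg (permUnitary (blockPerm (xorPerm b)))
      (project (c + 1) ψ)) = 𝒞.encode k (prepareBit b ψ) := by
  funext w h z
  rw [applyReg_liftBlock, sum_clearBlock]
  · rw [𝒞.encode_apply]
    refine Finset.sum_congr rfl fun y _ => ?_
    rw [𝒞.unitary_apply, applyReg_permUnitary]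
    have : (clearBlock y : Fin (c + 1) → Bool) (Fin.last c) = y := by simp [clearBlock]
    congr 1
    simp only [blockPerm, Equiv.coe_fn_mk, this, project, prepareBit, LinearMap.coe_mk,
      AddHom.coe_mk, xorPerm]
    by_cases hy : y = b
    · subst hy
      rw [if_pos rfl, if_pos]
      · simp [clearBlock]
      · intro l _
        simp [clearBlock]
    · rw [if_neg hy, if_neg]
      intro H
      have := H (Fin.last c) (by simp)
      simp at this
      exact hy this.symm
  · rintro h' ⟨l, hl, hl'⟩
    rw [applyReg_permUnitary, project, if_neg, mul_zero]
    intro H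
    apply hl'
    rw [← H l (by omega)]
    simp only [blockPerm, Equiv.coe_fn_mk]
    rw [Function.update_of_ne]
    intro h
    rw [h] at hl
    simp at hl

theorem bRun_toss_enc {s : ℕ} {x : P.Conf} {t : ℕ}
    {f : (Fin m → Bool) → State a (c + 1) M → ℝ}
    {τ : Equiv.Perm ((Fin a → Bool) × Bool)}
    (hτ : ∀ i k, i.val = m → P.instr 𝒞 (x.q, .toss i k) = .unitary (permUnitary (blockPerm τ)))
    (h : ∀ key, P.Runs 𝒞 U s (x.next key) t (f key)) (k : ℕ) (hk : s * cost c m ≤ k)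
    (ψ : State a (c + 1) M) :
    P.bRun 𝒞 U (k + 2 + m) x.q (.toss 0 fun _ => false) x.stk (t * (c + 1)) ψ =
      𝔼 key, f key (applyReg (liftBlock (𝒞.unitary key))
        (applyReg (permUnitary (blockPerm τ)) ψ)) := by
  rw [bRun_toss P 𝒞 U x.q x.stk _ ψ m le_rfl (k + 2)]
  refine Finset.expect_congr rfl fun key _ => ?_
  rw [zeroExtend_self]
  have h2 : ∀ b, (P.controller c).next ⟨(x.q, .toss ⟨m, by omega⟩ key), x.stk⟩ b =
      ⟨(x.q, .enc key), x.stk⟩ := by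
    intro b
    simp [Controller.next, controller, act_id]
  rw [bRun_unitary P 𝒞 U (hτ ⟨m, by omega⟩ key rfl)]
  simp only [h2]
  exact bRun_enc (h key) k hk _

theorem bRun_dec {x : P.Conf} {t : ℕ} (V : Unitary ((Fin a → Bool) × (Fin (c + 1) → Bool)))
    (hq : ∀ W, P.cmd x.q ≠ .work W) (hn : P.cmd x.q ≠ .nop)
    (hV : ∀ i : Fin (c + 2), i.val = c + 1 → P.instr 𝒞 (x.q, .ex i) = .unitary V) (k : ℕ)
    (ψ : State a (c + 1) M) :
    P.bRun 𝒞 U (k + c + 1 + (c + 1)) x.q (.ex 0) x.stk (t * (c + 1)) ψ =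
      P.bRun 𝒞 U k x.q (.meas ⟨c, by omega⟩) x.stk ((t + 1) * (c + 1))
        (project c (applyReg V (onBlock (exchangeBlock U t) ψ))) := by
  rw [bRun_ex P 𝒞 U x.q hq hn x.stk _ ψ (c + 1) (by omega) (k + c + 1)]
  have h2 : (P.controller c).next ⟨(x.q, .ex ⟨c + 1, by omega⟩), x.stk⟩ false =
      ⟨(x.q, .meas 0), x.stk⟩ := by
    unfold Controller.next controller
    cases h : P.cmd x.q <;> simp_all [act_id]
  rw [bRun_unitary P 𝒞 U (hV ⟨c + 1, by omega⟩ rfl)]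
  simp only [h2]
  rw [Nat.add_mul, one_mul]
  exact bRun_meas P 𝒞 U x.q x.stk _ _ c le_rfl k

theorem Runs.cycle {s : ℕ} {x : P.Conf} {t : ℕ} {f : (Fin m → Bool) → State a (c + 1) M → ℝ}
    {k' : Fin m → Bool} {σ : Equiv.Perm ((Fin a → Bool) × Bool)}
    (hx : P.cmd x.q = .cycle k' σ)
    (h : ∀ key, P.Runs 𝒞 U s (x.next key) (t + 1) (f key)) :
    P.Runs 𝒞 U (s + 1) x t fun ψ => 𝔼 key, f key
      (𝒞.encode key (permute σ (𝒞.decode k' (onBlock (exchangeBlock U t) ψ)))) := by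
  intro k hk ψ
  rw [Nat.add_mul, one_mul] at hk
  -- A cycle takes exactly `cost c m` rounds: `c + 1` exchanges, the decoding, `c` measurements and
  -- an idle round, `m` coin tosses, the permutation and the encoding.
  obtain ⟨k, rfl⟩ : ∃ l, k = (l + 2 + m + 1) + c + 1 + (c + 1) :=
    ⟨k - cost c m, by unfold cost at hk ⊢; omega⟩
  rw [bRun_dec (liftBlock (star (𝒞.unitary k'))) (by simp [hx]) (by simp [hx])
    (fun i hi => by simp [instr, hx, hi])]
  have h1 : P.instr 𝒞 (x.q, .meas ⟨c, by omega⟩) = .unitary 1 := by simp [instr, hx]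
  have h2 : (P.controller c).next ⟨(x.q, .meas ⟨c, by omega⟩), x.stk⟩ false =
      ⟨(x.q, .toss 0 fun _ => false), x.stk⟩ := by
    simp [Controller.next, controller, hx, act_id]
  rw [bRun_unitary P 𝒞 U h1]
  simp only [h2, applyReg_one]
  refine (bRun_toss_enc (τ := σ) (fun i k hi => by simp [instr, hx, hi]) h k
    (by unfold cost at hk ⊢; omega) _).trans ?_
  exact Finset.expect_congr rfl fun key _ => by rw [encode_project_decode]

theorem Runs.prep {s : ℕ} {x : P.Conf} {t : ℕ} {f : (Fin m → Bool) → State a (c + 1) M → ℝ}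
    {b : Bool} (hx : P.cmd x.q = .prep b)
    (h : ∀ key, P.Runs 𝒞 U s (x.next key) (t + 1) (f key)) :
    P.Runs 𝒞 U (s + 1) x t fun ψ => 𝔼 key, f key
      (𝒞.encode key (prepareBit b (onBlock (exchangeBlock U t) ψ))) := by
  intro k hk ψ
  rw [Nat.add_mul, one_mul] at hk
  obtain ⟨k, rfl⟩ : ∃ l, k = (l + 2 + m + 1) + c + 1 + (c + 1) :=
    ⟨k - cost c m, by unfold cost at hk ⊢; omega⟩
  rw [bRun_dec 1 (by simp [hx]) (by simp [hx]) (fun i hi => by simp [instr, hx, hi])]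
  have h1 : P.instr 𝒞 (x.q, .meas ⟨c, by omega⟩) = .measure (Fin.last c) := by simp [instr, hx]
  have h2 : (P.controller c).next ⟨(x.q, .meas ⟨c, by omega⟩), x.stk⟩ false =
      ⟨(x.q, .toss 0 fun _ => false), x.stk⟩ := by
    simp [Controller.next, controller, hx, act_id]
  have h3 : (P.controller c).next ⟨(x.q, .meas ⟨c, by omega⟩), x.stk⟩ true =
      ⟨(x.q, .halt false), x.stk⟩ := by
    simp [Controller.next, controller, hx, act_id]
  rw [bRun_measure P 𝒞 U h1]
  simp only [Fintype.sum_bool, h2, h3, applyReg_one]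
  have h4 := P.bRun_halt_false 𝒞 U x.q x.stk ((t + 1) * (c + 1))
    (projectBit (Fin.last c) true (project c (onBlock (exchangeBlock U t) ψ))) (k + 2 + m)
  rw [bRun] at h4
  rw [h4, zero_add]
  have h5 := projectBit_project c (Nat.lt_succ_self c) (onBlock (exchangeBlock U t) ψ)
  have h6 : (⟨c, Nat.lt_succ_self c⟩ : Fin (c + 1)) = Fin.last c := rfl
  rw [h6] at h5
  rw [h5]
  refine (bRun_toss_enc (τ := xorPerm b) (fun i k hi => by simp [instr, hx, hi]) h k
    (by unfold cost at hk ⊢; omega) _).trans ?_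
  exact Finset.expect_congr rfl fun key _ => by rw [encode_project]

theorem Runs.final {s : ℕ} {x : P.Conf} {t : ℕ} {k' : Fin m → Bool}
    (hx : P.cmd x.q = .final k') :
    P.Runs 𝒞 U (s + 1) x t fun ψ => acceptNorm (𝒞.decode k' (onBlock (exchangeBlock U t) ψ)) := by
  intro k hk ψ
  rw [Nat.add_mul, one_mul] at hk
  obtain ⟨k, rfl⟩ : ∃ l, k = (l + 1) + c + 1 + (c + 1) :=
    ⟨k - (2 * c + 3), by unfold cost at hk; omega⟩
  rw [bRun_dec (liftBlock (star (𝒞.unitary k'))) (by simp [hx]) (by simp [hx])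
    (fun i hi => by simp [instr, hx, hi])]
  have h1 : P.instr 𝒞 (x.q, .meas ⟨c, by omega⟩) = .measure (Fin.last c) := by simp [instr, hx]
  have h2 : ∀ v, (P.controller c).next ⟨(x.q, .meas ⟨c, by omega⟩), x.stk⟩ v =
      ⟨(x.q, .halt v), x.stk⟩ := by
    intro v
    simp [Controller.next, controller, hx, act_id]
  rw [bRun_measure P 𝒞 U h1]
  simp only [Fintype.sum_bool, h2]
  have h3 := fun ψ => P.bRun_halt_false 𝒞 U x.q x.stk ((t + 1) * (c + 1)) ψ k
  have h4 := fun ψ => P.bRun_halt_true 𝒞 U x.q x.stk ((t + 1) * (c + 1)) ψ k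
  simp only [bRun] at h3 h4
  rw [h3, h4, add_zero]
  refine Finset.sum_congr rfl fun w _ => ?_
  rw [sum_clearBlock]
  · rw [Fintype.sum_bool, add_eq_left.2]
    · refine Finset.sum_congr rfl fun z _ => ?_
      have e : (clearBlock true : Fin (c + 1) → Bool) (Fin.last c) = true := by simp [clearBlock]
      rw [projectBit, if_pos e, project, if_pos fun l hl => clearBlock_of_lt _ l hl,
        applyReg_liftBlock, 𝒞.decode_apply]
      congr 2
      refine Finset.sum_congr rfl fun h _ => ?_
      rw [← 𝒞.unitary_apply]
      rfl
    · refine Finset.sum_eq_zero fun z _ => ?_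
      have e : ¬ (clearBlock false : Fin (c + 1) → Bool) (Fin.last c) = true := by
        simp [clearBlock]
      rw [projectBit, if_neg e]
      simp
  · rintro h ⟨l, hl, hl'⟩
    refine Finset.sum_eq_zero fun z _ => ?_
    have : project c (applyReg (liftBlock (star (𝒞.unitary k')))
        (onBlock (exchangeBlock U t) ψ)) w h z = 0 := by
      rw [project, if_neg]
      exact fun H => hl' (H l hl)
    simp [projectBit, this]

end Run

end Program

end
end QPIP

open Computability
namespace QPIP
noncomputable section

open ComplexConjugate BigOperators

/-! ### The program of the verifier -/

instance (G : GateSet) : Fintype (Token G) :=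
  Fintype.ofEquiv (G.Op ⊕ Bool)
    { toFun := fun s => s.elim .op fun b => if b then .tick else .sep
      invFun := fun | .op g => .inl g | .tick => .inr true | .sep => .inr false
      left_inv := by rintro (g | b) <;> [rfl; cases b <;> rfl]
      right_inv := by rintro (g | _ | _) <;> rfl }

/-- The states of the program of the verifier. For every gate he fetches the qubits that it acts on
in passes through the whole memory, applies the gate, and puts them back in the
same way (the flag tells which of the two he does). -/
inductive ProgState (G : GateSet) (a m : ℕ) where
  | init
  | prep (b : Bool)
  | turn (r : Option (G.Op × Bool × Fin (a + 1)))
  | main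
  | look (g : G.Op) (b : Bool) (i : Fin (a + 1))
  | rest (g : G.Op) (b : Bool) (i : Fin (a + 1))
  | cyc (k : Fin m → Bool) (o : Option (Fin (a + 1))) (l : Bool) (g : G.Op) (b : Bool)
      (i : Fin (a + 1))
  | gate (g : G.Op)
  | rewind (g : G.Op)
  | final (k : Fin m → Bool)
  deriving Fintype

/-- The stacks of the verifier: the unread part of the input, the part of the circuit that has been
read, the keys of the blocks that will be fetched in the current pass, and
the keys of those that have been returned. -/
inductive ProgStk where
  | inp
  | rev
  | kin
  | kout
  deriving DecidableEq

instance : Fintype ProgStk :=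
  ⟨{.inp, .rev, .kin, .kout}, fun k => by cases k <;> simp⟩

/-- The exchange of a work qubit and the opened qubit. -/
def swapPerm {a : ℕ} (i : Fin a) : Equiv.Perm ((Fin a → Bool) × Bool) where
  toFun p := (Function.update p.1 i p.2, p.1 i)
  invFun p := (Function.update p.1 i p.2, p.1 i)
  left_inv p := by simp
  right_inv p := by simp

def opPerm {a : ℕ} : Option (Fin a) → Equiv.Perm ((Fin a → Bool) × Bool)
  | none => 1
  | some i => swapPerm i

variable {G : GateSet} {a c m n : ℕ} {δ : ℝ} {M : Type} [Fintype M]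

/-- A gate as an operator on the work qubits. -/
def workUnitary (hG : ∀ g, G.arity g ≤ a) (g : G.Op) : Unitary (Fin (a + 1) → Bool) :=
  ⟨embed (Fin.castLE ((hG g).trans (Nat.le_succ a))) (G.mat g).1,
    embed_mem (Fin.castLE_injective _) _⟩

/-- The effect of a transition on the stacks. -/
def actions {W : Type} (i r ki ko : Bool × List W) : ProgStk → Bool × List W
  | .inp => i
  | .rev => r
  | .kin => ki
  | .kout => ko

abbrev keep {W : Type} : Bool × List W := (false, [])
abbrev pop {W : Type} : Bool × List W := (true, [])
abbrev push {W : Type} (w : W) : Bool × List W := (false, [w])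

/-- Wires are written in unary, so the input tape itself counts the blocks of a pass: a tick lets
one block go by, a separator marks the block to be exchanged with a work qubit, and `rest` completes
the pass. Keys move from `kin` to `kout` as their blocks are re-encoded, and `turn` brings them back
for the next pass. The wires that have been read are kept on `rev`, so that `rewind` can present
them again for putting the qubits back. -/
def verifierProgram (hG : ∀ g, G.arity g ≤ a) (m : ℕ) : Program (Symbol G) (a + 1) m where
  Q := ProgState G a m
  K := ProgStk
  W := Symbol G ⊕ (Fin m → Bool)
  start := .init
  inK := .inp
  emb := .inl
  cmd
    | .prep b => .prep b
    | .cyc k o _ _ _ _ => .cycle k (opPerm o)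
    | .gate g => .work (workUnitary hG g)
    | .final k => .final k
    | _ => .nop
  tr q v key := match q with
    | .init => match v .inp with
      | some (.inl (.inl b)) => (.prep b, actions pop keep keep keep)
      | _ => (.turn none, actions keep keep keep keep)
    | .prep _ => (.init, actions keep keep keep (push (.inr key)))
    | .turn r => match v .kout with
      | some w => (.turn r, actions keep keep (push w) pop)
      | none => match r with
        | none => (.main, actions keep keep keep keep)
        | some (g, b, i) => (.look g b i, actions keep keep keep keep)
    | .main => match v .inp with
      | some (.inl (.inr (.op g))) => (.look g false 0, actions pop (push (.inl (.inr (.op g))))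
          keep keep)
      | _ => match v .kin with
        | some (.inr k) => (.final k, actions keep keep keep keep)
        | _ => (.main, actions keep keep keep keep)
    | .look g b i => match v .inp, v .kin with
      | some (.inl (.inr .tick)), some (.inr k) => (.cyc k none true g b i,
          actions pop (push (.inl (.inr .tick))) pop keep)
      -- A valid gate has at most `a` wires, so `i + 1` does not wrap around in `Fin (a + 1)`.
      | some (.inl (.inr .sep)), some (.inr k) => (.cyc k (some i) false g b (i + 1),
          actions pop (push (.inl (.inr .sep))) pop keep)
      -- The next gate or the end of the input has been reached. The qubits have been fetched if the
      -- flag is unset, and put back if it is set.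
      | _, _ => (if b then .main else .gate g, actions keep keep keep keep)
    | .rest g b i => match v .kin with
      | some (.inr k) => (.cyc k none false g b i, actions keep keep pop keep)
      | _ => (.turn (some (g, b, i)), actions keep keep keep keep)
    | .cyc _ _ l g b i => (if l then .look g b i else .rest g b i,
        actions keep keep keep (push (.inr key)))
    | .gate g => (.rewind g, actions keep keep keep keep)
    | .rewind g => match v .rev with
      | some (.inl (.inr .tick)) => (.rewind g, actions (push (.inl (.inr .tick))) pop keep keep)
      | some (.inl (.inr .sep)) => (.rewind g, actions (push (.inl (.inr .sep))) pop keep keep)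
      | _ => (.look g true 0, actions keep keep keep keep)
    | .final k => (.final k, actions keep keep keep keep)

section Sim

variable (hG : ∀ g, G.arity g ≤ a)

def progConf (q : ProgState G a m) (i r : List (Symbol G)) (ki ko : List (Fin m → Bool)) :
    (verifierProgram hG m).Conf :=
  ⟨q, fun
    | .inp => i.map .inl
    | .rev => r.map .inl
    | .kin => ki.map .inr
    | .kout => ko.map .inr⟩

variable {hG}

theorem next_progConf {q q' : ProgState G a m} {i i' r r' : List (Symbol G)}
    {ki ki' ko ko' : List (Fin m → Bool)} {key : Fin m → Bool}
    {ai ar aki ako : Bool × List (Symbol G ⊕ (Fin m → Bool))}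
    (h : (verifierProgram hG m).tr q
      (fun k => ((progConf hG q i r ki ko).stk k).head?) key = (q', actions ai ar aki ako))
    (hi : StackMachine.act ai (i.map .inl) = i'.map .inl)
    (hr : StackMachine.act ar (r.map .inl) = r'.map .inl)
    (hki : StackMachine.act aki (ki.map .inr) = ki'.map .inr)
    (hko : StackMachine.act ako (ko.map .inr) = ko'.map .inr) :
    (progConf hG q i r ki ko).next key = progConf hG q' i' r' ki' ko' := by
  have h' : (verifierProgram hG m).tr (progConf hG q i r ki ko).q
      (fun k => ((progConf hG q i r ki ko).stk k).head?) key = (q', actions ai ar aki ako) := h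
  unfold Program.Conf.next
  rw [h']
  refine Program.Conf.ext rfl (funext fun k => ?_)
  cases k
  · exact hi
  · exact hr
  · exact hki
  · exact hko

variable {𝒞 : Code c m δ} {U : ℕ → Matrix (Bool × M) (Bool × M) ℂ}

variable (hG 𝒞 U n) in
/-- In the state `q`, after `j` blocks of the current pass, the program will execute the jobs `js`. -/
def Sim (s : ℕ) (q : ProgState G a m) (i r : List (Token G)) (j : ℕ)
    (js : List (Job (a + 1) (n + 1))) : Prop :=
  ∀ (κ : Fin (n + 1) → Fin m → Bool) (t : ℕ), (verifierProgram hG m).Runs 𝒞 U s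
    (progConf hG q (i.map .inr) (r.map .inr) ((List.ofFn κ).drop j) ((List.ofFn κ).take j).reverse) t
    (script 𝒞 (Program.exchangeBlock U) 0 js κ t)

/-- The stack `kout` has the newest key on top; moving it over puts the key of block `0` on top of
`kin`. -/
theorem runs_turn {s : ℕ} {ret : Option (G.Op × Bool × Fin (a + 1))} {q : ProgState G a m}
    (hq : q = match ret with | none => .main | some (g, b, i) => .look g b i)
    {i r : List (Symbol G)} (ko ki : List (Fin m → Bool)) {t : ℕ}
    {f : State (a + 1) (c + 1) M → ℝ}
    (h : (verifierProgram hG m).Runs 𝒞 U s (progConf hG q i r (ko.reverse ++ ki) []) t f) :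
    (verifierProgram hG m).Runs 𝒞 U (s + (ko.length + 1)) (progConf hG (.turn ret) i r ki ko) t f := by
  induction ko generalizing ki with
  | nil =>
    refine Program.Runs.nop rfl ?_
    rw [next_progConf (q' := q) (ai := keep) (ar := keep) (aki := keep) (ako := keep) ?_
      rfl rfl rfl rfl]
    · exact h
    · subst hq
      rcases ret with _ | ⟨g, b, i⟩ <;> rfl
  | cons k ko ih =>
    refine Program.Runs.nop rfl ?_
    rw [next_progConf (q' := .turn ret) (ai := keep) (ar := keep) (aki := push (.inr k))
      (ako := pop) (i' := i) (r' := r) (ki' := k :: ki) (ko' := ko) rfl rfl rfl rfl rfl]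
    exact ih (k :: ki) (by simpa using h)

theorem drop_ofFn {X : Type} (κ : Fin (n + 1) → X) {j : ℕ} (hj : j < n + 1) :
    (List.ofFn κ).drop j = κ ⟨j, hj⟩ :: (List.ofFn κ).drop (j + 1) := by
  rw [List.drop_eq_getElem_cons (by simpa using hj), List.getElem_ofFn]

theorem drop_ofFn_update {X : Type} (κ : Fin (n + 1) → X) {j : ℕ} (hj : j < n + 1) (x : X) :
    (List.ofFn (Function.update κ ⟨j, hj⟩ x)).drop (j + 1) = (List.ofFn κ).drop (j + 1) := by
  refine List.ext_getElem (by simp) fun l h1 h2 => ?_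
  simp only [List.getElem_drop, List.getElem_ofFn]
  rw [Function.update_of_ne]
  intro h
  have := congrArg Fin.val h
  simp at this
  omega

theorem take_ofFn_update {X : Type} (κ : Fin (n + 1) → X) {j : ℕ} (hj : j < n + 1) (x : X) :
    (List.ofFn (Function.update κ ⟨j, hj⟩ x)).take (j + 1) = (List.ofFn κ).take j ++ [x] := by
  rw [List.take_add_one]
  congr 1
  · refine List.ext_getElem (by simp) fun l h1 h2 => ?_
    simp only [List.getElem_take, List.getElem_ofFn]
    rw [Function.update_of_ne]
    intro h
    have := congrArg Fin.val h
    simp at this h1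
    omega
  · rw [List.getElem?_eq_getElem (by simpa using hj), List.getElem_ofFn]
    simp

theorem runs_cyc {s : ℕ} {o : Option (Fin (a + 1))} {l : Bool} {g : G.Op} {b : Bool}
    {i : Fin (a + 1)} {inp r : List (Token G)} {j : ℕ} (hj : j < n + 1)
    {js : List (Job (a + 1) (n + 1))}
    (h : Sim n hG 𝒞 U s (if l then .look g b i else .rest g b i) inp r (j + 1) js)
    (κ : Fin (n + 1) → Fin m → Bool) (t : ℕ) :
    (verifierProgram hG m).Runs 𝒞 U (s + 1) (progConf hG (.cyc (κ ⟨j, hj⟩) o l g b i)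
      (inp.map .inr) (r.map .inr) ((List.ofFn κ).drop (j + 1)) ((List.ofFn κ).take j).reverse) t
      (script 𝒞 (Program.exchangeBlock U) 0 (.cycle ⟨j, hj⟩ (opPerm o) :: js) κ t) := by
  refine Program.Runs.cycle (k' := κ ⟨j, hj⟩) (σ := opPerm o)
    (f := fun key => script 𝒞 (Program.exchangeBlock U) 0 js (Function.update κ ⟨j, hj⟩ key) (t + 1))
    rfl fun key => ?_
  have := h (Function.update κ ⟨j, hj⟩ key) (t + 1)
  rw [drop_ofFn_update, take_ofFn_update, List.reverse_append] at this
  rw [next_progConf (q' := if l then .look g b i else .rest g b i) (ai := keep) (ar := keep)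
    (aki := keep) (ako := push (.inr key)) (i' := inp.map .inr) (r' := r.map .inr)
    (ki' := (List.ofFn κ).drop (j + 1)) (ko' := key :: ((List.ofFn κ).take j).reverse)
    rfl rfl rfl rfl rfl]
  exact this

theorem Sim.look_tick {s : ℕ} {g : G.Op} {b : Bool} {i : Fin (a + 1)} {inp r : List (Token G)}
    {j : ℕ} (hj : j < n + 1) {js : List (Job (a + 1) (n + 1))}
    (h : Sim n hG 𝒞 U s (.look g b i) inp (.tick :: r) (j + 1) js) :
    Sim n hG 𝒞 U (s + 2) (.look g b i) (.tick :: inp) r j (.cycle ⟨j, hj⟩ (opPerm none) :: js) := by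
  intro κ t
  refine Program.Runs.nop rfl ?_
  rw [drop_ofFn κ hj, next_progConf (q' := .cyc (κ ⟨j, hj⟩) none true g b i) (ai := pop)
    (ar := push (.inl (.inr .tick))) (aki := pop) (ako := keep) (i' := inp.map .inr)
    (r' := (Token.tick :: r).map .inr) (ki' := (List.ofFn κ).drop (j + 1))
    (ko' := ((List.ofFn κ).take j).reverse) rfl rfl rfl rfl rfl]
  exact runs_cyc hj h κ t

theorem Sim.look_sep {s : ℕ} {g : G.Op} {b : Bool} {i : Fin (a + 1)} {inp r : List (Token G)}
    {j : ℕ} (hj : j < n + 1) {js : List (Job (a + 1) (n + 1))}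
    (h : Sim n hG 𝒞 U s (.rest g b (i + 1)) inp (.sep :: r) (j + 1) js) :
    Sim n hG 𝒞 U (s + 2) (.look g b i) (.sep :: inp) r j
      (.cycle ⟨j, hj⟩ (opPerm (some i)) :: js) := by
  intro κ t
  refine Program.Runs.nop rfl ?_
  rw [drop_ofFn κ hj, next_progConf (q' := .cyc (κ ⟨j, hj⟩) (some i) false g b (i + 1)) (ai := pop)
    (ar := push (.inl (.inr .sep))) (aki := pop) (ako := keep) (i' := inp.map .inr)
    (r' := (Token.sep :: r).map .inr) (ki' := (List.ofFn κ).drop (j + 1))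
    (ko' := ((List.ofFn κ).take j).reverse) rfl rfl rfl rfl rfl]
  exact runs_cyc hj h κ t

theorem Sim.rest {s : ℕ} {g : G.Op} {b : Bool} {i : Fin (a + 1)} {inp r : List (Token G)}
    {j : ℕ} (hj : j < n + 1) {js : List (Job (a + 1) (n + 1))}
    (h : Sim n hG 𝒞 U s (.rest g b i) inp r (j + 1) js) :
    Sim n hG 𝒞 U (s + 2) (.rest g b i) inp r j (.cycle ⟨j, hj⟩ (opPerm none) :: js) := by
  intro κ t
  refine Program.Runs.nop rfl ?_
  rw [drop_ofFn κ hj, next_progConf (q' := .cyc (κ ⟨j, hj⟩) none false g b i) (ai := keep)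
    (ar := keep) (aki := pop) (ako := keep) (i' := inp.map .inr)
    (r' := r.map .inr) (ki' := (List.ofFn κ).drop (j + 1))
    (ko' := ((List.ofFn κ).take j).reverse) rfl rfl rfl rfl rfl]
  exact runs_cyc hj h κ t

theorem Sim.rest_end {s : ℕ} {g : G.Op} {b : Bool} {i : Fin (a + 1)} {inp r : List (Token G)}
    {js : List (Job (a + 1) (n + 1))} (h : Sim n hG 𝒞 U s (.look g b i) inp r 0 js) :
    Sim n hG 𝒞 U (s + (n + 3)) (.rest g b i) inp r (n + 1) js := by
  intro κ t
  refine Program.Runs.nop (s := s + (n + 2)) rfl ?_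
  have e1 : (List.ofFn κ).drop (n + 1) = [] := List.drop_eq_nil_of_le (by simp)
  have e2 : (List.ofFn κ).take (n + 1) = List.ofFn κ := List.take_of_length_le (by simp)
  rw [e1, e2, next_progConf (q' := .turn (some (g, b, i))) (ai := keep) (ar := keep) (aki := keep)
    (ako := keep) (i' := inp.map .inr) (r' := r.map .inr) (ki' := [])
    (ko' := (List.ofFn κ).reverse) rfl rfl rfl rfl rfl]
  have := runs_turn (hG := hG) (𝒞 := 𝒞) (U := U) (s := s) (ret := some (g, b, i)) rfl
    (i := inp.map .inr) (r := r.map .inr)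
    (List.ofFn κ).reverse [] (t := t) (f := script 𝒞 (Program.exchangeBlock U) 0 js κ t)
    (by simpa using h κ t)
  rw [List.length_reverse, List.length_ofFn] at this
  exact this

/-- The jobs from position `j` on in a pass that exchanges qubit `w` with the work qubit `i`. -/
def wireJobs (n w : ℕ) (i : Fin (a + 1)) (j : ℕ) : List (Job (a + 1) (n + 1)) :=
  ((List.finRange (n + 1)).drop j).map fun l =>
    .cycle l (opPerm (if l.val = w then some i else none))

theorem wireJobs_of_lt {w : ℕ} {i : Fin (a + 1)} {j : ℕ} (hj : j < n + 1) :
    wireJobs n w i j = .cycle ⟨j, hj⟩ (opPerm (if j = w then some i else none)) ::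
      wireJobs n w i (j + 1) := by
  rw [wireJobs, List.drop_eq_getElem_cons (by simpa using hj), List.map_cons]
  simp [wireJobs]

theorem Sim.rest_pass {s : ℕ} {g : G.Op} {b : Bool} {i i' : Fin (a + 1)} {inp r : List (Token G)}
    {js : List (Job (a + 1) (n + 1))} (h : Sim n hG 𝒞 U s (.look g b i) inp r 0 js) {w : ℕ}
    (d j : ℕ) (hd : j + d = n + 1) (hw : w < j) :
    Sim n hG 𝒞 U (s + (n + 3) + 2 * d) (.rest g b i) inp r j (wireJobs n w i' j ++ js) := by
  induction d generalizing j with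
  | zero =>
    obtain rfl : j = n + 1 := hd
    have : wireJobs n w i' (n + 1) = [] := by
      rw [wireJobs, List.drop_eq_nil_of_le (by simp), List.map_nil]
    rw [this]
    exact h.rest_end
  | succ d ih =>
    rw [wireJobs_of_lt (by omega), if_neg (by omega)]
    exact (ih (j + 1) (by omega) (by omega)).rest (by omega)

/-- The invariant is `j + d = w`, with `j` blocks passed and `d` ticks unread, so that the separator
is met exactly at block `w`. -/
theorem Sim.look_pass {s : ℕ} {g : G.Op} {b : Bool} {i : Fin (a + 1)} {inp r : List (Token G)}
    {js : List (Job (a + 1) (n + 1))} {w : ℕ}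
    (h : Sim n hG 𝒞 U s (.look g b (i + 1)) inp (.sep :: (List.replicate w .tick ++ r)) 0 js)
    (hw : w < n + 1) (d j : ℕ) (hd : j + d = w) :
    Sim n hG 𝒞 U (s + (n + 3) + 2 * (n + 1 - j)) (.look g b i)
      (List.replicate d .tick ++ .sep :: inp) (List.replicate j .tick ++ r) j
      (wireJobs n w i j ++ js) := by
  induction d generalizing j with
  | zero =>
    obtain rfl : j = w := hd
    rw [wireJobs_of_lt hw, if_pos rfl]
    have := (h.rest_pass (i' := i) (n - j) (j + 1) (by omega) (Nat.lt_succ_self j)).look_sep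
      (r := List.replicate j .tick ++ r) hw
    rwa [show s + (n + 3) + 2 * (n - j) + 2 = s + (n + 3) + 2 * (n + 1 - j) by omega] at this
  | succ d ih =>
    rw [wireJobs_of_lt (by omega), if_neg (by omega), List.replicate_succ]
    have := (ih (j + 1) (by omega)).look_tick (r := List.replicate j .tick ++ r) (by omega)
    rwa [show s + (n + 3) + 2 * (n + 1 - (j + 1)) + 2 = s + (n + 3) + 2 * (n + 1 - j) by omega]
      at this

/-- The jobs that exchange the qubits `ws` with the work qubits from `i` on. -/
def fetchJobs (n : ℕ) : List ℕ → Fin (a + 1) → List (Job (a + 1) (n + 1))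
  | [], _ => []
  | w :: ws, i => wireJobs n w i 0 ++ fetchJobs n ws (i + 1)

/-- The list of qubits of a gate as a word. -/
def wireTokens (ws : List ℕ) : List (Token G) :=
  ws.flatMap fun w => List.replicate w Token.tick ++ [Token.sep]

/-- A pass costs `3 * n + 5` commands: two for each of the `n + 1` blocks and `n + 3` for restoring
the stack of keys. The continuation is assumed for all work indices because the one reached after
the last wire is irrelevant. -/
theorem Sim.fetch {s : ℕ} {g : G.Op} {b : Bool} {inp : List (Token G)}
    {js : List (Job (a + 1) (n + 1))} (ws : List ℕ) (hw : ∀ w ∈ ws, w < n + 1) (r : List (Token G))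
    (i : Fin (a + 1))
    (h : ∀ i, Sim n hG 𝒞 U s (.look g b i) inp ((wireTokens ws).reverse ++ r) 0 js) :
    Sim n hG 𝒞 U (s + ws.length * (3 * n + 5)) (.look g b i) (wireTokens ws ++ inp) r 0
      (fetchJobs n ws i ++ js) := by
  induction ws generalizing r i with
  | nil => simpa [wireTokens, fetchJobs] using h i
  | cons w ws ih =>
    have e : ∀ l : List (Token G), wireTokens (w :: ws) ++ l =
        List.replicate w .tick ++ .sep :: (wireTokens ws ++ l) := by
      intro l
      simp [wireTokens]
    have h1 := ih (fun v hv => hw v (List.mem_cons_of_mem _ hv))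
      (.sep :: (List.replicate w .tick ++ r)) (i + 1) (by
        intro i
        have := h i
        simpa [wireTokens] using this)
    have h2 := h1.look_pass (hw w List.mem_cons_self) w 0 (by omega)
    rw [e, fetchJobs, List.append_assoc, List.length_cons]
    rwa [show s + ws.length * (3 * n + 5) + (n + 3) + 2 * (n + 1 - 0) =
      s + (ws.length + 1) * (3 * n + 5) by rw [Nat.sub_zero]; ring] at h2

theorem Sim.look_end {s : ℕ} {g : G.Op} {b : Bool} {i : Fin (a + 1)} {inp r : List (Token G)}
    (hinp : inp = [] ∨ ∃ g' l, inp = .op g' :: l) {js : List (Job (a + 1) (n + 1))}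
    (h : Sim n hG 𝒞 U s (if b then .main else .gate g) inp r 0 js) :
    Sim n hG 𝒞 U (s + 1) (.look g b i) inp r 0 js := by
  intro κ t
  refine Program.Runs.nop rfl ?_
  rw [next_progConf (q' := if b then .main else .gate g) (ai := keep) (ar := keep) (aki := keep)
    (ako := keep) ?_ rfl rfl rfl rfl]
  · exact h κ t
  · rcases hinp with rfl | ⟨g', l, rfl⟩ <;> rfl

theorem Sim.rewind {s : ℕ} {g : G.Op} {js : List (Job (a + 1) (n + 1))} {r : List (Token G)}
    (l : List (Token G)) (hl : ∀ x ∈ l, x = .tick ∨ x = .sep) (inp : List (Token G))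
    (h : Sim n hG 𝒞 U s (.look g true 0) (l.reverse ++ inp) (.op g :: r) 0 js) :
    Sim n hG 𝒞 U (s + (l.length + 1)) (.rewind g) inp (l ++ .op g :: r) 0 js := by
  induction l generalizing inp with
  | nil =>
    intro κ t
    refine Program.Runs.nop rfl ?_
    rw [next_progConf (q' := .look g true 0) (ai := keep) (ar := keep) (aki := keep)
      (ako := keep) rfl rfl rfl rfl rfl]
    exact h κ t
  | cons x l ih =>
    intro κ t
    refine Program.Runs.nop rfl ?_
    have h1 := ih (fun y hy => hl y (List.mem_cons_of_mem _ hy)) (x :: inp) (by simpa using h)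
    rw [next_progConf (q' := .rewind g) (ai := push (.inl (.inr x))) (ar := pop) (aki := keep)
      (ako := keep) (i' := (x :: inp).map .inr) (r' := (l ++ .op g :: r).map .inr) ?_
      rfl rfl rfl rfl]
    · exact h1 κ t
    · rcases hl x List.mem_cons_self with rfl | rfl <;> rfl

/-- The jobs for a gate. -/
def gateJobs (hG : ∀ g, G.arity g ≤ a) (n : ℕ) (g : Gate G) : List (Job (a + 1) (n + 1)) :=
  fetchJobs n g.wires 0 ++ .work (workUnitary hG g.op) :: fetchJobs n g.wires 0

/-- Fetching and putting back are the same jobs, as exchanges are involutions. The continuation has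
to work for every `rev` stack, because the tokens of finished gates stay there. -/
theorem Sim.gate {s : ℕ} (g : Gate G) (hw : ∀ w ∈ g.wires, w < n + 1) {inp r : List (Token G)}
    (hinp : inp = [] ∨ ∃ g' l, inp = .op g' :: l) {js : List (Job (a + 1) (n + 1))}
    (h : ∀ r, Sim n hG 𝒞 U s .main inp r 0 js) :
    Sim n hG 𝒞 U (s + (2 * g.wires.length * (3 * n + 5) + (wireTokens (G := G) g.wires).length + 5))
      .main (g.encode ++ inp) r 0 (gateJobs hG n g ++ js) := by
  -- The execution is assembled backwards, from the end of the second reading of the wires to the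
  -- first.
  have h1 : ∀ i r, Sim n hG 𝒞 U (s + 1) (.look g.op true i) inp r 0 js :=
    fun i r => (h r).look_end (b := true) hinp
  have h2 := Sim.fetch g.wires hw (.op g.op :: r) 0 fun i => h1 i _
  have h3 := Sim.rewind (r := r) (wireTokens g.wires).reverse (by
    intro x hx
    rw [List.mem_reverse, wireTokens, List.mem_flatMap] at hx
    obtain ⟨w, _, hx⟩ := hx
    rcases List.mem_append.1 hx with hx | hx
    · exact Or.inl (List.eq_of_mem_replicate hx)
    · exact Or.inr (List.mem_singleton.1 hx)) inp (by rw [List.reverse_reverse]; exact h2)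
  have h4 : Sim n hG 𝒞 U (s + 1 + g.wires.length * (3 * n + 5) +
      ((wireTokens (G := G) g.wires).reverse.length + 1) + 1) (.gate g.op) inp ((wireTokens g.wires).reverse ++ .op g.op :: r) 0
      (.work (workUnitary hG g.op) :: (fetchJobs n g.wires 0 ++ js)) := by
    intro κ t
    refine Program.Runs.work (V := workUnitary hG g.op)
      (f := script 𝒞 (Program.exchangeBlock U) 0 (fetchJobs n g.wires 0 ++ js) κ t) rfl ?_
    rw [next_progConf (q' := .rewind g.op) (ai := keep) (ar := keep) (aki := keep)
      (ako := keep) rfl rfl rfl rfl rfl]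
    exact h3 κ t
  have h5 := Sim.fetch g.wires hw (.op g.op :: r) 0 fun i => h4.look_end (i := i) (b := false) hinp
  intro κ t
  have e1 : gateJobs hG n g ++ js = fetchJobs n g.wires 0 ++
      (.work (workUnitary hG g.op) :: (fetchJobs n g.wires 0 ++ js)) := by
    simp [gateJobs]
  rw [e1]
  refine Program.Runs.mono (Program.Runs.nop rfl ?_) (s := s + 1 + g.wires.length * (3 * n + 5) +
    ((wireTokens (G := G) g.wires).reverse.length + 1) + 1 + 1 + g.wires.length * (3 * n + 5) + 1) ?_
  · rw [next_progConf (q' := .look g.op false 0) (ai := pop) (ar := push (.inl (.inr (.op g.op))))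
      (aki := keep) (ako := keep) (i' := (wireTokens g.wires ++ inp).map .inr)
      (r' := (.op g.op :: r).map .inr) rfl rfl rfl rfl rfl]
    exact h5 κ t
  · rw [List.length_reverse]
    apply le_of_eq
    ring

theorem Sim.main_end {r : List (Token G)} : Sim n hG 𝒞 U 2 .main [] r 0 [] := by
  intro κ t
  refine Program.Runs.nop (s := 1) rfl ?_
  rw [drop_ofFn κ (Nat.succ_pos n), next_progConf (q' := .final (κ 0)) (ai := keep) (ar := keep)
    (aki := keep) (ako := keep) (i' := []) (r' := r.map .inr) (ki' := List.ofFn κ) (ko' := [])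
    rfl rfl rfl ?_ rfl]
  · exact Program.Runs.final (s := 0) rfl
  · have := drop_ofFn κ (Nat.succ_pos n)
    rw [List.drop_zero] at this
    rw [this]
    rfl

theorem Sim.circuit (gs : List (Gate G)) (hw : ∀ g ∈ gs, ∀ w ∈ g.wires, w < n + 1)
    (r : List (Token G)) :
    Sim n hG 𝒞 U (2 + (gs.flatMap Gate.encode).length * (6 * n + 15)) .main
      (gs.flatMap Gate.encode) r 0 (gs.flatMap (gateJobs hG n)) := by
  induction gs generalizing r with
  | nil =>
    have h : Sim n hG 𝒞 U 2 .main [] r 0 [] := Sim.main_end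
    simpa using h
  | cons g gs ih =>
    have hinp : gs.flatMap Gate.encode = [] ∨
        ∃ g' l, gs.flatMap Gate.encode = Token.op (G := G) g' :: l := by
      rcases gs with _ | ⟨g', gs⟩
      · exact Or.inl rfl
      · exact Or.inr ⟨g'.op, _, rfl⟩
    have h := Sim.gate g (hw g List.mem_cons_self) (r := r) hinp
      (ih fun g' hg' => hw g' (List.mem_cons_of_mem _ hg'))
    rw [List.flatMap_cons, List.flatMap_cons]
    intro κ t
    refine (h κ t).mono ?_
    have h1 : g.wires.length ≤ (wireTokens (G := G) g.wires).length := by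
      rw [wireTokens, List.length_flatMap]
      induction g.wires with
      | nil => simp
      | cons w ws ih => simp at ih ⊢; omega
    have h2 : g.encode.length = (wireTokens (G := G) g.wires).length + 1 := rfl
    rw [List.length_append, h2]
    have h3 := Nat.mul_le_mul_right (3 * n + 5) h1
    nlinarith

variable (hG 𝒞 U n) in
/-- The acceptance probability after the preparation of `s` qubits. -/
def afterPrep (js : List (Job (a + 1) (n + 1))) (s : ℕ) (κ : Fin s → Fin m → Bool)
    (ψ : State (a + 1) (c + 1) M) : ℝ :=
  -- During the preparation the number of keys grows, so the continuation is needed for every `s`;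
  -- only the value `n + 1` occurs at the end.
  if h : s = n + 1 then
    script 𝒞 (Program.exchangeBlock U) 0 js (fun i => κ (Fin.cast h.symm i)) (n + 1) ψ
  else 0

theorem runs_init {N : ℕ} {js : List (Job (a + 1) (n + 1))} {toks : List (Token G)}
    (h : Sim n hG 𝒞 U N .main toks [] 0 js) (bs : List Bool) (s : ℕ) (hs : s + bs.length = n + 1)
    (κ : Fin s → Fin m → Bool) :
    (verifierProgram hG m).Runs 𝒞 U (N + (n + 3) + 2 * bs.length)
      (progConf hG .init (bs.map Sum.inl ++ toks.map Sum.inr) [] [] (List.ofFn κ).reverse) s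
      (prepare 𝒞 (Program.exchangeBlock U) (afterPrep n 𝒞 U js) bs s κ) := by
  induction bs generalizing s with
  | nil =>
    obtain rfl : s = n + 1 := hs
    refine Program.Runs.nop (s := N + (n + 2)) rfl ?_
    rw [List.map_nil, List.nil_append, next_progConf (i := toks.map .inr) (r := []) (ki := [])
      (q' := .turn none) (ai := keep) (ar := keep) (aki := keep)
      (ako := keep) (i' := toks.map .inr) (r' := []) (ki' := []) (ko' := (List.ofFn κ).reverse)
      ?_ rfl rfl rfl rfl]
    · have := runs_turn (hG := hG) (𝒞 := 𝒞) (U := U) (s := N) (ret := none) rfl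
        (i := toks.map .inr) (r := []) (List.ofFn κ).reverse [] (t := n + 1)
        (f := script 𝒞 (Program.exchangeBlock U) 0 js κ (n + 1)) (by simpa using h κ (n + 1))
      rw [List.length_reverse, List.length_ofFn] at this
      have e : afterPrep n 𝒞 U js (n + 1) κ = script 𝒞 (Program.exchangeBlock U) 0 js κ (n + 1) := by
        funext ψ
        rw [afterPrep, dif_pos rfl]
        rfl
      simp only [prepare, e]
      exact this
    · cases toks <;> rfl
  | cons b bs ih =>
    refine Program.Runs.nop (s := N + (n + 3) + 2 * bs.length + 1) rfl ?_
    rw [next_progConf (q' := .prep b) (ai := pop) (ar := keep) (aki := keep)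
      (ako := keep) (i' := bs.map Sum.inl ++ toks.map Sum.inr) (r' := []) (ki' := [])
      (ko' := (List.ofFn κ).reverse) rfl rfl rfl rfl rfl]
    refine Program.Runs.prep (b := b)
      (f := fun key => prepare 𝒞 (Program.exchangeBlock U) (afterPrep n 𝒞 U js) bs (s + 1)
        (Fin.snoc κ key)) rfl fun key => ?_
    have := ih (s + 1) (by rw [← hs, List.length_cons]; ring) (Fin.snoc κ key)
    rw [next_progConf (hG := hG) (q := .prep b) (i := bs.map Sum.inl ++ toks.map Sum.inr) (r := [])
      (ki := []) (ko := (List.ofFn κ).reverse) (q' := .init) (ai := keep) (ar := keep) (aki := keep)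
      (ako := push (.inr key)) (i' := bs.map Sum.inl ++ toks.map Sum.inr) (r' := []) (ki' := [])
      (ko' := key :: (List.ofFn κ).reverse) rfl rfl rfl rfl rfl]
    have e : (List.ofFn (Fin.snoc κ key : Fin (s + 1) → Fin m → Bool)).reverse =
        key :: (List.ofFn κ).reverse := by
      rw [List.ofFn_succ_last, List.reverse_append]
      simp
    rw [e] at this
    exact this

theorem init_encode (I : Instance G) :
    (verifierProgram hG m).init I.encode = progConf hG .init
      ((List.ofFn I.input).map .inl ++ (I.gates.flatMap Gate.encode).map .inr) [] [] [] := by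
  refine Program.Conf.ext rfl (funext fun k => ?_)
  cases k <;> rfl

end Sim

end
end QPIP

open Computability
namespace QPIP
noncomputable section

open ComplexConjugate BigOperators

/-! ### The effect of the jobs for a circuit -/

/-- The string `y` with the bits at the places `e` replaced by `u`. -/
def overwrite {n r : ℕ} (e : Fin r → Fin n) (u : Fin r → Bool) (y : Fin n → Bool) : Fin n → Bool :=
  fun j => if h : ∃ i, e i = j then u h.choose else y j

section Overwrite

variable {n r : ℕ} {e : Fin r → Fin n} (he : Function.Injective e) (u : Fin r → Bool)
  (y : Fin n → Bool)

include he in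
theorem overwrite_apply (i : Fin r) : overwrite e u y (e i) = u i := by
  have h : ∃ i', e i' = e i := ⟨i, rfl⟩
  rw [overwrite, dif_pos h, he h.choose_spec]

theorem overwrite_of_ne {j : Fin n} (h : ∀ i, e i ≠ j) : overwrite e u y j = y j := by
  rw [overwrite, dif_neg]
  rintro ⟨i, hi⟩
  exact h i hi

include he in
theorem sum_embed_mul (U : Matrix (Fin r → Bool) (Fin r → Bool) ℂ) (f : (Fin n → Bool) → ℂ) :
    ∑ x, embed e U y x * f x = ∑ u, U (y ∘ e) u * f (overwrite e u y) := by
  symm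
  refine Finset.sum_of_injOn (fun u => overwrite e u y) ?_ (by simp) ?_ ?_
  · intro u _ u' _ h
    funext i
    rw [← overwrite_apply he u y i, ← overwrite_apply he u' y i]
    exact congrFun h (e i)
  · intro x _ hx
    rw [embed, if_neg, zero_mul]
    intro h
    apply hx
    refine ⟨x ∘ e, by simp, ?_⟩
    funext j
    by_cases hj : ∃ i, e i = j
    · obtain ⟨i, rfl⟩ := hj
      exact overwrite_apply he _ _ i
    · have hj' : ∀ i, e i ≠ j := fun i hi => hj ⟨i, hi⟩
      exact (overwrite_of_ne _ _ hj').trans (h j hj')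
  · intro u _
    have h1 : overwrite e u y ∘ e = u := funext fun i => overwrite_apply he u y i
    rw [embed, if_pos fun j hj => (overwrite_of_ne u y hj).symm, h1]

end Overwrite

variable {G : GateSet} {a n : ℕ}

theorem onData_append (js js' : List (Job a n)) (χ : Data n a) :
    onData (js ++ js') χ = onData js' (onData js χ) := by
  rw [onData, List.foldl_append]
  rfl

/-- All blocks are handled in a pass, but only block `w` meets a nontrivial permutation. -/
theorem onData_wireJobs {w : ℕ} (hw : w < n + 1) (i : Fin (a + 1)) (χ : Data (n + 1) (a + 1))
    (l j : ℕ) (hj : j + l = n + 1) (d : Fin (n + 1) → Bool) (v : Fin (a + 1) → Bool) :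
    onData (wireJobs n w i j) χ d v = if j ≤ w then
      χ (Function.update d ⟨w, hw⟩ (v i)) (Function.update v i (d ⟨w, hw⟩)) else χ d v := by
  induction l generalizing j χ with
  | zero =>
    have : wireJobs n w i j = [] := by
      rw [wireJobs, List.drop_eq_nil_of_le (by simpa using hj.ge), List.map_nil]
    rw [this, if_neg (by omega)]
    rfl
  | succ l ih =>
    rw [wireJobs_of_lt (by omega)]
    have h : ∀ (J : Job (a + 1) (n + 1)) js, onData (J :: js) χ = onData js (J.onData χ) :=
      fun _ _ => rfl
    rw [h, ih _ (j + 1) (by omega)]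
    rcases lt_trichotomy j w with hlt | rfl | hlt
    · rw [if_neg hlt.ne, if_pos (by omega), if_pos hlt.le]
      simp [Job.onData, opPerm]
    · rw [if_pos rfl, if_neg (by omega), if_pos le_rfl]
      simp [Job.onData, opPerm, swapPerm]
    · rw [if_neg hlt.ne', if_neg (by omega), if_neg (by omega)]
      simp [Job.onData, opPerm]

/-- The wires are distinct and meet distinct work qubits, so the successive exchanges act as one
simultaneous exchange. The result `d'`, `v'` is characterised instead of constructed, so that the
induction can undo one exchange in it. -/
theorem onData_fetchJobs (ws : List ℕ) (hws : ws.Nodup) (hn : ∀ w ∈ ws, w < n + 1) (k : ℕ)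
    (hk : k + ws.length ≤ a + 1) (χ : Data (n + 1) (a + 1)) (d d' : Fin (n + 1) → Bool)
    (v v' : Fin (a + 1) → Bool)
    (h1 : ∀ (l : ℕ) (j : Fin (n + 1)) (i : Fin (a + 1)), i.val = k + l → ws[l]? = some j.val →
      d' j = v i ∧ v' i = d j)
    (h2 : ∀ j : Fin (n + 1), j.val ∉ ws → d' j = d j)
    (h3 : ∀ i : Fin (a + 1), (∀ l < ws.length, i.val ≠ k + l) → v' i = v i) :
    onData (fetchJobs n ws (Fin.ofNat (a + 1) k)) χ d v = χ d' v' := by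
  induction ws generalizing k χ d' v' with
  | nil =>
    rw [show d' = d from funext fun j => h2 j (by simp),
      show v' = v from funext fun i => h3 i (by simp)]
    rfl
  | cons w ws ih =>
    have hw : w < n + 1 := hn w List.mem_cons_self
    rw [List.length_cons] at hk
    obtain ⟨i, hi⟩ : ∃ i : Fin (a + 1), i.val = k := ⟨⟨k, by omega⟩, rfl⟩
    have hik : Fin.ofNat (a + 1) k = i := by rw [← hi]; simp
    have e := h1 0 ⟨w, hw⟩ i (by simpa using hi) rfl
    have hc : (i : Fin (a + 1)) + 1 = Fin.ofNat (a + 1) (k + 1) := by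
      rw [← hik]
      exact Fin.ext (by simp [Fin.val_add])
    rw [fetchJobs, onData_append, hik, hc]
    rw [ih (List.nodup_cons.1 hws).2 (fun x hx => hn x (List.mem_cons_of_mem _ hx)) (k + 1)
      (by omega) _ (Function.update d' ⟨w, hw⟩ (d ⟨w, hw⟩)) (Function.update v' i (v i))]
    · rw [onData_wireJobs hw i χ (n + 1) 0 (by omega), if_pos (Nat.zero_le _)]
      simp [← e.1, ← e.2]
    · intro l j i' hi' hj
      have hne : j ≠ ⟨w, hw⟩ := by
        rintro rfl
        exact (List.nodup_cons.1 hws).1 (List.mem_of_getElem? hj)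
      have hne' : i' ≠ i := by
        rintro rfl
        omega
      rw [Function.update_of_ne hne, Function.update_of_ne hne']
      exact h1 (l + 1) j i' (by omega) (by simpa using hj)
    · intro j hj
      by_cases hjw : j = ⟨w, hw⟩
      · rw [hjw, Function.update_self]
      · rw [Function.update_of_ne hjw]
        apply h2
        rw [List.mem_cons, not_or]
        exact ⟨fun h => hjw (Fin.ext h), hj⟩
    · intro i' hi'
      by_cases hii : i' = i
      · rw [hii, Function.update_self]
      · rw [Function.update_of_ne hii]
        apply h3
        intro l hl
        rcases l with _ | l
        · intro h
          exact hii (Fin.ext (by omega))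
        · intro h
          rw [List.length_cons] at hl
          exact hi' l (by omega) (by omega)

/-- A state of the logical qubits, with the work qubits in the state `0`. -/
def cleanData (φ : (Fin n → Bool) → ℂ) : Data n a :=
  fun d v => if v = fun _ => false then φ d else 0

/-- The exchange `e ↔ f` conjugates the gate on the work qubits `f` into the gate on the wires `e`.
As the work qubits start in the state `0`, they return to it, so the lemma can be iterated. -/
theorem onData_gateJobs (hG : ∀ g, G.arity g ≤ a) (g : Gate G) (hg : g.Valid (n + 1))
    (φ : (Fin (n + 1) → Bool) → ℂ) :
    onData (gateJobs hG n g) (cleanData φ) = cleanData ((g.unitary (n + 1)).1.mulVec φ) := by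
  let r := G.arity g.op
  let e : Fin r → Fin (n + 1) := fun i =>
    ⟨g.wires[i.val]'(by rw [hg.1]; exact i.isLt), hg.2.2 _ (List.getElem_mem _)⟩
  have he : Function.Injective e := fun i j hij =>
    Fin.ext ((hg.2.1.getElem_inj_iff).1 (congrArg Fin.val hij))
  have hr : r ≤ a + 1 := (hG g.op).trans (Nat.le_succ a)
  let f : Fin r → Fin (a + 1) := Fin.castLE hr
  have hf : Function.Injective f := Fin.castLE_injective _
  have hfetch : ∀ (χ : Data (n + 1) (a + 1)) d v, onData (fetchJobs n g.wires 0) χ d v =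
      χ (overwrite e (v ∘ f) d) (overwrite f (d ∘ e) v) := by
    intro χ d v
    have := onData_fetchJobs g.wires hg.2.1 hg.2.2 0 (by rw [zero_add, hg.1]; exact hr) χ d
      (overwrite e (v ∘ f) d) v (overwrite f (d ∘ e) v) ?_ ?_ ?_
    · simpa using this
    · intro l j i hi hj
      obtain ⟨hl, hj⟩ := List.getElem?_eq_some_iff.1 hj
      rw [zero_add] at hi
      have hlr : l < r := hl.trans_eq hg.1
      have e1 : j = e ⟨l, hlr⟩ := Fin.ext hj.symm
      have e2 : i = f ⟨l, hlr⟩ := Fin.ext hi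
      rw [e1, e2, overwrite_apply he, overwrite_apply hf]
      exact ⟨rfl, rfl⟩
    · intro j hj
      refine overwrite_of_ne _ _ fun i hi => hj ?_
      rw [← hi]
      exact List.getElem_mem _
    · intro i hi
      refine overwrite_of_ne _ _ fun l hl => ?_
      refine hi l (by rw [hg.1]; exact l.isLt) ?_
      rw [zero_add, ← hl]
      rfl
  funext d v
  have hU : ∀ y, ((g.unitary (n + 1)).1.mulVec φ) y =
      ∑ u, (G.mat g.op).1 (y ∘ e) u * φ (overwrite e u y) := by
    intro y
    rw [← sum_embed_mul he]
    have : (g.unitary (n + 1)).1 = embed e (G.mat g.op).1 := by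
      rw [Gate.unitary, dif_pos hg]
    rw [this]
    rfl
  have hcons : ∀ (J : Job (a + 1) (n + 1)) js χ, onData (J :: js) χ = onData js (J.onData χ) :=
    fun _ _ _ => rfl
  rw [gateJobs, onData_append, hcons, hfetch]
  set d' := overwrite e (v ∘ f) d with hd'
  set v' := overwrite f (d ∘ e) v with hv'
  have h1 : (Job.work (workUnitary hG g.op)).onData
      (onData (fetchJobs n g.wires 0) (cleanData φ)) d' v' =
      ∑ u, (G.mat g.op).1 (v' ∘ f) u *
        onData (fetchJobs n g.wires 0) (cleanData φ) d' (overwrite f u v') := by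
    rw [← sum_embed_mul hf]
    rfl
  have h2 : v' ∘ f = d ∘ e := funext fun i => overwrite_apply hf _ _ i
  have h3 : d' ∘ e = v ∘ f := funext fun i => overwrite_apply he _ _ i
  have h4 : ∀ u, overwrite f u v' ∘ f = u := fun u => funext fun i => overwrite_apply hf _ _ i
  have h5 : ∀ u, overwrite e u d' = overwrite e u d := by
    intro u
    funext j
    by_cases hj : ∃ i, e i = j
    · obtain ⟨i, rfl⟩ := hj
      rw [overwrite_apply he, overwrite_apply he]
    · have hj' : ∀ i, e i ≠ j := fun i hi => hj ⟨i, hi⟩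
      rw [overwrite_of_ne _ _ hj', overwrite_of_ne _ _ hj', hd', overwrite_of_ne _ _ hj']
  have h6 : ∀ u, overwrite f (v ∘ f) (overwrite f u v') = v := by
    intro u
    funext j
    by_cases hj : ∃ i, f i = j
    · obtain ⟨i, rfl⟩ := hj
      rw [overwrite_apply hf]
      rfl
    · have hj' : ∀ i, f i ≠ j := fun i hi => hj ⟨i, hi⟩
      rw [overwrite_of_ne _ _ hj', overwrite_of_ne _ _ hj', hv', overwrite_of_ne _ _ hj']
  rw [h1, h2]
  simp only [hfetch, h3, h4, h5, h6, cleanData, hU]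
  split_ifs <;> simp

theorem onData_circuit (hG : ∀ g, G.arity g ≤ a) (gs : List (Gate G))
    (hg : ∀ g ∈ gs, g.Valid (n + 1)) (φ : (Fin (n + 1) → Bool) → ℂ) :
    onData (gs.flatMap (gateJobs hG n)) (cleanData φ) =
      cleanData ((circuitUnitary (n + 1) gs).1.mulVec φ) := by
  induction gs generalizing φ with
  | nil =>
    have : ((circuitUnitary (n + 1) ([] : List (Gate G))).1.mulVec φ) = φ := Matrix.one_mulVec φ
    rw [this]
    rfl
  | cons g gs ih =>
    rw [List.flatMap_cons, onData_append, onData_gateJobs hG g (hg g List.mem_cons_self),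
      ih fun g' hg' => hg g' (List.mem_cons_of_mem _ hg'), Matrix.mulVec_mulVec]
    rfl

theorem prob_onData_circuit (hG : ∀ g, G.arity g ≤ a) (gs : List (Gate G))
    (hg : ∀ g ∈ gs, g.Valid (n + 1)) (input : Fin (n + 1) → Bool) (x : ℕ → Bool)
    (hx : ∀ i : Fin (n + 1), x i = input i) :
    (onData (gs.flatMap (gateJobs hG n)) (basisData (a + 1) (n + 1) x)).prob 0 =
      ∑ y : Fin (n + 1) → Bool, if y 0 = true then
        ‖(circuitUnitary (n + 1) gs).1.mulVec (Pi.single input 1) y‖ ^ 2 else 0 := by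
  have h : basisData (a + 1) (n + 1) x = cleanData (Pi.single input 1) := by
    funext d v
    have e : (∀ i : Fin (n + 1), d i = x i) ↔ d = input := by
      simp only [hx]
      exact funext_iff.symm
    simp only [basisData, cleanData, e, Pi.single_apply]
    split_ifs <;> simp_all
  rw [h, onData_circuit hG gs hg, Data.prob]
  refine Finset.sum_congr rfl fun y _ => ?_
  congr 1
  rw [Finset.sum_eq_single fun _ => false]
  · simp [cleanData]
  · intro v _ hv
    simp [cleanData, hv]
  · simp

end
end QPIP

open Computability
namespace QPIP
noncomputable section

open ComplexConjugate BigOperators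

/-! ### The memory of the honest prover -/

namespace Memory

variable {w : ℕ}

theorem mulVec_cnot (i j : Fin (w + 1)) (hij : i ≠ j) (f : (Fin (w + 1) → Bool) → ℂ)
    (y : Fin (w + 1) → Bool) :
    ((⟨StdOp.CNOT, [i.val, j.val]⟩ : Gate stdGates).unitary (w + 1)).1.mulVec f y =
      f (Function.update y j (xor (y i) (y j))) := by
  have hv : (⟨StdOp.CNOT, [i.val, j.val]⟩ : Gate stdGates).Valid (w + 1) := by
    refine ⟨rfl, ?_, ?_⟩
    · simpa [Fin.ext_iff] using hij
    · simp
      omega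
  let e : Fin 2 → Fin (w + 1) := ![i, j]
  have he : Function.Injective e := by
    intro k l h
    fin_cases k <;> fin_cases l <;> simp_all [e, hij.symm]
  have h1 : ((⟨StdOp.CNOT, [i.val, j.val]⟩ : Gate stdGates).unitary (w + 1)).1 = embed e cnot := by
    rw [Gate.unitary, dif_pos hv]
    change embed _ _ = _
    congr 1
    funext k
    fin_cases k <;> rfl
  rw [h1]
  change ∑ x, embed e cnot y x * f x = _
  rw [sum_embed_mul he, Finset.sum_eq_single ![y i, xor (y i) (y j)]]
  · have : overwrite e ![y i, xor (y i) (y j)] y = Function.update y j (xor (y i) (y j)) := by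
      funext k
      by_cases hk : ∃ l, e l = k
      · obtain ⟨l, rfl⟩ := hk
        rw [overwrite_apply he]
        fin_cases l
        · simp [e, hij]
        · simp [e]
      · have hk' : ∀ l, e l ≠ k := fun l hl => hk ⟨l, hl⟩
        have hj : j ≠ k := hk' 1
        rw [overwrite_of_ne _ _ hk', Function.update_of_ne hj.symm]
    rw [this]
    simp [cnot, e]
  · intro u _ hu
    rw [cnot, if_neg, zero_mul]
    rintro ⟨h0, h1⟩
    apply hu
    have h0' : y i = u 0 := h0
    have h1' : y j = xor (u 0) (u 1) := h1
    funext k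
    fin_cases k
    · exact h0'.symm
    · simp [h0', h1']
  · simp

theorem mulVec_swapGates (p : Fin (w + 1)) (f : (Fin (w + 1) → Bool) → ℂ)
    (y : Fin (w + 1) → Bool) :
    (circuitUnitary (w + 1) (swapGates p.val)).1.mulVec f y = f (y ∘ Equiv.swap 0 p) := by
  have hmul : ∀ (U V : Unitary (Fin (w + 1) → Bool)) f, (U * V).1.mulVec f =
      U.1.mulVec (V.1.mulVec f) := fun U V f => (Matrix.mulVec_mulVec _ _ _).symm
  have h1 : ∀ f : (Fin (w + 1) → Bool) → ℂ, (1 : Unitary (Fin (w + 1) → Bool)).1.mulVec f = f :=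
    fun f => Matrix.one_mulVec f
  -- For `p = 0` the gates repeat a wire; they are invalid and count as the identity, which is also
  -- the swap of `0` with itself.
  by_cases hp : p = 0
  · subst hp
    have hv : ∀ g ∈ swapGates 0, g.unitary (w + 1) = 1 := by
      intro g hg
      rw [Gate.unitary, dif_neg]
      rintro ⟨_, h, _⟩
      simp [swapGates] at hg
      subst hg
      simp at h
    simp only [swapGates, Fin.val_zero, circuitUnitary, List.mem_cons, forall_eq_or_imp] at hv ⊢
    rw [hv.1, one_mul, one_mul, one_mul, h1, Equiv.swap_self]
    rfl
  · have h2 : ∀ f y, ((⟨StdOp.CNOT, [0, p.val]⟩ : Gate stdGates).unitary (w + 1)).1.mulVec f y = _ :=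
      mulVec_cnot 0 p (Ne.symm hp)
    have h3 : ∀ f y, ((⟨StdOp.CNOT, [p.val, 0]⟩ : Gate stdGates).unitary (w + 1)).1.mulVec f y = _ :=
      mulVec_cnot p 0 hp
    have h4 : circuitUnitary (w + 1) (swapGates p.val) =
      (((1 * (⟨StdOp.CNOT, [0, p.val]⟩ : Gate stdGates).unitary (w + 1)) *
        (⟨StdOp.CNOT, [p.val, 0]⟩ : Gate stdGates).unitary (w + 1)) *
        (⟨StdOp.CNOT, [0, p.val]⟩ : Gate stdGates).unitary (w + 1)) := rfl
    rw [h4, hmul, hmul, hmul, h1, h2, h3, h2]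
    congr 1
    funext k
    by_cases hk : k = p
    · subst hk
      simp [Ne.symm hp, hp]
    · by_cases hk0 : k = 0
      · subst hk0
        simp [Ne.symm hp, hp]
        cases y 0 <;> cases y p <;> rfl
      · simp [hk, hk0, Equiv.swap_apply_of_ne_of_ne hk0 hk]

theorem circuitUnitary_append {G : GateSet} (n : ℕ) (c c' : List (Gate G)) :
    circuitUnitary n (c ++ c') = circuitUnitary n c' * circuitUnitary n c := by
  induction c with
  | nil => exact (mul_one _).symm
  | cons g c ih => rw [List.cons_append, circuitUnitary, ih, circuitUnitary, mul_assoc]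

/-- The operator of the honest prover in interaction number `t`, if he delays bits by `L`. -/
def operator (w L t : ℕ) : Matrix (Bool × (Fin w → Bool)) (Bool × (Fin w → Bool)) ℂ :=
  (splitFirst (circuitUnitary (w + 1) (swapGates (t + 1) ++ swapGates (t + 1 - L)))).1

variable {c L : ℕ}

/-- The operator permutes basis states, so the amplitude after it is the amplitude before it at the
preimage `y`, obtained by undoing the two exchanges in reverse order. -/
theorem exchangeBit_operator {t : ℕ} (ht : t < w) (i : Fin (c + 1))
    (φ : (Fin (c + 1) → Bool) → (Fin w → Bool) → ℂ) (h : Fin (c + 1) → Bool) (z y)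
    (hy : y = ((Fin.cons (h i) z : Fin (w + 1) → Bool) ∘
      Equiv.swap 0 ⟨t + 1 - L, by omega⟩) ∘ Equiv.swap 0 ⟨t + 1, by omega⟩) :
    exchangeBit (operator w L t) i φ h z = φ (Function.update h i (y 0)) (Fin.tail y) := by
  have h1 := mulVec_swapGates ⟨t + 1, by omega⟩
    (fun y : Fin (w + 1) → Bool => φ (Function.update h i (y 0)) (Fin.tail y))
    ((Fin.cons (h i) z : Fin (w + 1) → Bool) ∘ Equiv.swap 0 ⟨t + 1 - L, by omega⟩)
  have h2 := mulVec_swapGates ⟨t + 1 - L, by omega⟩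
    ((circuitUnitary (w + 1) (swapGates (t + 1))).1.mulVec
      fun y : Fin (w + 1) → Bool => φ (Function.update h i (y 0)) (Fin.tail y))
    (Fin.cons (h i) z : Fin (w + 1) → Bool)
  rw [h1, Matrix.mulVec_mulVec] at h2
  rw [hy]
  refine Eq.trans ?_ h2
  simp only [exchangeBit, LinearMap.coe_mk, AddHom.coe_mk, operator, circuitUnitary_append]
  rw [Matrix.mulVec, dotProduct, ← Equiv.sum_comp (Fin.consEquiv fun _ => Bool)]
  refine Finset.sum_congr rfl fun r _ => ?_
  simp [splitFirst, Fin.consEquiv]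

/-- The bit that is sent in interaction number `u`, if `R k` is the block that is encoded at the end
of cycle `k`. -/
def sentBit (R : ℕ → Fin (c + 1) → Bool) (u : ℕ) : Bool :=
  if u / (c + 1) = 0 then false
  else R (u / (c + 1) - 1) ⟨u % (c + 1), Nat.mod_lt _ (Nat.succ_pos c)⟩

/-- The contents of the memory before interaction number `t`. -/
def contents (w L : ℕ) (R : ℕ → Fin (c + 1) → Bool) (t : ℕ) : Fin w → Bool :=
  fun u => if u.val < t ∧ t ≤ u.val + L then sentBit R u.val else false

/-- The bit that is returned in interaction number `t`. -/
def returnedBit (L : ℕ) (R : ℕ → Fin (c + 1) → Bool) (t : ℕ) : Bool :=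
  if L ≤ t then sentBit R (t - L) else false

/-- One step of the queue. For `L = 0` the exchanges cancel; for `t < L` the second one is trivial
and a fresh `0` is returned; otherwise the bit of interaction `t - L` comes out and its place is
filled with `0`. -/
theorem cons_comp_swap {t : ℕ} (ht : t < w) (R : ℕ → Fin (c + 1) → Bool) :
    ((Fin.cons (sentBit R t) (contents w L R t) : Fin (w + 1) → Bool) ∘
      Equiv.swap 0 ⟨t + 1, by omega⟩) ∘ Equiv.swap 0 ⟨t + 1 - L, by omega⟩ =
      Fin.cons (returnedBit L R t) (contents w L R (t + 1)) := by
  rcases Nat.eq_zero_or_pos L with rfl | hL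
  · funext j
    have : (⟨t + 1 - 0, by omega⟩ : Fin (w + 1)) = ⟨t + 1, by omega⟩ := rfl
    rw [this]
    simp only [Function.comp_apply, ← Equiv.Perm.mul_apply, Equiv.swap_mul_self,
      Equiv.Perm.one_apply]
    refine Fin.cases ?_ (fun u => ?_) j
    · simp [returnedBit]
    · simp only [Fin.cons_succ, contents]
      rw [if_neg (by omega), if_neg (by omega)]
  · funext j
    have hP : (⟨t + 1, by omega⟩ : Fin (w + 1)) = Fin.succ ⟨t, ht⟩ := rfl
    rw [hP]
    simp only [Function.comp_apply]
    rcases Nat.lt_or_ge t L with hlt | hge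
    · have hQ : (⟨t + 1 - L, by omega⟩ : Fin (w + 1)) = 0 := Fin.ext (by simp; omega)
      rw [hQ, Equiv.swap_self, Equiv.refl_apply]
      refine Fin.cases ?_ (fun u => ?_) j
      · rw [Equiv.swap_apply_left, Fin.cons_succ, Fin.cons_zero]
        simp [contents, returnedBit, hlt]
      · by_cases hu : u = ⟨t, ht⟩
        · subst hu
          rw [Equiv.swap_apply_right, Fin.cons_zero, Fin.cons_succ]
          simp only [contents]
          rw [if_pos (by omega)]
        · rw [Equiv.swap_apply_of_ne_of_ne (Fin.succ_ne_zero u)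
            (fun h => hu (Fin.succ_injective _ h)), Fin.cons_succ,
            Fin.cons_succ]
          have : u.val ≠ t := fun h => hu (Fin.ext h)
          simp only [contents]
          congr 1
          exact propext ⟨fun h => by omega, fun h => by omega⟩
    · obtain ⟨q, hq⟩ : ∃ q : Fin w, q.val = t - L := ⟨⟨t - L, by omega⟩, rfl⟩
      have hQ : (⟨t + 1 - L, by omega⟩ : Fin (w + 1)) = q.succ := Fin.ext (by simp; omega)
      rw [hQ]
      have hqt : q ≠ ⟨t, ht⟩ := fun h => by
        have := congrArg Fin.val h
        simp at this
        omega
      refine Fin.cases ?_ (fun u => ?_) j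
      · rw [Equiv.swap_apply_left, Equiv.swap_apply_of_ne_of_ne (Fin.succ_ne_zero q)
          (fun h => hqt (Fin.succ_injective _ h)), Fin.cons_succ, Fin.cons_zero]
        simp only [contents, returnedBit]
        rw [if_pos (by omega), if_pos hge, hq]
      · by_cases huq : u = q
        · subst huq
          rw [Equiv.swap_apply_right, Equiv.swap_apply_left, Fin.cons_succ, Fin.cons_succ]
          simp only [contents]
          rw [if_neg (by omega), if_neg (by omega)]
        · rw [Equiv.swap_apply_of_ne_of_ne (Fin.succ_ne_zero u) fun h => huq (Fin.succ_injective _ h)]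
          by_cases hu : u = ⟨t, ht⟩
          · subst hu
            rw [Equiv.swap_apply_right, Fin.cons_zero, Fin.cons_succ]
            simp only [contents]
            rw [if_pos (by omega)]
          · rw [Equiv.swap_apply_of_ne_of_ne (Fin.succ_ne_zero u)
                (fun h => hu (Fin.succ_injective _ h)),
              Fin.cons_succ, Fin.cons_succ]
            have h1 : u.val ≠ t := fun h => hu (Fin.ext h)
            have h2 : u.val ≠ t - L := fun h => huq (Fin.ext (h.trans hq.symm))
            simp only [contents]
            congr 1
            exact propext ⟨fun h => by omega, fun h => by omega⟩

/-- The basis state with block `h₀` and memory `z₀`. -/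
def basisState (h₀ : Fin (c + 1) → Bool) (z₀ : Fin w → Bool) :
    (Fin (c + 1) → Bool) → (Fin w → Bool) → ℂ :=
  fun h z => if h = h₀ ∧ z = z₀ then 1 else 0

theorem exchangeBit_basisState {t : ℕ} (ht : t < w) (R : ℕ → Fin (c + 1) → Bool) (i : Fin (c + 1))
    (h₀ : Fin (c + 1) → Bool) (hi : h₀ i = sentBit R t) :
    exchangeBit (operator w L t) i (basisState h₀ (contents w L R t)) =
      basisState (Function.update h₀ i (returnedBit L R t)) (contents w L R (t + 1)) := by
  funext h z
  rw [exchangeBit_operator ht i _ h z _ rfl]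
  set y := ((Fin.cons (h i) z : Fin (w + 1) → Bool) ∘ Equiv.swap 0 ⟨t + 1 - L, by omega⟩) ∘
    Equiv.swap 0 ⟨t + 1, by omega⟩ with hy
  have hinv : (y ∘ Equiv.swap 0 ⟨t + 1, by omega⟩) ∘ Equiv.swap 0 ⟨t + 1 - L, by omega⟩ =
      (Fin.cons (h i) z : Fin (w + 1) → Bool) := by
    funext j
    simp [hy]
  have key := cons_comp_swap (L := L) ht R
  simp only [basisState]
  congr 1
  refine propext ⟨fun ⟨h1, h2⟩ => ?_, fun ⟨h1, h2⟩ => ?_⟩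
  · have h3 : y = Fin.cons (sentBit R t) (contents w L R t) := by
      rw [← Fin.cons_self_tail y, h2, ← hi, ← h1, Function.update_self]
    rw [h3, key] at hinv
    have h4 := congrFun hinv 0
    rw [Fin.cons_zero, Fin.cons_zero] at h4
    refine ⟨?_, ?_⟩
    · rw [← h1, Function.update_idem, h4, Function.update_eq_self]
    · have := congrArg Fin.tail hinv
      rwa [Fin.tail_cons, Fin.tail_cons, eq_comm] at this
  · have h3 : (Fin.cons (h i) z : Fin (w + 1) → Bool) =
        Fin.cons (returnedBit L R t) (contents w L R (t + 1)) := by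
      rw [h1, h2, Function.update_self]
    rw [h3, ← key] at hinv
    have h4 : y = Fin.cons (sentBit R t) (contents w L R t) := by
      have h5 := congrArg (fun f => (f ∘ Equiv.swap 0 (⟨t + 1 - L, by omega⟩ : Fin (w + 1))) ∘
        Equiv.swap 0 (⟨t + 1, by omega⟩ : Fin (w + 1))) hinv
      funext j
      have := congrFun h5 j
      simpa using this
    rw [h4, Fin.cons_zero, Fin.tail_cons]
    refine ⟨?_, rfl⟩
    rw [h1, Function.update_idem, ← hi, Function.update_eq_self]

end Memory

end
end QPIP

/-! ### The honest prover as a queue of blocks -/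

open Computability
namespace QPIP
noncomputable section

open ComplexConjugate BigOperators

namespace Memory

variable {w c n a : ℕ}

/-- The block that is sent to the prover in cycle `s`. -/
def sentBlock (R : ℕ → Fin (c + 1) → Bool) (s : ℕ) : Fin (c + 1) → Bool :=
  if s = 0 then fun _ => false else R (s - 1)

/-- The block that the prover returns in cycle `s`. -/
def returnedBlock (n : ℕ) (R : ℕ → Fin (c + 1) → Bool) (s : ℕ) : Fin (c + 1) → Bool :=
  if n ≤ s then sentBlock R (s - n) else fun _ => false

/-- The contents of the memory before cycle `s`. -/
def blockContents (w n : ℕ) (R : ℕ → Fin (c + 1) → Bool) (s : ℕ) : Fin w → Bool :=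
  contents w (n * (c + 1)) R (s * (c + 1))

theorem sentBit_eq (R : ℕ → Fin (c + 1) → Bool) (s : ℕ) (i : Fin (c + 1)) :
    sentBit R (s * (c + 1) + i) = sentBlock R s i := by
  have h1 : (s * (c + 1) + i) / (c + 1) = s := by
    rw [mul_comm, Nat.mul_add_div (Nat.succ_pos c), Nat.div_eq_of_lt i.isLt, add_zero]
  have h2 : (s * (c + 1) + i) % (c + 1) = i := by
    rw [mul_comm, Nat.mul_add_mod, Nat.mod_eq_of_lt i.isLt]
  simp only [sentBit, h1, h2, sentBlock]
  split_ifs <;> rfl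

theorem returnedBit_eq (R : ℕ → Fin (c + 1) → Bool) (s : ℕ) (i : Fin (c + 1)) :
    returnedBit (n * (c + 1)) R (s * (c + 1) + i) = returnedBlock n R s i := by
  rw [returnedBit, returnedBlock]
  by_cases h : n ≤ s
  · obtain ⟨d, rfl⟩ := Nat.exists_eq_add_of_le h
    have h1 : (n + d) * (c + 1) + i = n * (c + 1) + (d * (c + 1) + i) := by ring
    rw [if_pos h, h1, if_pos (Nat.le_add_right _ _), Nat.add_sub_cancel_left, sentBit_eq,
      Nat.add_sub_cancel_left]
  · have h1 : (s + 1) * (c + 1) ≤ n * (c + 1) := Nat.mul_le_mul_right _ (by omega)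
    have h2 := i.isLt
    rw [if_neg h, if_neg]
    rw [add_mul, one_mul] at h1
    omega

/-- Before cycle `s` the queue holds at most the blocks sent in the `n` preceding cycles, and what
is sent in cycle `k + 1` is `R k`. The delay is `n` and not `n + 1` because one block is in the
hands of the verifier. -/
theorem blockContents_congr {R R' : ℕ → Fin (c + 1) → Bool} {s : ℕ}
    (h : ∀ k, k + 1 < s → s ≤ k + 1 + n → R k = R' k) :
    blockContents w n R s = blockContents w n R' s := by
  funext u
  simp only [blockContents, contents]
  split_ifs with hu
  · have h1 : u.val / (c + 1) < s := by
      rw [Nat.div_lt_iff_lt_mul (Nat.succ_pos c)]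
      exact hu.1
    have h2 : s ≤ u.val / (c + 1) + n := by
      rw [← Nat.add_mul_div_right _ _ (Nat.succ_pos c), Nat.le_div_iff_mul_le (Nat.succ_pos c)]
      exact hu.2
    rw [sentBit, sentBit]
    split_ifs with h0
    · rfl
    · have h3 := Nat.sub_add_cancel (Nat.pos_of_ne_zero h0)
      rw [h _ (by rwa [h3]) (by rwa [h3])]
  · rfl

theorem exchangeUpTo_basisState {s : ℕ} (hs : (s + 1) * (c + 1) ≤ w)
    (R : ℕ → Fin (c + 1) → Bool) (k : ℕ) (hk : k ≤ c + 1) :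
    Program.exchangeUpTo (operator w (n * (c + 1))) (s * (c + 1)) k
        (basisState (sentBlock R s) (blockContents w n R s)) =
      basisState (fun i => if i.val < k then returnedBlock n R s i else sentBlock R s i)
        (contents w (n * (c + 1)) R (s * (c + 1) + k)) := by
  induction k with
  | zero =>
    simp [Program.exchangeUpTo, blockContents]
  | succ k ih =>
    have ht : s * (c + 1) + k < w := by
      rw [add_mul, one_mul] at hs
      omega
    rw [Program.exchangeUpTo, dif_pos (by omega), Module.End.mul_apply, ih (by omega),
      exchangeBit_basisState ht R ⟨k, by omega⟩ _ (by
        rw [if_neg (lt_irrefl _)]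
        exact (sentBit_eq R s ⟨k, by omega⟩).symm)]
    congr 1
    funext i
    by_cases hi : i.val = k
    · subst hi
      rw [Function.update_self, if_pos (Nat.lt_succ_self _)]
      exact returnedBit_eq R s i
    · rw [Function.update_of_ne (fun h => hi (congrArg Fin.val h))]
      have : i.val < k ↔ i.val < k + 1 := by omega
      simp only [this]

theorem exchangeBlock_basisState {s : ℕ} (hs : (s + 1) * (c + 1) ≤ w)
    (R : ℕ → Fin (c + 1) → Bool) :
    Program.exchangeBlock (operator w (n * (c + 1))) s
        (basisState (sentBlock R s) (blockContents w n R s)) =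
      basisState (returnedBlock n R s) (blockContents w n R (s + 1)) := by
  rw [Program.exchangeBlock, exchangeUpTo_basisState hs R _ le_rfl, blockContents]
  congr 1
  · funext i
    rw [if_pos i.isLt]
  · congr 1
    ring

/-- The state of the block and the memory before cycle `s`. -/
def stateBefore (w n : ℕ) (R : ℕ → Fin (c + 1) → Bool) (s : ℕ) :
    (Fin (c + 1) → Bool) → (Fin w → Bool) → ℂ :=
  basisState (sentBlock R s) (blockContents w n R s)

/-- A finite sequence of blocks, continued by `0`. -/
def extend {s : ℕ} (r : Fin s → Fin (c + 1) → Bool) (k : ℕ) : Fin (c + 1) → Bool :=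
  if h : k < s then r ⟨k, h⟩ else fun _ => false

/-- A finite sequence of blocks, continued periodically. -/
def repeated (r : Fin (n + 1) → Fin (c + 1) → Bool) (k : ℕ) : Fin (c + 1) → Bool :=
  r ⟨k % (n + 1), Nat.mod_lt _ (Nat.succ_pos n)⟩

/-- In the first `n + 1` cycles the honest prover returns only zeros, so the measurements of the
preparation succeed with certainty and only the factors from the encodings remain. -/
theorem initMemo_eq (s : ℕ) (hs : s ≤ n + 1) (hw : s * (c + 1) ≤ w)
    (r : Fin s → Fin (c + 1) → Bool) :
    initMemo (Program.exchangeBlock (operator w (n * (c + 1))))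
        (basisState (fun _ => false) fun _ => false) s r =
      ((Real.sqrt (blockDim c) : ℂ)⁻¹ ^ s) • stateBefore w n (extend r) s := by
  induction s with
  | zero =>
    rw [initMemo, pow_zero, one_smul, stateBefore, sentBlock, if_pos rfl]
    have : blockContents w n (extend r) 0 = fun _ => false := by
      funext u
      simp [blockContents, contents]
    rw [this]
  | succ s ih =>
    have h1 : returnedBlock n (extend (Fin.init r)) s = fun _ => false := by
      rw [returnedBlock]
      split_ifs
      -- This is cycle `n`, in which the zero block that the verifier sent in cycle `0` comes back.
      · rw [sentBlock, if_pos (by omega)]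
      · rfl
    have h2 : blockContents w n (extend (Fin.init r)) (s + 1) =
        blockContents w n (extend r) (s + 1) := by
      refine blockContents_congr fun k hk _ => ?_
      rw [extend, extend, dif_pos (by omega), dif_pos (by omega)]
      rfl
    have h3 : sentBlock (extend r) (s + 1) = r (Fin.last s) := by
      rw [sentBlock, if_neg (Nat.succ_ne_zero s), extend, dif_pos (by omega)]
      rfl
    funext h z
    have h4 := ih (by omega) (by rw [add_mul] at hw; omega) (Fin.init r)
    simp only [initMemo]
    rw [h4, map_smul, stateBefore, exchangeBlock_basisState hw, h1, h2]
    simp only [stateBefore, h3, Pi.smul_apply, basisState, smul_eq_mul, true_and, pow_succ']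
    by_cases hh : h = r (Fin.last s)
    · simp only [hh, if_true, true_and, mul_assoc]
    · simp [hh]

theorem stateBefore_extend (r : Fin (n + 1) → Fin (c + 1) → Bool) :
    stateBefore w n (extend r) (n + 1) = stateBefore w n (repeated r) (n + 1) := by
  have h : ∀ k, k < n + 1 → extend r k = repeated r k := by
    intro k hk
    rw [extend, dif_pos hk, repeated]
    congr
    rw [Nat.mod_eq_of_lt hk]
  rw [stateBefore, stateBefore]
  congr 1
  · rw [sentBlock, sentBlock, if_neg (Nat.succ_ne_zero n), if_neg (Nat.succ_ne_zero n)]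
    exact h _ (by omega)
  · exact blockContents_congr fun k hk _ => h k (by omega)

/-- The honest state survives the projection without loss: the returned block agrees with the label
`r j`, and the rest of the memory does not depend on this label, so the sum over `ρ` consists of
`blockDim c` equal terms. -/
theorem collapse_stateBefore {t : ℕ} (ht : n + 1 ≤ t) (hw : (t + 1) * (c + 1) ≤ w)
    (j : Fin (n + 1)) (hj : j.val = t % (n + 1)) (C : ℂ) :
    (collapse j fun r : Fin (n + 1) → Fin (c + 1) → Bool => Program.exchangeBlock (operator w (n * (c + 1))) t
        (C • stateBefore w n (repeated r) t)) =
      fun r : Fin (n + 1) → Fin (c + 1) → Bool => C • stateBefore w n (repeated r) (t + 1) := by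
  have h1 : ∀ r : Fin (n + 1) → Fin (c + 1) → Bool, returnedBlock n (repeated r) t = r j := by
    intro r
    rw [returnedBlock, if_pos (by omega), sentBlock, if_neg (by omega), repeated]
    congr
    rw [hj, ← Nat.add_mod_right (t - n - 1)]
    congr 1
    omega
  have h2 : ∀ r : Fin (n + 1) → Fin (c + 1) → Bool, sentBlock (repeated r) (t + 1) = r j := by
    intro r
    rw [sentBlock, if_neg (Nat.succ_ne_zero t), repeated]
    congr
    exact hj.symm
  have h3 : ∀ (r : Fin (n + 1) → Fin (c + 1) → Bool) ρ,
      blockContents w n (repeated (Function.update r j ρ)) (t + 1) =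
        blockContents w n (repeated r) (t + 1) := by
    intro r ρ
    -- The stored indices `k` satisfy `t - n ≤ k < t`, and none of these is congruent to `t` modulo
    -- `n + 1`.
    refine blockContents_congr fun k hk hk' => ?_
    rw [repeated, repeated, Function.update_of_ne]
    intro h
    have h4 := congrArg Fin.val h
    simp only [hj] at h4
    have h5 : (n + 1) ∣ t - k := (Nat.modEq_iff_dvd' (by omega)).1 h4
    have := Nat.le_of_dvd (by omega) h5
    omega
  have hN : (blockDim c : ℂ) ≠ 0 := by
    exact_mod_cast (blockDim_pos c).ne'
  have hcard : ((Fintype.card (Fin (c + 1) → Bool) : ℕ) : ℂ) = blockDim c := by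
    simp [blockDim]
  funext r h z
  simp only [collapse, map_smul, stateBefore, exchangeBlock_basisState hw, h1, h2, h3,
    Function.update_self, Pi.smul_apply, basisState, true_and, smul_eq_mul, Finset.sum_const,
    Finset.card_univ, nsmul_eq_mul, hcard]
  by_cases hh : h = r j
  · simp only [hh, if_true, true_and]
    rw [inv_mul_cancel_left₀ hN]
  · simp [hh]

/-- The cycles of the list of jobs that starts with cycle `t` and ends before cycle `t'` go through
the qubits in turn. -/
def InTurn : List (Job a (n + 1)) → ℕ → ℕ → Prop
  | [], t, t' => t = t'
  | .cycle j _ :: js, t, t' => j.val = t % (n + 1) ∧ InTurn js (t + 1) t'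
  | .work _ :: js, t, t' => InTurn js t t'

theorem InTurn.le {js : List (Job a (n + 1))} {t t' : ℕ} (h : InTurn js t t') : t ≤ t' := by
  induction js generalizing t with
  | nil => exact Eq.le h
  | cons J js ih =>
    cases J with
    | cycle j σ => exact (Nat.le_succ t).trans (ih h.2)
    | work U => exact ih h

theorem InTurn.append {js js' : List (Job a (n + 1))} {t t' t'' : ℕ} (h : InTurn js t t')
    (h' : InTurn js' t' t'') : InTurn (js ++ js') t t'' := by
  induction js generalizing t with
  | nil =>
    obtain rfl : t = t' := h
    exact h'
  | cons J js ih =>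
    cases J with
    | cycle j σ => exact ⟨h.1, ih h.2⟩
    | work U => exact ih h

/-- No cycle loses norm as long as the blocks are fetched in turn. The script must end at a multiple
of `n + 1` since the last fetch is of block `0`. For each label the squared norm is `(blockDim c)⁻¹
^ (n + 1)`, and there are `blockDim c ^ (n + 1)` labels. -/
theorem sqNorm_attack {js : List (Job a (n + 1))} {t t' : ℕ} (h : InTurn js t t')
    (ht : n + 1 ≤ t) (ht' : t' % (n + 1) = 0) (hw : (t' + 1) * (c + 1) ≤ w) :
    (attack (Program.exchangeBlock (operator w (n * (c + 1)))) 0 js t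
      fun r : Fin (n + 1) → Fin (c + 1) → Bool =>
      ((Real.sqrt (blockDim c) : ℂ)⁻¹ ^ (n + 1)) • stateBefore w n (repeated r) t).sqNorm = 1 := by
  induction js generalizing t with
  | nil =>
    obtain rfl : t = t' := h
    rw [attack, collapse_stateBefore ht hw 0 ht'.symm]
    have hN := blockDim_pos c
    have h1 : ‖((Real.sqrt (blockDim c) : ℂ)⁻¹ ^ (n + 1))‖ ^ 2 = ((blockDim c)⁻¹) ^ (n + 1) := by
      rw [norm_pow, norm_inv, Complex.norm_real, Real.norm_of_nonneg (Real.sqrt_nonneg _), ← pow_mul,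
        mul_comm, pow_mul, inv_pow, Real.sq_sqrt hN.le]
    have h2 : ∀ (h₀ : Fin (c + 1) → Bool) (z₀ : Fin w → Bool),
        ∑ h, ∑ z, ‖((Real.sqrt (blockDim c) : ℂ)⁻¹ ^ (n + 1)) * basisState h₀ z₀ h z‖ ^ 2 =
          ((blockDim c)⁻¹) ^ (n + 1) := by
      intro h₀ z₀
      rw [Finset.sum_eq_single h₀ _ (by simp), Finset.sum_eq_single z₀ _ (by simp)]
      · rw [basisState, if_pos ⟨rfl, rfl⟩, mul_one, h1]
      · intro z _ hz
        simp [basisState, hz]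
      · intro h _ hh
        simp [basisState, hh]
    simp only [Memo.sqNorm, Pi.smul_apply, smul_eq_mul, stateBefore, h2, Finset.sum_const,
      Finset.card_univ, nsmul_eq_mul]
    have hcard : ((Fintype.card (Fin (n + 1) → Fin (c + 1) → Bool) : ℕ) : ℝ) =
        blockDim c ^ (n + 1) := by
      simp [blockDim]
    rw [hcard, ← mul_pow, mul_inv_cancel₀ hN.ne', one_pow]
  | cons J js ih =>
    cases J with
    | work U => exact ih h ht
    | cycle j σ =>
      have hlt := h.2.le
      rw [attack, collapse_stateBefore ht
        (le_trans (Nat.mul_le_mul_right _ (by omega)) hw) j h.1]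
      exact ih h.2 (by omega)

section Circuit

variable {G : GateSet}

theorem inTurn_wireJobs (v : ℕ) (i : Fin (a + 1)) (K d j : ℕ) (hd : j + d = n + 1) :
    InTurn (wireJobs n v i j) (K * (n + 1) + j) ((K + 1) * (n + 1)) := by
  induction d generalizing j with
  | zero =>
    obtain rfl : j = n + 1 := hd
    have : wireJobs n v i (n + 1) = [] := by simp [wireJobs]
    rw [this]
    change _ = _
    ring
  | succ d ih =>
    rw [wireJobs_of_lt (by omega)]
    refine ⟨?_, ih (j + 1) (by omega)⟩
    rw [mul_comm, Nat.mul_add_mod, Nat.mod_eq_of_lt (by omega)]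

theorem inTurn_fetchJobs (ws : List ℕ) (i : Fin (a + 1)) (K : ℕ) :
    InTurn (fetchJobs n ws i) (K * (n + 1)) ((K + ws.length) * (n + 1)) := by
  induction ws generalizing i K with
  | nil => rfl
  | cons w ws ih =>
    refine (inTurn_wireJobs w i K (n + 1) 0 (by omega)).append ?_
    have := ih (i + 1) (K + 1)
    rwa [add_assoc K, add_comm 1] at this

theorem inTurn_circuit (hG : ∀ g, G.arity g ≤ a) (gs : List (Gate G)) (K : ℕ) :
    ∃ K', K' ≤ K + 2 * (gs.flatMap Gate.encode).length ∧
      InTurn (gs.flatMap (gateJobs hG n)) (K * (n + 1)) (K' * (n + 1)) := by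
  induction gs generalizing K with
  | nil => exact ⟨K, by simp, rfl⟩
  | cons g gs ih =>
    obtain ⟨K', h1, h2⟩ := ih (K + g.wires.length + g.wires.length)
    refine ⟨K', ?_, ?_⟩
    · have : g.wires.length ≤ g.encode.length := by
        rw [Gate.encode, List.length_cons, List.length_flatMap]
        refine le_trans ?_ (Nat.le_succ _)
        refine (List.length_le_sum_of_one_le _ ?_).trans' (by simp)
        simp
      rw [List.flatMap_cons, List.length_append]
      omega
    · exact ((inTurn_fetchJobs g.wires 0 K).append (js' := .work _ :: _)
        (inTurn_fetchJobs g.wires 0 (K + g.wires.length))).append h2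

end Circuit

end Memory

end
end QPIP

/-! ### The protocol: completeness, soundness and the number of qubits -/

open Computability
namespace QPIP
noncomputable section

open ComplexConjugate BigOperators

variable {a c m n : ℕ} {δ : ℝ} {G : GateSet}

theorem isIsometry_exchangeBlock (S : Strategy) (s : ℕ) :
    IsIsometry (Program.exchangeBlock (c := c)
      (fun t => (S.act (List.replicate (t + 1) .quantum)).1) s) := by
  have h : ∀ k, IsIsometry (Program.exchangeUpTo (c := c)
      (fun t => (S.act (List.replicate (t + 1) .quantum)).1) (s * (c + 1)) k) := by
    intro k
    induction k with
    | zero => exact isIsometry_one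
    | succ k ih =>
      rw [Program.exchangeUpTo]
      refine IsIsometry.mul ?_ ih
      split_ifs with hk
      · exact isIsometry_exchangeBit _ _
      · exact isIsometry_one
  exact h _

/-- A bound for the number of rounds and for the memory of the honest prover. -/
def roundBound (c m : ℕ) : Polynomial ℕ :=
  Polynomial.C (Program.cost c m) * ((Polynomial.X + 1) * (6 * Polynomial.X + 15))

theorem eval_roundBound (c m l : ℕ) :
    (roundBound c m).eval l = Program.cost c m * ((l + 1) * (6 * l + 15)) := by
  simp [roundBound]

/-- The verifier. -/
def verifier (hG : ∀ g, G.arity g ≤ a) (𝒞 : Code c m δ) :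
    Verifier (Symbol G) ((a + 1) + (c + 1)) :=
  ((verifierProgram hG m).controller c).verifier ((verifierProgram hG m).instr 𝒞) (roundBound c m)

/-- The honest prover. -/
def prover (G : GateSet) (c m : ℕ) : BQPProver (Symbol G) where
  width := roundBound c m
  circuit := Memory.circuit (c + 1) Sum.isLeft
  polyTime := Memory.polyTime_circuit (c + 1) Sum.isLeft

/-- The initial state of the block and the private register of the prover. -/
def initBlock (S : Strategy) (c : ℕ) : (Fin (c + 1) → Bool) → S.M → ℂ :=
  fun h z => if h = fun _ => false then S.init z else 0

/-- The squared norm of the part of the state of the prover that returns the blocks that he has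
been sent. -/
def fidelity (S : Strategy) (c : ℕ) (js : List (Job a (n + 1))) : ℝ :=
  (attack (Program.exchangeBlock fun t => (S.act (List.replicate (t + 1) .quantum)).1) 0 js (n + 1)
    (initMemo (Program.exchangeBlock fun t => (S.act (List.replicate (t + 1) .quantum)).1)
      (initBlock S c) (n + 1))).sqNorm

theorem encode_eq (I : Instance G) : I.encode =
    (List.ofFn I.input).map .inl ++ (I.gates.flatMap Gate.encode).map .inr := rfl

theorem length_encode (I : Instance G) :
    I.encode.length = I.n + (I.gates.flatMap Gate.encode).length := by
  simp [encode_eq]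

/-- The protocol behaves as the ideal one on the fraction `fidelity` of the prover's state, and the
remainder is accepted with probability at most `δ`. The proof joins the simulation of the program,
the bounds for preparation and script, and the computation of the data. -/
theorem acceptProb_bounds (hG : ∀ g, G.arity g ≤ a) (𝒞 : Code c m δ) (hδ : 0 ≤ δ) (S : Strategy)
    (pos : 0 < n + 1) (gs : List (Gate G)) (hg : ∀ g ∈ gs, g.Valid (n + 1))
    (input : Fin (n + 1) → Bool) :
    (Instance.mk (n + 1) pos gs hg input).prob * fidelity S c (gs.flatMap (gateJobs hG n)) ≤
        acceptProb (verifier hG 𝒞) S (Instance.mk (n + 1) pos gs hg input).encode ∧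
      acceptProb (verifier hG 𝒞) S (Instance.mk (n + 1) pos gs hg input).encode ≤
        (Instance.mk (n + 1) pos gs hg input).prob * fidelity S c (gs.flatMap (gateJobs hG n)) +
          δ * (1 - fidelity S c (gs.flatMap (gateJobs hG n))) := by
  set I := Instance.mk (n + 1) pos gs hg input with hI
  set U := fun t => (S.act (List.replicate (t + 1) .quantum)).1 with hU
  let x : ℕ → Bool := fun i => if h : i < n + 1 then input ⟨i, h⟩ else false
  have hx : ∀ i : Fin (n + 1), x i = input i := fun i => dif_pos i.isLt
  have hprob := prob_onData_circuit hG gs hg input x hx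
  have hrun := runs_init (m := m) (Sim.circuit (hG := hG) (𝒞 := 𝒞) (U := U) gs
    (fun g h w hw => (hg g h).2.2 w hw) []) (List.ofFn input) 0 (by simp) ![]
  have hacc : acceptProb (verifier hG 𝒞) S I.encode =
      prepare 𝒞 (Program.exchangeBlock U) (afterPrep n 𝒞 U (gs.flatMap (gateJobs hG n)))
        (List.ofFn input) 0 ![]
        (fun w h z => if w = fun _ => false then initBlock S c h z else 0) := by
    have e : (initState S : State (a + 1) (c + 1) S.M) =
        fun w h z => if w = fun _ => false then initBlock S c h z else 0 := by
      funext w h z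
      by_cases hw : w = fun _ => false <;> by_cases hh : h = fun _ => false <;>
        simp [initState, initBlock, hw, hh]
    have h1 := hrun ((roundBound c m).eval I.encode.length) (by
      rw [eval_roundBound, mul_comm, length_encode]
      refine Nat.mul_le_mul_left _ ?_
      simp only [List.length_ofFn, hI]
      generalize (gs.flatMap Gate.encode).length = l
      nlinarith) (initState S)
    rw [zero_mul] at h1
    rw [← e]
    refine (acceptProb_verifier _ _ _ S I.encode).trans (Eq.trans ?_ h1)
    have h2 : ∀ x : (verifierProgram hG m).Conf, (verifierProgram hG m).init I.encode = x →
        ((verifierProgram hG m).controller c).init I.encode = ⟨(x.q, .ex 0), x.stk⟩ := by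
      rintro x rfl
      rfl
    exact congrArg (fun x => blockRun ((verifierProgram hG m).controller c)
      ((verifierProgram hG m).instr 𝒞) U ((roundBound c m).eval I.encode.length) x 0
      (initState S)) (h2 _ (init_encode I))
  rw [hacc]
  have h := prepare_bounds 𝒞 (isIsometry_exchangeBlock S) hδ
    (afterPrep n 𝒞 U (gs.flatMap (gateJobs hG n))) 0 (gs.flatMap (gateJobs hG n))
    (fun κ ψ => by rw [afterPrep, dif_pos rfl]; rfl) (initBlock S c) (by
      rw [Finset.sum_eq_single (fun _ => false)]
      · simpa [initBlock] using S.norm_init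
      · intro h _ hh
        simp [initBlock, hh]
      · simp) x (List.ofFn input) (by simp) (fun i hi => by
        rw [List.getElem_ofFn]
        exact (hx ⟨i, by simpa using hi⟩).symm)
  rw [hprob] at h
  exact h

/-- On an encoded instance the prover counts the input bits, so his delay is `n` blocks. The
schedule of the verifier is in turn, and the memory is large enough because its width is the bound
for the number of rounds. -/
theorem fidelity_prover (hG : ∀ g, G.arity g ≤ a) (pos : 0 < n + 1) (gs : List (Gate G))
    (hg : ∀ g ∈ gs, g.Valid (n + 1)) (input : Fin (n + 1) → Bool) :
    fidelity ((prover G c m).strategy (Instance.mk (n + 1) pos gs hg input).encode) c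
      (gs.flatMap (gateJobs hG n)) = 1 := by
  set I := Instance.mk (n + 1) pos gs hg input with hI
  obtain ⟨w, hw⟩ : ∃ w, w = (roundBound c m).eval I.encode.length := ⟨_, rfl⟩
  have hlen := length_encode I
  have hdelay : Memory.delay (c + 1) Sum.isLeft I.encode = n * (c + 1) := by
    have h1 : (I.encode.countP Sum.isLeft) = n + 1 := by
      rw [encode_eq, List.countP_append, List.countP_map, List.countP_map]
      have e1 : List.countP (Sum.isLeft ∘ Sum.inl (β := Token G)) (List.ofFn I.input) =
          (List.ofFn I.input).length := List.countP_eq_length.2 fun _ _ => rfl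
      have e2 : List.countP (Sum.isLeft ∘ Sum.inr (α := Bool)) (I.gates.flatMap Gate.encode) =
          0 := List.countP_eq_zero.2 fun _ _ => by simp
      rw [e1, e2, List.length_ofFn]
    rw [Memory.delay, h1, Nat.add_sub_cancel, mul_comm]
  obtain ⟨K', hK, hturn⟩ := Memory.inTurn_circuit (n := n) hG gs 1
  have hbound : (K' * (n + 1) + 1) * (c + 1) ≤ w := by
    rw [hw, eval_roundBound, hlen, mul_comm]
    refine Nat.mul_le_mul (by unfold Program.cost; omega) ?_
    simp only [hI]
    revert hK
    generalize (gs.flatMap Gate.encode).length = l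
    intro hK
    nlinarith [Nat.mul_le_mul_right (n + 1) hK]
  have hle : (n + 1) * (c + 1) ≤ w := by
    refine le_trans (Nat.mul_le_mul_right _ ?_) hbound
    have := hturn.le
    rw [one_mul] at this
    exact this.trans (Nat.le_succ _)
  have key : (attack (Program.exchangeBlock (Memory.operator w (n * (c + 1)))) 0
      (gs.flatMap (gateJobs hG n)) (n + 1)
      (initMemo (Program.exchangeBlock (Memory.operator w (n * (c + 1))))
        (Memory.basisState (c := c) (fun _ => false) fun _ => false) (n + 1))).sqNorm = 1 := by
    have h1 : (initMemo (Program.exchangeBlock (Memory.operator w (n * (c + 1))))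
        (Memory.basisState (c := c) (fun _ => false) fun _ => false) (n + 1)) = fun r =>
        ((Real.sqrt (blockDim c) : ℂ)⁻¹ ^ (n + 1)) •
          Memory.stateBefore w n (Memory.repeated r) (n + 1) := by
      funext r
      rw [Memory.initMemo_eq (n + 1) le_rfl hle, Memory.stateBefore_extend]
    rw [h1]
    rw [one_mul] at hturn
    exact Memory.sqNorm_attack hturn le_rfl (Nat.mul_mod_left _ _) hbound
  subst hw
  have hop : (fun t => (((prover G c m).strategy I.encode).act
      (List.replicate (t + 1) .quantum)).1) =
      Memory.operator ((roundBound c m).eval I.encode.length) (n * (c + 1)) := by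
    funext t
    have : (prover G c m).circuit (I.encode, List.replicate (t + 1) .quantum) =
        Memory.swapGates (t + 1) ++ Memory.swapGates (t + 1 - n * (c + 1)) := by
      change Memory.circuit (c + 1) Sum.isLeft _ = _
      rw [Memory.circuit, List.length_replicate, hdelay]
    change (splitFirst (circuitUnitary _
      ((prover G c m).circuit (I.encode, List.replicate (t + 1) .quantum)))).1 = _
    rw [this]
    rfl
  have hinit : initBlock ((prover G c m).strategy I.encode) c =
      Memory.basisState (fun _ => false) fun _ => false := by
    funext h z
    by_cases hh : h = fun _ => false
    · by_cases hz : z = fun _ => false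
      · subst hz
        simp [initBlock, Memory.basisState, hh, BQPProver.strategy]
      · rw [initBlock, if_pos hh]
        exact (Pi.single_eq_of_ne hz 1).trans (if_neg fun h => hz h.2).symm
    · simp [initBlock, Memory.basisState, hh]
  rw [fidelity, hop, hinit]
  exact key

theorem Instance.prob_nonneg (I : Instance G) : 0 ≤ I.prob :=
  Finset.sum_nonneg fun y _ => by split_ifs <;> positivity

/-- With fidelity `1` the lower bound is the acceptance probability of the circuit. On a NO instance
`p * F + δ * (1 - F) ≤ p + δ ≤ γ + ε`. -/
theorem hasQPIP_of_code (hG : ∀ g, G.arity g ≤ a) (𝒞 : Code c m δ) (hδ : 0 < δ) {ε γ : ℝ}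
    (hε : δ ≤ ε) :
    HasQPIP ((a + 1) + (c + 1)) (qCircuitYes G γ) (qCircuitNo G γ) (1 - γ) (ε + γ) := by
  refine ⟨verifier hG 𝒞, prover G c m, ?_, ?_⟩
  · rintro _ ⟨⟨n | n, pos, gs, hg, input⟩, rfl, hI⟩
    · exact absurd pos (lt_irrefl 0)
    · have h := (acceptProb_bounds hG 𝒞 hδ.le ((prover G c m).strategy
        (Instance.mk (n + 1) pos gs hg input).encode) pos gs hg input).1
      rw [fidelity_prover, mul_one] at h
      exact hI.trans h
  · rintro _ ⟨⟨n | n, pos, gs, hg, input⟩, rfl, hI⟩ S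
    · exact absurd pos (lt_irrefl 0)
    · have h := acceptProb_bounds hG 𝒞 hδ.le S pos gs hg input
      set F := fidelity S c (gs.flatMap (gateJobs hG n))
      have h0 : 0 ≤ F := by
        unfold F fidelity Memo.sqNorm
        positivity
      -- This follows from comparing the two bounds with each other: their difference `δ * (1 - F)`
      -- is nonnegative, and `δ > 0`.
      have h1 : F ≤ 1 := by
        by_contra hlt
        push Not at hlt
        have := h.1.trans h.2
        nlinarith
      have hp := Instance.prob_nonneg (Instance.mk (n + 1) pos gs hg input)
      refine h.2.trans ?_
      nlinarith

theorem exists_hasQPIP (hG : ∀ g, G.arity g ≤ a) {ε γ : ℝ} (hε : 0 < ε) (hε' : ε < 1) :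
    ∃ κ : ℕ, (κ : ℝ) ≤ (a + 10) * (1 + Real.log (1 / ε)) ∧
      HasQPIP κ (qCircuitYes G γ) (qCircuitNo G γ) (1 - γ) (ε + γ) := by
  have hlog : 0 < Real.log (1 / ε) := Real.log_pos (by rw [lt_div_iff₀ hε]; linarith)
  have hlog2 := Real.log_two_gt_d9
  -- The least `d` with `2 ^ d ≥ 1 / ε`, so that the error `(2 ^ d)⁻¹` of the code is at most `ε`.
  obtain ⟨d, hd⟩ : ∃ d, d = ⌈Real.log (1 / ε) / Real.log 2⌉₊ := ⟨_, rfl⟩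
  have h1 : Real.log (1 / ε) / Real.log 2 ≤ d := hd ▸ Nat.le_ceil _
  have h2 : (d : ℝ) < Real.log (1 / ε) / Real.log 2 + 1 :=
    hd ▸ Nat.ceil_lt_add_one (by positivity)
  have hd0 : d ≠ 0 := by
    rintro rfl
    have : 0 < Real.log (1 / ε) / Real.log 2 := by positivity
    push_cast at h1
    linarith
  obtain ⟨𝒞⟩ := exists_code d hd0
  refine ⟨_, ?_, hasQPIP_of_code hG 𝒞 (by positivity) ?_⟩
  · have h3 : a + 1 + (3 * d - 1 + 1) = a + 1 + 3 * d := by omega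
    rw [h3]
    -- From `log 2 ≥ 1 / 2`. Hence the number of qubits `a + 1 + 3 * d` is below `a + 4 + 6 * log (1
    -- / ε)`, which the constant `a + 10` covers.
    have h4 : Real.log (1 / ε) / Real.log 2 ≤ 2 * Real.log (1 / ε) := by
      rw [div_le_iff₀ (by linarith)]
      nlinarith
    push_cast
    nlinarith [mul_nonneg (Nat.cast_nonneg (α := ℝ) a) hlog.le]
  · rw [div_le_iff₀ (by linarith), ← Real.log_pow, Real.log_le_log_iff (by positivity)
      (by positivity)] at h1
    rw [inv_le_comm₀ (by positivity) hε, ← one_div]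
    exact h1

end
end QPIP

theorem mainTheorem2 (a : ℕ) :
    ∃ C : ℝ, ∀ G : QPIP.GateSet, (∀ g, G.arity g ≤ a) →
      ∀ ε γ : ℝ, 0 < ε → ε < 1 → γ < 1 - ε →
        ∃ κ : ℕ, (κ : ℝ) ≤ C * (1 + Real.log (1 / ε)) ∧
          QPIP.HasQPIP κ (QPIP.qCircuitYes G γ) (QPIP.qCircuitNo G γ) (1 - γ) (ε + γ) :=
  ⟨a + 10, fun _ hG _ _ hε hε' _ => QPIP.exists_hasQPIP hG hε hε'⟩
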